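/- Let $f\in C^\infty(\mathbb R)$ satisfy $f''\ge 0$ on $\mathbb R$, let $u_0\in\mathbb R$, $e_1,e_2>0$, $x_1^0<x_2^0$, and suppose that $f''$ does not vanish identically on $[u_0,u_0+e_1+e_2]$ (for example, $f''>0$ there). Consider $L[u]:=u_t+(f(u))_x=0$, $t\ge 0$, with the initial value $$u^{*0}(x)=\begin{cases}u_0+e_1+e_2,&x<x_1^0,\\ u_0+e_2,&x_1^0<x<x_2^0,\\ u_0,&x>x_2^0.\end{cases}$$ Let $H$ be the Heaviside function and put $$D=e_2f(u_0+e_1+e_2)-(e_1+e_2)f(u_0+e_2)+e_1f(u_0),\qquad t^*=\frac{e_1e_2(x_2^0-x_1^0)}{D},$$ $$s_1=\frac{f(u_0+e_1+e_2)-f(u_0+e_2)}{e_1},\qquad s_2=\frac{f(u_0+e_2)-f(u_0)}{e_2},$$ $$\phi_1(t)=x_1^0+s_1t-(s_1-s_2)\frac{e_2}{e_1+e_2}(t-t^*)H(t-t^*),$$ $$\phi_2(t)=x_2^0+s_2t+(s_1-s_2)\frac{e_1}{e_1+e_2}(t-t^*)H(t-t^*),$$ $$u^*(x,t)=u_0+e_1H(-x+\phi_1(t))+e_2H(-x+\phi_2(t)).$$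 Then the following hold. 1. The function $u^*$ is a generalized solution of the Cauchy problem in the sense of weak limits of asymptotic solutions. That is, for any smooth kernels $\omega_1,\omega_2\ge0$ on $\mathbb R$ with $\int\omega_k=1$ and $\omega_k(z)=O((1+|z|)^{-N})$ for every $N$, there are phases $\Phi_1(t,\varepsilon),\Phi_2(t,\varepsilon)$, smooth in $t$ for each $\varepsilon>0$, such that the functions $$u_\varepsilon(x,t)=u_0+\sum_{k=1}^2e_kH(-x+\Phi_k(t,\varepsilon)),\qquad u(x,t,\varepsilon)=u_0+\sum_{k=1}^2e_k\int_{-\infty}^{(-x+\Phi_k(t,\varepsilon))/\varepsilon}\omega_k(\eta)\,d\eta$$ satisfy, as $\varepsilon\to+0$: $L[u(\cdot,t,\varepsilon)]=O_{\mathcal D'}(\varepsilon)$ uniformly in $t\in[0,T]$ for every $T>0$; $u_\varepsilon(\cdot,0)-u^{*0}=O_{\mathcal D'}(\varepsilon)$; and $u_\varepsilon(\cdot,t)\to u^*(\cdot,t)$ in $\mathcal D'(\mathbb R)$ for every $t\ge0$. Here a family $F_\varepsilon$ of distributions in $x$ is $O_{\mathcal D'}(\varepsilon)$ if $\langle F_\varepsilon,\varphi\rangle=O(\varepsilon)$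 for every $\varphi\in\mathcal D(\mathbb R)$. 2. We have $t^*>0$. For $0\le t<t^*$ we have $\phi_1(t)=x_1^0+s_1t<\phi_2(t)=x_2^0+s_2t$ (two shocks moving with the Rankine–Hugoniot speeds). For $t\ge t^*$ the shocks have merged into one: $$\phi_1(t)=\phi_2(t)=x^*+\frac{f(u_0+e_1+e_2)-f(u_0)}{e_1+e_2}(t-t^*),$$ $$x^*=\frac{[f(u_0+e_1+e_2)-f(u_0+e_2)]e_2x_2^0-[f(u_0+e_2)-f(u_0)]e_1x_1^0}{D}.$$ 3. For every $T>0$, $u^*$ is the unique (up to equality almost everywhere) generalized solution of the Cauchy problem in $\Omega=\mathbb R\times(0,T)$ in the sense of the integral identity. That is, it is the unique function $u$ which is bounded on $\Omega$, is $C^\infty$ in $\Omega$ off a locally finite family of continuous curves $x=\gamma_i(t)$, satisfies the stability condition that at each of its discontinuity points in $\Omega$ the one-sided limits exist and $u(x-0,t)>u(x+0,t)$, satisfies $$\iint_{\Omega}\big[u\,\varphi_t+f(u)\,\varphi_x\big]\,dx\,dt=0\qquad\text{for all }\varphi\in\mathcal D(\Omega),$$ and attains the initial value weakly: $u(\cdot,t)\to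 u^{*0}$ in $\mathcal D'(\mathbb R)$ as $t\to+0$. -/

import Mathlib

open Set Filter Topology MeasureTheory
open scoped ContDiff

namespace Shock

noncomputable section

/-- The Heaviside function (its value at `0` is immaterial). -/
def heaviside (ξ : ℝ) : ℝ := if 0 < ξ then 1 else 0

/-- Test functions of the variable `x`, i.e. elements of `𝓓(ℝ)`. -/
def IsTest (φ : ℝ → ℝ) : Prop := ContDiff ℝ ∞ φ ∧ HasCompactSupport φ

/-! ### Approximations of the Heaviside function -/

/-- An averaging kernel `κ`: smooth, nonnegative, of integral one, and decreasing faster than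
every power (compactly supported kernels are a special case). -/
structure IsKernel (κ : ℝ → ℝ) : Prop where
  smooth : ContDiff ℝ ∞ κ
  nonneg : ∀ z, 0 ≤ κ z
  integral_eq_one : ∫ z, κ z = 1
  decay : ∀ N : ℕ, ∃ C : ℝ, ∀ z, κ z * (1 + |z|) ^ N ≤ C

/-- `H(ξ, ε) = ∫_{-∞}^{ξ/ε} κ(η) dη`, the smooth approximation of the Heaviside function. -/
def heavisideApprox (κ : ℝ → ℝ) (ξ ε : ℝ) : ℝ := ∫ η in Iic (ξ / ε), κ η

/-! ### Ansatzes, asymptotic solutions and their weak limits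

A function of `(x, t)` is written `u x t`, a phase depending on the small parameter is written
`Φ t ε`. -/

/-- The singular two-shock ansatz
`U(x,t) + ∑ₖ Eₖ(x,t) H(-x + Φₖ(t,ε))`. -/
def singularAnsatz (U : ℝ → ℝ → ℝ) (E Φ : Fin 2 → ℝ → ℝ → ℝ) (x t ε : ℝ) : ℝ :=
  U x t + ∑ k, E k x t * heaviside (-x + Φ k t ε)

/-- The smooth two-shock ansatz
`U(x,t) + ∑ₖ Eₖ(x,t) Hₖ(-x + Φₖ(t,ε), ε)`. -/
def smoothAnsatz (κ : Fin 2 → ℝ → ℝ) (U : ℝ → ℝ → ℝ) (E Φ : Fin 2 → ℝ → ℝ → ℝ)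
    (x t ε : ℝ) : ℝ :=
  U x t + ∑ k, E k x t * heavisideApprox (κ k) (-x + Φ k t ε) ε

/-- `L[u] = u_t + (f(u))_x`, for functions with classical derivatives. -/
def lawOperator (f : ℝ → ℝ) (u : ℝ → ℝ → ℝ) (x t : ℝ) : ℝ :=
  deriv (fun s => u x s) t + deriv (fun y => f (u y t)) x

/-- `F(·, t, ε) = O_{𝓓'}(ε)` as `ε → +0`, uniformly with respect to `t ∈ I`; here `F x t ε` is a
family of distributions in `x`, while `t` and `ε` are parameters. -/
def IsBigODistrib (F : ℝ → ℝ → ℝ → ℝ) (I : Set ℝ) : Prop :=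
  ∀ φ : ℝ → ℝ, IsTest φ → ∃ C : ℝ, ∃ ε₀ > 0, ∀ ε ∈ Ioo 0 ε₀, ∀ t ∈ I,
    |∫ x, F x t ε * φ x| ≤ C * ε

/-- The ansatz with coefficients `U`, `E` and phases `Φ` is a generalized asymptotic solution of
`u_t + (f(u))_x = 0` for `t ∈ [0, T]` with initial value `g`. -/
structure IsAsymptoticSolution (f : ℝ → ℝ) (κ : Fin 2 → ℝ → ℝ) (U : ℝ → ℝ → ℝ)
    (E Φ : Fin 2 → ℝ → ℝ → ℝ) (g : ℝ → ℝ) (T : ℝ) : Prop where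
  smooth_background : ContDiff ℝ ∞ (fun p : ℝ × ℝ => U p.1 p.2)
  smooth_amplitude : ∀ k, ContDiff ℝ ∞ (fun p : ℝ × ℝ => E k p.1 p.2)
  smooth_phase : ∀ k, ∀ ε > 0, ContDiff ℝ ∞ (fun t => Φ k t ε)
  equation : IsBigODistrib
    (fun x t ε => lawOperator f (fun y s => smoothAnsatz κ U E Φ y s ε) x t) (Icc 0 T)
  initial : IsBigODistrib (fun x t ε => singularAnsatz U E Φ x t ε - g x) {0}

/-- `u` is a generalized solution, on `[0, ∞)`, of the Cauchy problem for `u_t + (f(u))_x = 0` with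
initial value `g`: the weak limit as `ε → +0` of an asymptotic solution with coefficients `U`, `E`
built with the kernels `κ`. -/
def IsWeakLimitSolution (f : ℝ → ℝ) (κ : Fin 2 → ℝ → ℝ) (U : ℝ → ℝ → ℝ)
    (E : Fin 2 → ℝ → ℝ → ℝ) (g : ℝ → ℝ) (u : ℝ → ℝ → ℝ) : Prop :=
  ∃ Φ : Fin 2 → ℝ → ℝ → ℝ,
    (∀ T > 0, IsAsymptoticSolution f κ U E Φ g T) ∧
    ∀ t ≥ 0, ∀ φ : ℝ → ℝ, IsTest φ →
      Tendsto (fun ε => ∫ x, singularAnsatz U E Φ x t ε * φ x) (𝓝[>] 0)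
        (𝓝 (∫ x, u x t * φ x))

/-! ### Generalized solutions in the sense of the integral identity -/

/-- The strip `ℝ × (0, T)`; points are `(x, t)`. -/
def strip (T : ℝ) : Set (ℝ × ℝ) := univ ×ˢ Ioo 0 T

/-- The integral identity `∫∫ (u φ_t + f(u) φ_x) dx dt = 0` for all test functions in the strip. -/
def IntegralIdentity (f : ℝ → ℝ) (T : ℝ) (u : ℝ → ℝ → ℝ) : Prop :=
  ∀ φ : ℝ → ℝ → ℝ, ContDiff ℝ ∞ (fun p : ℝ × ℝ => φ p.1 p.2) →
    HasCompactSupport (fun p : ℝ × ℝ => φ p.1 p.2) →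
    tsupport (fun p : ℝ × ℝ => φ p.1 p.2) ⊆ strip T →
    ∫ p in strip T, (u p.1 p.2 * deriv (fun s => φ p.1 s) p.2 +
      f (u p.1 p.2) * deriv (fun y => φ y p.2) p.1) = 0

/-- `u` is smooth in the strip outside a locally finite family of continuous curves `x = γᵢ(t)`,
`t ∈ Jᵢ`, where the `Jᵢ` are (possibly empty) intervals. -/
def IsPiecewiseSmooth (T : ℝ) (u : ℝ → ℝ → ℝ) : Prop :=
  ∃ (J : ℕ → Set ℝ) (γ : ℕ → ℝ → ℝ),
    (∀ i, (J i).OrdConnected) ∧ (∀ i, ContinuousOn (γ i) (J i)) ∧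
    (∀ p ∈ strip T, ∃ V ∈ 𝓝 p, {i | ∃ t ∈ J i, (γ i t, t) ∈ V}.Finite) ∧
    ∀ p ∈ strip T, (∀ i, p.2 ∈ J i → p.1 ≠ γ i p.2) →
      ContDiffAt ℝ ∞ (fun q : ℝ × ℝ => u q.1 q.2) p

/-- The stability condition: at every point of discontinuity in the strip the one-sided limits
exist and `u(x-0, t) > u(x+0, t)`. -/
def IsStable (T : ℝ) (u : ℝ → ℝ → ℝ) : Prop :=
  ∀ p ∈ strip T, ¬ ContinuousAt (fun q : ℝ × ℝ => u q.1 q.2) p →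
    ∃ l r : ℝ, Tendsto (fun x => u x p.2) (𝓝[<] p.1) (𝓝 l) ∧
      Tendsto (fun x => u x p.2) (𝓝[>] p.1) (𝓝 r) ∧ r < l

/-- `u` is a (bounded, piecewise smooth, stable) generalized solution of the Cauchy problem for
`u_t + (f(u))_x = 0` on `ℝ × (0, T)` with initial value `g`, in the sense of the integral identity;
the initial value is attained weakly. -/
structure IsIntegralSolution (f : ℝ → ℝ) (T : ℝ) (g : ℝ → ℝ) (u : ℝ → ℝ → ℝ) : Prop where
  bounded : ∃ M : ℝ, ∀ p ∈ strip T, |u p.1 p.2| ≤ M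
  piecewise_smooth : IsPiecewiseSmooth T u
  stable : IsStable T u
  identity : IntegralIdentity f T u
  initial : ∀ φ : ℝ → ℝ, IsTest φ →
    Tendsto (fun t => ∫ x, u x t * φ x) (𝓝[>] 0) (𝓝 (∫ x, g x * φ x))

/-! ### The explicit objects of the two-shock problem -/

/-- The piecewise constant initial value with two downward jumps `e₁`, `e₂` at `x₁ < x₂`. -/
def initialData (u₀ e₁ e₂ x₁ x₂ x : ℝ) : ℝ :=
  if x < x₁ then u₀ + e₁ + e₂ else if x < x₂ then u₀ + e₂ else u₀

/-- The Rankine–Hugoniot speed of a shock between the states `a` and `b`. -/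
def speed (f : ℝ → ℝ) (a b : ℝ) : ℝ := (f a - f b) / (a - b)

/-- The merging time `t*`. -/
def mergeTime (f : ℝ → ℝ) (u₀ e₁ e₂ x₁ x₂ : ℝ) : ℝ :=
  e₁ * e₂ * ((x₂ - x₁) /
    (e₂ * f (u₀ + e₁ + e₂) - (e₁ + e₂) * f (u₀ + e₂) + e₁ * f u₀))

/-- The merging point `x*`. -/
def mergePoint (f : ℝ → ℝ) (u₀ e₁ e₂ x₁ x₂ : ℝ) : ℝ :=
  ((f (u₀ + e₁ + e₂) - f (u₀ + e₂)) * e₂ * x₂ - (f (u₀ + e₂) - f u₀) * e₁ * x₁) /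
    (e₂ * f (u₀ + e₁ + e₂) - (e₁ + e₂) * f (u₀ + e₂) + e₁ * f u₀)

/-- The phase `φ₁(t)`. -/
def phase₁ (f : ℝ → ℝ) (u₀ e₁ e₂ x₁ x₂ t : ℝ) : ℝ :=
  x₁ + (f (u₀ + e₁ + e₂) - f (u₀ + e₂)) / e₁ * t -
    ((f (u₀ + e₁ + e₂) - f (u₀ + e₂)) / e₁ - (f (u₀ + e₂) - f u₀) / e₂) * (e₂ / (e₁ + e₂)) *
      (t - mergeTime f u₀ e₁ e₂ x₁ x₂) * heaviside (t - mergeTime f u₀ e₁ e₂ x₁ x₂)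

/-- The phase `φ₂(t)`. -/
def phase₂ (f : ℝ → ℝ) (u₀ e₁ e₂ x₁ x₂ t : ℝ) : ℝ :=
  x₂ + (f (u₀ + e₂) - f u₀) / e₂ * t +
    ((f (u₀ + e₁ + e₂) - f (u₀ + e₂)) / e₁ - (f (u₀ + e₂) - f u₀) / e₂) * (e₁ / (e₁ + e₂)) *
      (t - mergeTime f u₀ e₁ e₂ x₁ x₂) * heaviside (t - mergeTime f u₀ e₁ e₂ x₁ x₂)

/-- `u*(x,t) = u₀ + e₁ H(-x + φ₁(t)) + e₂ H(-x + φ₂(t))`. -/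
def twoShock (f : ℝ → ℝ) (u₀ e₁ e₂ x₁ x₂ x t : ℝ) : ℝ :=
  u₀ + e₁ * heaviside (-x + phase₁ f u₀ e₁ e₂ x₁ x₂ t) +
    e₂ * heaviside (-x + phase₂ f u₀ e₁ e₂ x₁ x₂ t)

end

end Shock

namespace Shock

noncomputable section

/-! ### Convexity of the flux -/

/-! Convexity gives `D ≥ 0`, and `D = 0` would force `f` to be affine on `[u₀, u₀ + e₁ + e₂]`. Hence
`D > 0` (`three_point_pos`), which is the same as `s₁ > s₂`: the left shock catches up with the
right one. The formulas for the phases follow by algebra, best done in the coordinates barycentre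
and distance: the barycentre moves uniformly, and the distance is `max (d - c t) 0` with `d = x₂ -
x₁`, `c = s₁ - s₂`.

Weak limit. The asymptotic phases keep the exact barycentre and replace the distance by a smooth
`δ`. Paired with a test function `φ`, the equation becomes, up to `O(ε)`, the sum of the two
Rankine–Hugoniot defects times `φ` at the shocks (`exists_equation_bound`). The defects are
opposite, so what is left is a constant times `(δ' + c) (φ(Φ₂) - φ(Φ₁))`, of size at most a constant
times `|δ' + c| δ`. Before merging the first factor is small, afterwards the second; for the
explicit `smoothGap` the product is at most `c ε`.

Integral identity. A solution has a potential `U` with `U_x = u`, `U_t = -f(u)`. The potential of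
`u*` is the minimum of the three affine functions `p x - f(p) t + const` of its states
(`exists_strict_min`). Its regularisation `softmin` has a gradient that converges boundedly almost
everywhere to `(u*, -f(u*))`, and the identity is the limit of the vanishing of a curl
(`integral_gradient_cross_eq_zero`).

Uniqueness. Every solution `v` has a Lipschitz potential `U` (`IsRegular.exists_potential`). It is
squeezed by a maximum principle run at penalized minima. Jensen's inequality for spatial averages
puts `U` below each affine solution (`IsPotential.le_affine`). In the other direction a soft minimum
is a subsolution, since its gradient is a convex combination of gradients of solutions, and
stability keeps the minimum of `U - softmin` away from discontinuities: there `U` has a concave kink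
(`IsPotential.softmin_le`). Letting the smoothing parameter tend to zero, `U` is the minimum of the
three affine functions, and `v = U_x = u*` almost everywhere. -/

lemma tangent_le {f : ℝ → ℝ} (hf : ContDiff ℝ ∞ f) (hconvex : ∀ v, 0 ≤ deriv (deriv f) v)
    (p v : ℝ) : f p + deriv f p * (v - p) ≤ f v := by
  have hd : Differentiable ℝ f := hf.differentiable (by simp)
  have hd' : Differentiable ℝ (deriv f) :=
    (contDiff_infty_iff_deriv.1 hf).2.differentiable (by simp)
  have hc : ConvexOn ℝ univ f :=
    convexOn_univ_of_deriv2_nonneg hd hd' (fun x => by simpa using hconvex x)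
  rcases lt_trichotomy p v with h | h | h
  · have := hc.deriv_le_slope (mem_univ p) (mem_univ v) h (hd p)
    rw [slope_def_field, le_div_iff₀ (by linarith)] at this
    linarith
  · simp [h]
  · have := hc.slope_le_deriv (mem_univ v) (mem_univ p) h (hd p)
    rw [slope_def_field, div_le_iff₀ (by linarith)] at this
    linarith

/-- The tangent inequalities at `u₀ + e₂`, evaluated at the two end states and weighted by `e₂` and
`e₁`, add up to `D ≥ 0`. Equality forces equality in both, hence an affine `f` on the whole
interval, against the nondegeneracy. -/
lemma three_point_pos {f : ℝ → ℝ} {u₀ e₁ e₂ : ℝ} (hf : ContDiff ℝ ∞ f)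
    (hconvex : ∀ v, 0 ≤ deriv (deriv f) v)
    (hnondeg : ∃ v ∈ Icc u₀ (u₀ + e₁ + e₂), 0 < deriv (deriv f) v)
    (he₁ : 0 < e₁) (he₂ : 0 < e₂) :
    0 < e₂ * f (u₀ + e₁ + e₂) - (e₁ + e₂) * f (u₀ + e₂) + e₁ * f u₀ := by
  have hT := tangent_le hf hconvex
  set q := deriv f (u₀ + e₂) with hq
  have ha := hT (u₀ + e₂) (u₀ + e₁ + e₂)
  have hb := hT (u₀ + e₂) u₀
  rw [← hq] at ha hb
  by_contra hD
  push Not at hD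
  have ea : f (u₀ + e₁ + e₂) = f (u₀ + e₂) + q * e₁ := by nlinarith
  have eb : f u₀ = f (u₀ + e₂) - q * e₂ := by nlinarith
  -- the graph lies on its tangent over the whole interval
  have haff : ∀ v ∈ Icc u₀ (u₀ + e₁ + e₂), f v = f (u₀ + e₂) + q * (v - (u₀ + e₂)) := by
    intro v hv
    refine le_antisymm ?_ (hT _ _)
    -- Tangents at `v`, evaluated at both ends with weights `v - u₀` and `u₀ + e₁ + e₂ - v`: the
    -- slope terms cancel.
    have h1 := hT v (u₀ + e₁ + e₂)
    have h2 := hT v u₀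
    rw [ea] at h1
    rw [eb] at h2
    have hw1 : 0 ≤ v - u₀ := by linarith [hv.1]
    have hw2 : 0 ≤ u₀ + e₁ + e₂ - v := by linarith [hv.2]
    have := mul_le_mul_of_nonneg_left h1 hw1
    have := mul_le_mul_of_nonneg_left h2 hw2
    nlinarith
  have hcont : Continuous (deriv (deriv f)) :=
    (contDiff_infty_iff_deriv.1 (contDiff_infty_iff_deriv.1 hf).2).2.continuous
  obtain ⟨v, hv, hpos⟩ := hnondeg
  -- The point where `f'' > 0` may be an endpoint; continuity of `f''` moves it into the open
  -- interval, where `f` agrees with the affine function on a neighbourhood.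
  have hcl : v ∈ closure (Ioo u₀ (u₀ + e₁ + e₂)) := by
    rw [closure_Ioo (by linarith)]; exact hv
  obtain ⟨w, hw, hwI⟩ := mem_closure_iff.1 hcl _ (isOpen_lt continuous_const hcont) hpos
  have hev : f =ᶠ[𝓝 w] fun v => f (u₀ + e₂) + q * (v - (u₀ + e₂)) := by
    filter_upwards [Ioo_mem_nhds hwI.1 hwI.2] with z hz using haff z (Ioo_subset_Icc_self hz)
  have h1 := hev.deriv.deriv_eq
  have h2 : deriv (fun v => f (u₀ + e₂) + q * (v - (u₀ + e₂))) = fun _ => q := by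
    funext z
    simp
  rw [h2] at h1
  simp only [deriv_const] at h1
  exact absurd hw (by simp [h1])

/-! ### The phases -/

lemma sub_mul_heaviside (y : ℝ) : y * heaviside y = max y 0 := by
  unfold heaviside
  split_ifs with h
  · rw [max_eq_left h.le, mul_one]
  · rw [max_eq_right (not_lt.1 h), mul_zero]

section phases

variable {f : ℝ → ℝ} {u₀ e₁ e₂ x₁ x₂ : ℝ}

lemma three_point_eq (f : ℝ → ℝ) (u₀ : ℝ) (he₁ : 0 < e₁) (he₂ : 0 < e₂) :
    e₂ * f (u₀ + e₁ + e₂) - (e₁ + e₂) * f (u₀ + e₂) + e₁ * f u₀ =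
      e₁ * e₂ * ((f (u₀ + e₁ + e₂) - f (u₀ + e₂)) / e₁ - (f (u₀ + e₂) - f u₀) / e₂) := by
  field_simp
  ring

lemma speed_gap_pos (he₁ : 0 < e₁) (he₂ : 0 < e₂)
    (hD : 0 < e₂ * f (u₀ + e₁ + e₂) - (e₁ + e₂) * f (u₀ + e₂) + e₁ * f u₀) :
    0 < (f (u₀ + e₁ + e₂) - f (u₀ + e₂)) / e₁ - (f (u₀ + e₂) - f u₀) / e₂ := by
  rw [three_point_eq f u₀ he₁ he₂] at hD
  exact pos_of_mul_pos_right hD (by positivity)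

lemma speed_gap_mul_mergeTime (he₁ : 0 < e₁) (he₂ : 0 < e₂)
    (hD : 0 < e₂ * f (u₀ + e₁ + e₂) - (e₁ + e₂) * f (u₀ + e₂) + e₁ * f u₀) :
    ((f (u₀ + e₁ + e₂) - f (u₀ + e₂)) / e₁ - (f (u₀ + e₂) - f u₀) / e₂) *
      mergeTime f u₀ e₁ e₂ x₁ x₂ = x₂ - x₁ := by
  have hc := speed_gap_pos he₁ he₂ hD
  unfold mergeTime
  rw [three_point_eq f u₀ he₁ he₂]
  set c := (f (u₀ + e₁ + e₂) - f (u₀ + e₂)) / e₁ - (f (u₀ + e₂) - f u₀) / e₂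
  field_simp

lemma mergeTime_pos (he₁ : 0 < e₁) (he₂ : 0 < e₂) (hx : x₁ < x₂)
    (hD : 0 < e₂ * f (u₀ + e₁ + e₂) - (e₁ + e₂) * f (u₀ + e₂) + e₁ * f u₀) :
    0 < mergeTime f u₀ e₁ e₂ x₁ x₂ := by
  have : 0 < x₂ - x₁ := by linarith
  unfold mergeTime
  positivity

/-- Since `c t* = d`, the term switched on at `t*` is exactly what turns the signed distance `d - c
t` into its positive part. This removes `heaviside` and `t*` from the phases and makes their
continuity visible. -/
lemma gap_max_eq (t : ℝ) (he₁ : 0 < e₁) (he₂ : 0 < e₂)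
    (hD : 0 < e₂ * f (u₀ + e₁ + e₂) - (e₁ + e₂) * f (u₀ + e₂) + e₁ * f u₀) :
    ((f (u₀ + e₁ + e₂) - f (u₀ + e₂)) / e₁ - (f (u₀ + e₂) - f u₀) / e₂) *
      ((t - mergeTime f u₀ e₁ e₂ x₁ x₂) * heaviside (t - mergeTime f u₀ e₁ e₂ x₁ x₂)) =
    max (x₂ - x₁ - ((f (u₀ + e₁ + e₂) - f (u₀ + e₂)) / e₁ - (f (u₀ + e₂) - f u₀) / e₂) * t) 0
      - (x₂ - x₁ - ((f (u₀ + e₁ + e₂) - f (u₀ + e₂)) / e₁ - (f (u₀ + e₂) - f u₀) / e₂) * t) := by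
  have hc := speed_gap_pos he₁ he₂ hD
  have ht := speed_gap_mul_mergeTime (x₁ := x₁) (x₂ := x₂) he₁ he₂ hD
  rw [sub_mul_heaviside, ← ht]
  generalize (f (u₀ + e₁ + e₂) - f (u₀ + e₂)) / e₁ - (f (u₀ + e₂) - f u₀) / e₂ = c at *
  rcases le_total t (mergeTime f u₀ e₁ e₂ x₁ x₂) with h | h
  · rw [max_eq_right (by linarith), max_eq_left (by nlinarith)]; ring
  · rw [max_eq_left (by linarith), max_eq_right (by nlinarith)]; ring

/-- Coordinates adapted to the merging: `e₁ φ₁ + e₂ φ₂` is affine in `t` with slope the total jump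
of `f`, and only the distance feels the interaction. -/
lemma phase₁_eq (t : ℝ) (he₁ : 0 < e₁) (he₂ : 0 < e₂)
    (hD : 0 < e₂ * f (u₀ + e₁ + e₂) - (e₁ + e₂) * f (u₀ + e₂) + e₁ * f u₀) :
    phase₁ f u₀ e₁ e₂ x₁ x₂ t =
      (e₁ * x₁ + e₂ * x₂ + (f (u₀ + e₁ + e₂) - f u₀) * t - e₂ * max (x₂ - x₁ -
        ((f (u₀ + e₁ + e₂) - f (u₀ + e₂)) / e₁ - (f (u₀ + e₂) - f u₀) / e₂) * t) 0) /
        (e₁ + e₂) := by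
  have h := gap_max_eq (x₁ := x₁) (x₂ := x₂) t he₁ he₂ hD
  have hm := eq_add_of_sub_eq h.symm
  rw [hm]
  unfold phase₁
  generalize (t - mergeTime f u₀ e₁ e₂ x₁ x₂) = τ at *
  field_simp
  ring

lemma phase₂_eq (t : ℝ) (he₁ : 0 < e₁) (he₂ : 0 < e₂)
    (hD : 0 < e₂ * f (u₀ + e₁ + e₂) - (e₁ + e₂) * f (u₀ + e₂) + e₁ * f u₀) :
    phase₂ f u₀ e₁ e₂ x₁ x₂ t =
      (e₁ * x₁ + e₂ * x₂ + (f (u₀ + e₁ + e₂) - f u₀) * t + e₁ * max (x₂ - x₁ -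
        ((f (u₀ + e₁ + e₂) - f (u₀ + e₂)) / e₁ - (f (u₀ + e₂) - f u₀) / e₂) * t) 0) /
        (e₁ + e₂) := by
  have h := gap_max_eq (x₁ := x₁) (x₂ := x₂) t he₁ he₂ hD
  have hm := eq_add_of_sub_eq h.symm
  rw [hm]
  unfold phase₂
  generalize (t - mergeTime f u₀ e₁ e₂ x₁ x₂) = τ at *
  field_simp
  ring

lemma phase_sub (t : ℝ) (he₁ : 0 < e₁) (he₂ : 0 < e₂)
    (hD : 0 < e₂ * f (u₀ + e₁ + e₂) - (e₁ + e₂) * f (u₀ + e₂) + e₁ * f u₀) :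
    phase₂ f u₀ e₁ e₂ x₁ x₂ t - phase₁ f u₀ e₁ e₂ x₁ x₂ t = max (x₂ - x₁ -
        ((f (u₀ + e₁ + e₂) - f (u₀ + e₂)) / e₁ - (f (u₀ + e₂) - f u₀) / e₂) * t) 0 := by
  rw [phase₁_eq t he₁ he₂ hD, phase₂_eq t he₁ he₂ hD]
  field_simp
  ring

lemma phase₁_le_phase₂ (t : ℝ) (he₁ : 0 < e₁) (he₂ : 0 < e₂)
    (hD : 0 < e₂ * f (u₀ + e₁ + e₂) - (e₁ + e₂) * f (u₀ + e₂) + e₁ * f u₀) :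
    phase₁ f u₀ e₁ e₂ x₁ x₂ t ≤ phase₂ f u₀ e₁ e₂ x₁ x₂ t := by
  have := phase_sub (x₁ := x₁) (x₂ := x₂) t he₁ he₂ hD
  have := le_max_right (x₂ - x₁ -
        ((f (u₀ + e₁ + e₂) - f (u₀ + e₂)) / e₁ - (f (u₀ + e₂) - f u₀) / e₂) * t) 0
  linarith

lemma continuous_phase₁ (he₁ : 0 < e₁) (he₂ : 0 < e₂)
    (hD : 0 < e₂ * f (u₀ + e₁ + e₂) - (e₁ + e₂) * f (u₀ + e₂) + e₁ * f u₀) :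
    Continuous (phase₁ f u₀ e₁ e₂ x₁ x₂) := by
  rw [show phase₁ f u₀ e₁ e₂ x₁ x₂ = _ from funext fun t => phase₁_eq t he₁ he₂ hD]
  fun_prop

lemma continuous_phase₂ (he₁ : 0 < e₁) (he₂ : 0 < e₂)
    (hD : 0 < e₂ * f (u₀ + e₁ + e₂) - (e₁ + e₂) * f (u₀ + e₂) + e₁ * f u₀) :
    Continuous (phase₂ f u₀ e₁ e₂ x₁ x₂) := by
  rw [show phase₂ f u₀ e₁ e₂ x₁ x₂ = _ from funext fun t => phase₂_eq t he₁ he₂ hD]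
  fun_prop

lemma phases_before_merge {t : ℝ} (he₁ : 0 < e₁) (he₂ : 0 < e₂)
    (hD : 0 < e₂ * f (u₀ + e₁ + e₂) - (e₁ + e₂) * f (u₀ + e₂) + e₁ * f u₀)
    (ht : t < mergeTime f u₀ e₁ e₂ x₁ x₂) :
    phase₁ f u₀ e₁ e₂ x₁ x₂ t = x₁ + speed f (u₀ + e₁ + e₂) (u₀ + e₂) * t ∧
      phase₂ f u₀ e₁ e₂ x₁ x₂ t = x₂ + speed f (u₀ + e₂) u₀ * t ∧
      phase₁ f u₀ e₁ e₂ x₁ x₂ t < phase₂ f u₀ e₁ e₂ x₁ x₂ t := by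
  have hH : heaviside (t - mergeTime f u₀ e₁ e₂ x₁ x₂) = 0 := if_neg (by linarith)
  refine ⟨?_, ?_, ?_⟩
  · unfold phase₁ speed
    rw [hH, show u₀ + e₁ + e₂ - (u₀ + e₂) = e₁ by ring]; ring
  · unfold phase₂ speed
    rw [hH, show u₀ + e₂ - u₀ = e₂ by ring]; ring
  · have hc := speed_gap_pos he₁ he₂ hD
    have h := speed_gap_mul_mergeTime (x₁ := x₁) (x₂ := x₂) he₁ he₂ hD
    have h2 := phase_sub (x₁ := x₁) (x₂ := x₂) t he₁ he₂ hD
    have h3 : 0 < x₂ - x₁ -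
        ((f (u₀ + e₁ + e₂) - f (u₀ + e₂)) / e₁ - (f (u₀ + e₂) - f u₀) / e₂) * t := by
      rw [← h, ← mul_sub]
      exact mul_pos hc (by linarith)
    rw [max_eq_left h3.le] at h2
    linarith

lemma gap_max_eq_zero {t : ℝ} (he₁ : 0 < e₁) (he₂ : 0 < e₂)
    (hD : 0 < e₂ * f (u₀ + e₁ + e₂) - (e₁ + e₂) * f (u₀ + e₂) + e₁ * f u₀)
    (ht : mergeTime f u₀ e₁ e₂ x₁ x₂ ≤ t) :
    max (x₂ - x₁ -
        ((f (u₀ + e₁ + e₂) - f (u₀ + e₂)) / e₁ - (f (u₀ + e₂) - f u₀) / e₂) * t) 0 = 0 := by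
  have hc := speed_gap_pos he₁ he₂ hD
  have h := speed_gap_mul_mergeTime (x₁ := x₁) (x₂ := x₂) he₁ he₂ hD
  refine max_eq_right ?_
  rw [← h, ← mul_sub]
  exact mul_nonpos_of_nonneg_of_nonpos hc.le (by linarith)

/-- The line of the barycentre passes through `(x*, t*)`. -/
lemma merged_phase_eq {t : ℝ} (he₁ : 0 < e₁) (he₂ : 0 < e₂)
    (hD : 0 < e₂ * f (u₀ + e₁ + e₂) - (e₁ + e₂) * f (u₀ + e₂) + e₁ * f u₀) :
    (e₁ * x₁ + e₂ * x₂ + (f (u₀ + e₁ + e₂) - f u₀) * t) / (e₁ + e₂) =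
      mergePoint f u₀ e₁ e₂ x₁ x₂ +
        (f (u₀ + e₁ + e₂) - f u₀) / (e₁ + e₂) * (t - mergeTime f u₀ e₁ e₂ x₁ x₂) := by
  unfold mergePoint mergeTime
  generalize f (u₀ + e₁ + e₂) = A at *
  generalize f (u₀ + e₂) = B at *
  generalize f u₀ = C at *
  have hne : e₂ * A - (e₁ + e₂) * B + e₁ * C ≠ 0 := hD.ne'
  have h2 : e₁ + e₂ ≠ 0 := by positivity
  generalize hE : e₂ * A - (e₁ + e₂) * B + e₁ * C = E at *
  field_simp
  subst hE
  ring

lemma phases_after_merge {t : ℝ} (he₁ : 0 < e₁) (he₂ : 0 < e₂)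
    (hD : 0 < e₂ * f (u₀ + e₁ + e₂) - (e₁ + e₂) * f (u₀ + e₂) + e₁ * f u₀)
    (ht : mergeTime f u₀ e₁ e₂ x₁ x₂ ≤ t) :
    phase₁ f u₀ e₁ e₂ x₁ x₂ t = mergePoint f u₀ e₁ e₂ x₁ x₂ +
        (f (u₀ + e₁ + e₂) - f u₀) / (e₁ + e₂) * (t - mergeTime f u₀ e₁ e₂ x₁ x₂) ∧
      phase₂ f u₀ e₁ e₂ x₁ x₂ t = mergePoint f u₀ e₁ e₂ x₁ x₂ +
        (f (u₀ + e₁ + e₂) - f u₀) / (e₁ + e₂) * (t - mergeTime f u₀ e₁ e₂ x₁ x₂) := by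
  rw [phase₁_eq t he₁ he₂ hD, phase₂_eq t he₁ he₂ hD, gap_max_eq_zero he₁ he₂ hD ht,
    mul_zero, mul_zero, sub_zero, add_zero, merged_phase_eq he₁ he₂ hD]
  exact ⟨rfl, rfl⟩

end phases

/-! ### Approximate Heaviside functions -/

section kernel

variable {κ : ℝ → ℝ}

/-- A finite second moment is all that is needed of the decay of the kernel. -/
lemma IsKernel.integrable_mul_one_add_sq (hκ : IsKernel κ) :
    Integrable (fun z => κ z * (1 + z ^ 2)) := by
  -- Order 4: one factor `1 + z²` is the moment, the other leaves the integrable majorant `C / (1 +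
  -- z²)`.
  obtain ⟨C, hC⟩ := hκ.decay 4
  refine Integrable.mono' (integrable_inv_one_add_sq.const_mul C)
    (by have := hκ.smooth.continuous; fun_prop) (Eventually.of_forall fun z => ?_)
  have h0 := hκ.nonneg z
  have hp : (0 : ℝ) < 1 + z ^ 2 := by positivity
  rw [Real.norm_eq_abs, abs_of_nonneg (by positivity), ← div_eq_mul_inv, le_div_iff₀ hp]
  have h1 : 1 + z ^ 2 ≤ (1 + |z|) ^ 2 := by nlinarith [abs_nonneg z, sq_abs z]
  calc κ z * (1 + z ^ 2) * (1 + z ^ 2) = κ z * (1 + z ^ 2) ^ 2 := by ring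
    _ ≤ κ z * ((1 + |z|) ^ 2) ^ 2 := by gcongr
    _ = κ z * (1 + |z|) ^ 4 := by ring
    _ ≤ C := hC z

lemma IsKernel.integrable (hκ : IsKernel κ) : Integrable κ :=
  hκ.integrable_mul_one_add_sq.mono' hκ.smooth.continuous.aestronglyMeasurable
    (Eventually.of_forall fun z => by
      rw [Real.norm_eq_abs, abs_of_nonneg (hκ.nonneg z)]
      nlinarith [hκ.nonneg z, mul_nonneg (hκ.nonneg z) (sq_nonneg z)])

/-- Chebyshev's inequality with the weight `1 + z²`. -/
lemma setIntegral_kernel_le (hκ : IsKernel κ) {s : Set ℝ} (hs : MeasurableSet s) {y : ℝ}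
    (h : ∀ z ∈ s, y ^ 2 ≤ z ^ 2) :
    ∫ z in s, κ z ≤ (∫ z, κ z * (1 + z ^ 2)) / (1 + y ^ 2) := by
  have hp : (0 : ℝ) < 1 + y ^ 2 := by positivity
  rw [le_div_iff₀ hp, ← integral_mul_const]
  calc ∫ z in s, κ z * (1 + y ^ 2) ≤ ∫ z in s, κ z * (1 + z ^ 2) := by
        refine setIntegral_mono_on (hκ.integrable.mul_const _).integrableOn
          hκ.integrable_mul_one_add_sq.integrableOn hs fun z hz => ?_
        have := h z hz
        have := hκ.nonneg z
        gcongr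
    _ ≤ ∫ z, κ z * (1 + z ^ 2) :=
        setIntegral_le_integral hκ.integrable_mul_one_add_sq
          (Eventually.of_forall fun z => mul_nonneg (hκ.nonneg z) (by positivity))

lemma abs_primitive_sub_heaviside_le (hκ : IsKernel κ) (y : ℝ) :
    |(∫ z in Iic y, κ z) - heaviside y| ≤ (∫ z, κ z * (1 + z ^ 2)) * (1 + y ^ 2)⁻¹ := by
  rw [← div_eq_mul_inv]
  unfold heaviside
  split_ifs with hy
  · have h := intervalIntegral.integral_Iic_add_Ioi (b := y) hκ.integrable.integrableOn
      hκ.integrable.integrableOn (f := κ)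
    rw [hκ.integral_eq_one] at h
    have h' : (∫ z in Iic y, κ z) - 1 = -∫ z in Ioi y, κ z := by linarith
    rw [h', abs_neg, abs_of_nonneg (setIntegral_nonneg measurableSet_Ioi fun z _ => hκ.nonneg z)]
    exact setIntegral_kernel_le hκ measurableSet_Ioi fun z hz => by
      have : y < z := hz
      nlinarith
  · rw [sub_zero, abs_of_nonneg (setIntegral_nonneg measurableSet_Iic fun z _ => hκ.nonneg z)]
    exact setIntegral_kernel_le hκ measurableSet_Iic fun z hz => by
      have : z ≤ y := hz
      nlinarith

lemma heavisideApprox_mem (hκ : IsKernel κ) (y ε : ℝ) : heavisideApprox κ y ε ∈ Icc (0 : ℝ) 1 :=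
  ⟨setIntegral_nonneg measurableSet_Iic fun z _ => hκ.nonneg z, by
    rw [← hκ.integral_eq_one]
    exact setIntegral_le_integral hκ.integrable (Eventually.of_forall hκ.nonneg)⟩

lemma heaviside_mem (y : ℝ) : heaviside y ∈ Icc (0 : ℝ) 1 := by
  unfold heaviside; split_ifs <;> simp

lemma hasDerivAt_heavisideApprox (hκ : IsKernel κ) (y ε : ℝ) :
    HasDerivAt (fun y => heavisideApprox κ y ε) (κ (y / ε) / ε) y := by
  have hκc := hκ.smooth.continuous
  have h1 : HasDerivAt (fun z => ∫ η in Iic z, κ η) (κ (y / ε)) (y / ε) := by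
    have h2 : (fun z => ∫ η in Iic z, κ η) =
        fun z => (∫ η in (0 : ℝ)..z, κ η) + ∫ η in Iic 0, κ η := by
      funext z
      rw [← intervalIntegral.integral_Iic_sub_Iic hκ.integrable.integrableOn
        hκ.integrable.integrableOn]
      ring
    rw [h2]
    exact (intervalIntegral.integral_hasDerivAt_right (hκc.intervalIntegrable _ _)
      hκc.stronglyMeasurable.stronglyMeasurableAtFilter hκc.continuousAt).add_const _
  have h3 := h1.comp y ((hasDerivAt_id y).div_const ε)
  rw [mul_one_div] at h3
  exact h3

lemma measurable_heaviside : Measurable heaviside :=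
  Measurable.ite measurableSet_Ioi measurable_const measurable_const

lemma heaviside_div {ε : ℝ} (hε : 0 < ε) (y : ℝ) : heaviside (y / ε) = heaviside y := by
  unfold heaviside
  simp [div_pos_iff_of_pos_right hε]

/-- The tail bound `K / (1 + y²)` is integrable in `y = (a - x) / ε`. The change of variables
produces the factor `ε`, and `π` is the integral of `1 / (1 + y²)`. -/
lemma integrable_heavisideApprox_sub (hκ : IsKernel κ) {ε : ℝ} (hε : 0 < ε) (a : ℝ) :
    Integrable (fun x => |heavisideApprox κ (-x + a) ε - heaviside (-x + a)|) ∧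
    ∫ x, |heavisideApprox κ (-x + a) ε - heaviside (-x + a)| ≤
      (∫ z, κ z * (1 + z ^ 2)) * Real.pi * ε := by
  set K := ∫ z, κ z * (1 + z ^ 2)
  have hb : ∀ x, |heavisideApprox κ (-x + a) ε - heaviside (-x + a)| ≤
      K * (1 + ((a - x) / ε) ^ 2)⁻¹ := fun x => by
    rw [← heaviside_div hε, show a - x = -x + a by ring]
    exact abs_primitive_sub_heaviside_le hκ _
  have hi : Integrable (fun x => K * (1 + ((a - x) / ε) ^ 2)⁻¹) :=
    ((integrable_inv_one_add_sq.comp_div hε.ne').comp_sub_left a).const_mul K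
  have hm : AEStronglyMeasurable
      (fun x => |heavisideApprox κ (-x + a) ε - heaviside (-x + a)|) volume := by
    have h1 : Continuous (fun y => heavisideApprox κ y ε) :=
      continuous_iff_continuousAt.2 fun y => (hasDerivAt_heavisideApprox hκ y ε).continuousAt
    have h2 := measurable_heaviside
    have h3 : Measurable (fun x => |heavisideApprox κ (-x + a) ε - heaviside (-x + a)|) := by
      have h4 := h1.measurable
      exact ((h4.comp (by fun_prop : Measurable fun x : ℝ => -x + a)).sub
        (h2.comp (by fun_prop : Measurable fun x : ℝ => -x + a))).norm
    exact h3.aestronglyMeasurable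
  have hI : Integrable (fun x => |heavisideApprox κ (-x + a) ε - heaviside (-x + a)|) :=
    hi.mono' hm (Eventually.of_forall fun x => by simpa using hb x)
  refine ⟨hI, (integral_mono hI hi hb).trans (le_of_eq ?_)⟩
  rw [integral_const_mul, integral_sub_left_eq_self (fun x => (1 + (x / ε) ^ 2)⁻¹) volume a,
    Measure.integral_comp_div (fun x => (1 + x ^ 2)⁻¹) ε, integral_univ_inv_one_add_sq]
  simp [abs_of_pos hε]
  ring

end kernel

/-! ### Pairing step functions with test functions -/

section pairing

variable {φ : ℝ → ℝ}

lemma IsTest.deriv (hφ : IsTest φ) : IsTest (deriv φ) :=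
  ⟨(contDiff_infty_iff_deriv.1 hφ.1).2, hφ.2.deriv⟩

lemma IsTest.integrable (hφ : IsTest φ) : Integrable φ :=
  hφ.1.continuous.integrable_of_hasCompactSupport hφ.2

lemma IsTest.bound (hφ : IsTest φ) : ∃ B, 0 ≤ B ∧ ∀ x, |φ x| ≤ B := by
  obtain ⟨B, hB⟩ := hφ.1.continuous.bounded_above_of_compact_support hφ.2
  exact ⟨B, (norm_nonneg _).trans (hB 0), hB⟩

lemma heaviside_mul_eq_indicator (a : ℝ) (g : ℝ → ℝ) :
    (fun x => heaviside (-x + a) * g x) = (Iio a).indicator g := by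
  funext x
  unfold heaviside
  by_cases h : x < a
  · rw [if_pos (by linarith), indicator_of_mem (by exact h), one_mul]
  · rw [if_neg (by linarith), indicator_of_notMem (by exact h), zero_mul]

lemma integrable_heaviside_mul (a : ℝ) {g : ℝ → ℝ} (hg : Integrable g) :
    Integrable (fun x => heaviside (-x + a) * g x) := by
  rw [heaviside_mul_eq_indicator]
  exact hg.indicator measurableSet_Iio

lemma integral_heaviside_mul (a : ℝ) (g : ℝ → ℝ) :
    ∫ x, heaviside (-x + a) * g x = ∫ x in Iic a, g x := by
  rw [heaviside_mul_eq_indicator, integral_indicator measurableSet_Iio, integral_Iic_eq_integral_Iio]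

lemma integral_Iic_deriv (hφ : IsTest φ) (a : ℝ) : ∫ x in Iic a, deriv φ x = φ a := by
  have h := integral_Iic_of_hasDerivAt_of_tendsto (f := φ) (f' := deriv φ) (a := a) (m := 0)
    hφ.1.continuous.continuousWithinAt
    (fun x _ => (hφ.1.differentiable (by simp) x).hasDerivAt) hφ.deriv.integrable.integrableOn
    (hφ.2.is_zero_at_infty.mono_left atBot_le_cocompact)
  simpa using h

lemma abs_integral_heaviside_mul_sub_le (hφ : IsTest φ) {B : ℝ} (hB : ∀ x, |φ x| ≤ B) (a b : ℝ) :
    |(∫ x, heaviside (-x + a) * φ x) - ∫ x, heaviside (-x + b) * φ x| ≤ B * |a - b| := by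
  rw [integral_heaviside_mul, integral_heaviside_mul,
    intervalIntegral.integral_Iic_sub_Iic hφ.integrable.integrableOn hφ.integrable.integrableOn]
  exact intervalIntegral.norm_integral_le_of_norm_le_const (f := φ) fun x _ => hB x

lemma abs_sub_le_of_abs_deriv_le (hφ : IsTest φ) {B : ℝ} (hB : ∀ x, |deriv φ x| ≤ B) (a b : ℝ) :
    |φ a - φ b| ≤ B * |a - b| :=
  Convex.norm_image_sub_le_of_norm_deriv_le (𝕜 := ℝ) (s := univ) (f := φ)
    (fun x _ => hφ.1.differentiable (by simp) x) (fun x _ => hB x) convex_univ trivial trivial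

end pairing

/-! ### The conservation law on a smooth two-shock profile -/

section profile

variable {κ : Fin 2 → ℝ → ℝ} {f : ℝ → ℝ} {u₀ e₁ e₂ : ℝ}

lemma lipschitz_on_range (hf : ContDiff ℝ ∞ f) (p q : ℝ) :
    ∃ L, 0 ≤ L ∧ ∀ v ∈ Icc p q, ∀ w ∈ Icc p q, |f v - f w| ≤ L * |v - w| := by
  have hd : Continuous (deriv f) := (contDiff_infty_iff_deriv.1 hf).2.continuous
  obtain ⟨L, hL⟩ := isCompact_Icc.exists_bound_of_continuousOn (s := Icc p q) hd.continuousOn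
  refine ⟨max L 0, le_max_right _ _, fun v hv w hw => ?_⟩
  exact Convex.norm_image_sub_le_of_norm_deriv_le (𝕜 := ℝ) (f := f)
    (fun x _ => hf.differentiable (by simp) x) (fun x hx => (hL x hx).trans (le_max_left _ _))
    (convex_Icc p q) hw hv

/-- Pairing the equation with a test function: all approximate Heaviside functions may be replaced
by the exact ones, with an error proportional to `ε`. -/
lemma exists_equation_bound (hf : ContDiff ℝ ∞ f) (hκ : ∀ k, IsKernel (κ k))
    (he₁ : 0 < e₁) (he₂ : 0 < e₂) {φ : ℝ → ℝ} (hφ : IsTest φ) (R : ℝ) :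
    ∃ C, ∀ (Φ : Fin 2 → ℝ → ℝ → ℝ) (t ε : ℝ), 0 < ε →
      (∀ k, DifferentiableAt ℝ (fun s => Φ k s ε) t) →
      (∀ k, |deriv (fun s => Φ k s ε) t| ≤ R) → Φ 0 t ε ≤ Φ 1 t ε →
      |(∫ x, lawOperator f (fun y s => smoothAnsatz κ (fun _ _ => u₀)
          ![fun _ _ => e₁, fun _ _ => e₂] Φ y s ε) x t * φ x)
        - ((e₁ * deriv (fun s => Φ 0 s ε) t - (f (u₀ + e₁ + e₂) - f (u₀ + e₂))) * φ (Φ 0 t ε)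
          + (e₂ * deriv (fun s => Φ 1 s ε) t - (f (u₀ + e₂) - f u₀)) * φ (Φ 1 t ε))| ≤ C * ε := by
  obtain ⟨L, hL0, hL⟩ := lipschitz_on_range hf u₀ (u₀ + e₁ + e₂)
  obtain ⟨B, hB0, hB⟩ := hφ.deriv.bound
  set K : Fin 2 → ℝ := fun k => (∫ z, κ k z * (1 + z ^ 2)) * Real.pi
  refine ⟨B * ((L + |R|) * e₁ * K 0 + (L + |R|) * e₂ * K 1), ?_⟩
  intro Φ t ε hε hdiff hR hle
  set q : Fin 2 → ℝ := fun k => deriv (fun s => Φ k s ε) t with hq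
  set a : Fin 2 → ℝ := fun k => Φ k t ε with ha
  have hqR : ∀ k, |q k| ≤ |R| := fun k => (hR k).trans (le_abs_self R)
  set W : Fin 2 → ℝ → ℝ := fun k x => heavisideApprox (κ k) (-x + a k) ε with hW
  set H : Fin 2 → ℝ → ℝ := fun k x => heaviside (-x + a k) with hH
  set u : ℝ → ℝ := fun x => u₀ + e₁ * W 0 x + e₂ * W 1 x with hu
  set uH : ℝ → ℝ := fun x => u₀ + e₁ * H 0 x + e₂ * H 1 x with huH
  -- Each profile depends on `-x + Φ k`, so its time derivative is `-q k` times its `x`-derivative.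
  -- Hence the operator applied to the ansatz is exactly `g'`, and `gH` is its counterpart with
  -- sharp jumps.
  set g : ℝ → ℝ := fun x => f (u x) - e₁ * q 0 * W 0 x - e₂ * q 1 * W 1 x with hg
  set gH : ℝ → ℝ := fun x => f (uH x) - e₁ * q 0 * H 0 x - e₂ * q 1 * H 1 x with hgH
  have hfd : Differentiable ℝ f := hf.differentiable (by simp)
  have hWd : ∀ k x, HasDerivAt (W k) (-(κ k ((-x + a k) / ε) / ε)) x := fun k x => by
    have h1 : HasDerivAt (fun x : ℝ => -x + a k) (-1) x := (hasDerivAt_neg x).add_const _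
    simpa [Function.comp_def] using (hasDerivAt_heavisideApprox (hκ k) (-x + a k) ε).comp x h1
  have hud : ∀ x, HasDerivAt u (e₁ * -(κ 0 ((-x + a 0) / ε) / ε)
      + e₂ * -(κ 1 ((-x + a 1) / ε) / ε)) x := fun x =>
    (((hWd 0 x).const_mul e₁).const_add u₀).add ((hWd 1 x).const_mul e₂)
  have hgd : ∀ x, HasDerivAt g (deriv f (u x) * (e₁ * -(κ 0 ((-x + a 0) / ε) / ε)
      + e₂ * -(κ 1 ((-x + a 1) / ε) / ε)) - e₁ * q 0 * -(κ 0 ((-x + a 0) / ε) / ε)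
      - e₂ * q 1 * -(κ 1 ((-x + a 1) / ε) / ε)) x := fun x =>
    ((((hfd (u x)).hasDerivAt).comp x (hud x)).sub ((hWd 0 x).const_mul _)).sub
      ((hWd 1 x).const_mul _)
  have hop : ∀ x, lawOperator f (fun y s => smoothAnsatz κ (fun _ _ => u₀)
      ![fun _ _ => e₁, fun _ _ => e₂] Φ y s ε) x t = deriv g x := fun x => by
    have hS : ∀ y s, smoothAnsatz κ (fun _ _ => u₀) ![fun _ _ => e₁, fun _ _ => e₂] Φ y s ε =
        u₀ + e₁ * heavisideApprox (κ 0) (-y + Φ 0 s ε) ε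
          + e₂ * heavisideApprox (κ 1) (-y + Φ 1 s ε) ε := fun y s => by
      simp [smoothAnsatz, Fin.sum_univ_two, add_assoc]
    have hT : ∀ k, HasDerivAt (fun s => heavisideApprox (κ k) (-x + Φ k s ε) ε)
        (κ k ((-x + a k) / ε) / ε * q k) t := fun k =>
      HasDerivAt.comp (h₂ := fun y => heavisideApprox (κ k) y ε) (h := fun s => -x + Φ k s ε) t
        (hasDerivAt_heavisideApprox (hκ k) (-x + Φ k t ε) ε)
        ((hdiff k).hasDerivAt.const_add (-x))
    have hut : HasDerivAt (fun s => u₀ + e₁ * heavisideApprox (κ 0) (-x + Φ 0 s ε) ε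
          + e₂ * heavisideApprox (κ 1) (-x + Φ 1 s ε) ε)
        (e₁ * (κ 0 ((-x + a 0) / ε) / ε * q 0) + e₂ * (κ 1 ((-x + a 1) / ε) / ε * q 1)) t :=
      (((hT 0).const_mul e₁).const_add u₀).add ((hT 1).const_mul e₂)
    have hux : HasDerivAt (fun y => f (u y)) (deriv f (u x) * (e₁ * -(κ 0 ((-x + a 0) / ε) / ε)
      + e₂ * -(κ 1 ((-x + a 1) / ε) / ε))) x := ((hfd (u x)).hasDerivAt).comp x (hud x)
    unfold lawOperator
    simp only [hS]
    rw [hut.deriv, (hgd x).deriv]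
    have := hux.deriv
    simp only [hu, hW, ha] at this ⊢
    rw [this]
    ring
  have hWm : ∀ k x, W k x ∈ Icc (0 : ℝ) 1 := fun k x => heavisideApprox_mem (hκ k) _ _
  have hHm : ∀ k x, H k x ∈ Icc (0 : ℝ) 1 := fun k x => heaviside_mem _
  have hmem : ∀ w₁ ∈ Icc (0 : ℝ) 1, ∀ w₂ ∈ Icc (0 : ℝ) 1,
      u₀ + e₁ * w₁ + e₂ * w₂ ∈ Icc u₀ (u₀ + e₁ + e₂) := by
    intro w₁ h₁ w₂ h₂
    constructor
    · nlinarith [h₁.1, h₂.1]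
    · nlinarith [h₁.2, h₂.2]
  have hgc : Continuous g := continuous_iff_continuousAt.2 fun x => (hgd x).continuousAt
  have hgdiff : Differentiable ℝ g := fun x => (hgd x).differentiableAt
  have hWc : ∀ k, Continuous (W k) := fun k =>
    continuous_iff_continuousAt.2 fun x => (hWd k x).continuousAt
  have huc : Continuous u := continuous_iff_continuousAt.2 fun x => (hud x).continuousAt
  have hdf : Continuous (deriv f) := (contDiff_infty_iff_deriv.1 hf).2.continuous
  have hgdc : Continuous (deriv g) := by
    rw [show deriv g = _ from funext fun x => (hgd x).deriv]
    have h0 := (hκ 0).smooth.continuous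
    have h1 := (hκ 1).smooth.continuous
    fun_prop
  have hcs : ∀ {h : ℝ → ℝ}, Continuous h → ∀ {ψ : ℝ → ℝ}, IsTest ψ →
      Integrable (fun x => h x * ψ x) := fun hh _ hψ =>
    (hh.mul hψ.1.continuous).integrable_of_hasCompactSupport hψ.2.mul_left
  -- integration by parts
  have hparts : ∫ x, deriv g x * φ x = -∫ x, g x * deriv φ x := by
    have := integral_mul_deriv_eq_deriv_mul_of_integrable (u := g) (v := φ) (u' := deriv g)
      (v' := deriv φ) (fun x _ => (hgdiff x).hasDerivAt)
      (fun x _ => (hφ.1.differentiable (by simp) x).hasDerivAt)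
      (hcs hgc hφ.deriv) (hcs hgdc hφ) (hcs hgc hφ)
    linarith
  -- The order of the phases excludes `H 0 = 1`, `H 1 = 0`. On the three remaining combinations
  -- `f(uH)` is affine in `H 0` and `H 1`.
  have hgHeq : ∀ x, gH x = f u₀ + (f (u₀ + e₁ + e₂) - f (u₀ + e₂) - e₁ * q 0) * H 0 x
      + (f (u₀ + e₂) - f u₀ - e₂ * q 1) * H 1 x := fun x => by
    have : H 0 x ≤ H 1 x := by
      simp only [hH, heaviside]
      split_ifs <;> linarith
    simp only [hgH, huH]
    have h0 : H 0 x = 0 ∨ H 0 x = 1 := by simp only [hH, heaviside]; split_ifs <;> simp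
    have h1 : H 1 x = 0 ∨ H 1 x = 1 := by simp only [hH, heaviside]; split_ifs <;> simp
    rcases h0 with h0 | h0 <;> rcases h1 with h1 | h1 <;> rw [h0, h1] at this ⊢
    · simp
    · simp; ring
    · norm_num at this
    · simp; ring
  have hHi : ∀ k, Integrable (fun x => H k x * deriv φ x) := fun k =>
    integrable_heaviside_mul (a k) hφ.deriv.integrable
  have hgHexp : (fun x => gH x * deriv φ x) = fun x => f u₀ * deriv φ x +
      (f (u₀ + e₁ + e₂) - f (u₀ + e₂) - e₁ * q 0) * (H 0 x * deriv φ x)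
      + (f (u₀ + e₂) - f u₀ - e₂ * q 1) * (H 1 x * deriv φ x) := by
    funext x; rw [hgHeq]; ring
  have hgHi : Integrable (fun x => gH x * deriv φ x) := by
    rw [hgHexp]
    exact ((hφ.deriv.integrable.const_mul _).add ((hHi 0).const_mul _)).add ((hHi 1).const_mul _)
  have hgHint : ∫ x, gH x * deriv φ x =
      (f (u₀ + e₁ + e₂) - f (u₀ + e₂) - e₁ * q 0) * φ (a 0)
      + (f (u₀ + e₂) - f u₀ - e₂ * q 1) * φ (a 1) := by
    rw [hgHexp, integral_add, integral_add, integral_const_mul, integral_const_mul,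
      integral_const_mul, integral_heaviside_mul, integral_heaviside_mul, integral_Iic_deriv hφ,
      integral_Iic_deriv hφ, integral_eq_zero_of_hasDerivAt_of_integrable
        (fun x => (hφ.1.differentiable (by simp) x).hasDerivAt) hφ.deriv.integrable hφ.integrable]
    · ring
    · exact hφ.deriv.integrable.const_mul _
    · exact (hHi 0).const_mul _
    · exact (hφ.deriv.integrable.const_mul _).add ((hHi 0).const_mul _)
    · exact (hHi 1).const_mul _
  have hWHi := fun k => (integrable_heavisideApprox_sub (hκ k) hε (a k)).1
  have hWHb := fun k => (integrable_heavisideApprox_sub (hκ k) hε (a k)).2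
  -- Both `u` and `uH` take values in `[u₀, u₀ + e₁ + e₂]`, where `f` is Lipschitz, so the `L¹`
  -- distance of the profiles controls that of the fluxes.
  have hpt : ∀ x, |g x - gH x| ≤ (L + |R|) * e₁ * |W 0 x - H 0 x|
      + (L + |R|) * e₂ * |W 1 x - H 1 x| := fun x => by
    have h1 : |f (u x) - f (uH x)| ≤ L * (e₁ * |W 0 x - H 0 x| + e₂ * |W 1 x - H 1 x|) := by
      refine (hL _ (hmem _ (hWm 0 x) _ (hWm 1 x)) _ (hmem _ (hHm 0 x) _ (hHm 1 x))).trans ?_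
      refine mul_le_mul_of_nonneg_left ?_ hL0
      calc |u x - uH x| = |e₁ * (W 0 x - H 0 x) + e₂ * (W 1 x - H 1 x)| := by
            simp only [hu, huH]; ring_nf
        _ ≤ |e₁ * (W 0 x - H 0 x)| + |e₂ * (W 1 x - H 1 x)| := abs_add_le _ _
        _ = _ := by rw [abs_mul, abs_mul, abs_of_pos he₁, abs_of_pos he₂]
    have h2 : |g x - gH x| ≤ |f (u x) - f (uH x)| + |e₁ * q 0 * (W 0 x - H 0 x)|
        + |e₂ * q 1 * (W 1 x - H 1 x)| := by
      have : g x - gH x = (f (u x) - f (uH x)) + (-(e₁ * q 0 * (W 0 x - H 0 x)))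
        + (-(e₂ * q 1 * (W 1 x - H 1 x))) := by simp only [hg, hgH]; ring
      rw [this]
      refine (abs_add_three _ _ _).trans ?_
      rw [abs_neg, abs_neg]
    rw [abs_mul, abs_mul, abs_mul, abs_mul, abs_of_pos he₁, abs_of_pos he₂] at h2
    have h3 : e₁ * |q 0| * |W 0 x - H 0 x| ≤ e₁ * |R| * |W 0 x - H 0 x| := by
      have := hqR 0
      gcongr
    have h4 : e₂ * |q 1| * |W 1 x - H 1 x| ≤ e₂ * |R| * |W 1 x - H 1 x| := by
      have := hqR 1
      gcongr
    linarith
  have hbi : Integrable (fun x => ((L + |R|) * e₁ * |W 0 x - H 0 x|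
      + (L + |R|) * e₂ * |W 1 x - H 1 x|)) := ((hWHi 0).const_mul _).add ((hWHi 1).const_mul _)
  have hdiffb : |∫ x, (g x - gH x) * deriv φ x| ≤
      B * ((L + |R|) * e₁ * K 0 + (L + |R|) * e₂ * K 1) * ε := by
    have h1 : ‖∫ x, (g x - gH x) * deriv φ x‖ ≤ ∫ x, ((L + |R|) * e₁ * |W 0 x - H 0 x|
      + (L + |R|) * e₂ * |W 1 x - H 1 x|) * B := by
      refine norm_integral_le_of_norm_le (hbi.mul_const B) (Eventually.of_forall fun x => ?_)
      rw [norm_mul, Real.norm_eq_abs, Real.norm_eq_abs]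
      exact mul_le_mul (hpt x) (hB x) (abs_nonneg _) ((abs_nonneg _).trans (hpt x))
    rw [integral_mul_const, integral_add ((hWHi 0).const_mul _) ((hWHi 1).const_mul _),
      integral_const_mul, integral_const_mul] at h1
    refine h1.trans ?_
    have h2 : (L + |R|) * e₁ * (∫ x, |W 0 x - H 0 x|) ≤ (L + |R|) * e₁ * (K 0 * ε) := by
      gcongr; exact hWHb 0
    have h3 : (L + |R|) * e₂ * (∫ x, |W 1 x - H 1 x|) ≤ (L + |R|) * e₂ * (K 1 * ε) := by
      gcongr; exact hWHb 1
    calc _ ≤ ((L + |R|) * e₁ * (K 0 * ε) + (L + |R|) * e₂ * (K 1 * ε)) * B := by gcongr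
      _ = _ := by ring
  simp only [hop]
  rw [hparts]
  have hsplit : ∫ x, (g x - gH x) * deriv φ x =
      (∫ x, g x * deriv φ x) - ∫ x, gH x * deriv φ x := by
    rw [← integral_sub (hcs hgc hφ.deriv) hgHi]
    congr 1; funext x; ring
  rw [hsplit, hgHint] at hdiffb
  rw [← abs_neg]
  refine le_trans (le_of_eq ?_) hdiffb
  congr 1
  simp only [ha, hq]
  ring

end profile

/-! ### Smooth phases describing the merging of two shocks -/

/-- A smooth approximation of the distance `max (d - c t) 0` between two shocks which are initially
at distance `d` and approach each other with relative velocity `c`. -/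
def smoothGap (d c t ε : ℝ) : ℝ := (d - c * t + √((d - c * t) ^ 2 + ε ^ 2)) / 2

section gap

variable {d c t ε : ℝ}

lemma radicand_pos (hε : 0 < ε) (y : ℝ) : 0 < y ^ 2 + ε ^ 2 := by positivity

lemma abs_le_sqrt_add (y ε : ℝ) : |y| ≤ √(y ^ 2 + ε ^ 2) :=
  Real.abs_le_sqrt (by nlinarith [sq_nonneg ε])

lemma smoothGap_nonneg (d c t ε : ℝ) : 0 ≤ smoothGap d c t ε := by
  have := abs_le_sqrt_add (d - c * t) ε
  have := neg_abs_le (d - c * t)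
  unfold smoothGap
  linarith

lemma contDiff_smoothGap (hε : 0 < ε) : ContDiff ℝ ∞ (fun t => smoothGap d c t ε) := by
  unfold smoothGap
  have h : ContDiff ℝ ∞ (fun t => √((d - c * t) ^ 2 + ε ^ 2)) :=
    ContDiff.sqrt (by fun_prop) fun t => (radicand_pos hε _).ne'
  fun_prop

lemma hasDerivAt_smoothGap (hε : 0 < ε) :
    HasDerivAt (fun t => smoothGap d c t ε)
      (-c * (1 + (d - c * t) / √((d - c * t) ^ 2 + ε ^ 2)) / 2) t := by
  unfold smoothGap
  have h1 : HasDerivAt (fun t => d - c * t) (-c) t := by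
    simpa using ((hasDerivAt_id t).const_mul c).const_sub d
  have h2 := ((h1.pow 2).add_const (ε ^ 2)).sqrt (radicand_pos hε _).ne'
  refine ((h1.add h2).div_const 2).congr_deriv ?_
  have := Real.sqrt_pos.2 (radicand_pos hε (d - c * t))
  simp only [Pi.pow_apply]
  generalize √((d - c * t) ^ 2 + ε ^ 2) = r at *
  push_cast
  field_simp
  ring

lemma abs_deriv_smoothGap_le (hc : 0 < c) (hε : 0 < ε) :
    |deriv (fun t => smoothGap d c t ε) t| ≤ c := by
  rw [(hasDerivAt_smoothGap hε).deriv]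
  have hr := Real.sqrt_pos.2 (radicand_pos hε (d - c * t))
  have h1 : |(d - c * t) / √((d - c * t) ^ 2 + ε ^ 2)| ≤ 1 := by
    rw [abs_div, abs_of_pos hr, div_le_one hr]
    exact abs_le_sqrt_add _ _
  rw [abs_le] at h1 ⊢
  constructor <;> nlinarith [h1.1, h1.2]

/-- With `y = d - c t` and `r = √(y² + ε²)` the factors are `c (r - y) / (2r)` and `(r + y) / 2`. As
`(r - y)(r + y) = ε²`, the product is `c ε² / (4r)`, and `r ≥ ε`. The bound is uniform in time,
through the interaction. -/
lemma abs_deriv_smoothGap_add_mul_le (hc : 0 < c) (hε : 0 < ε) :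
    |deriv (fun t => smoothGap d c t ε) t + c| * smoothGap d c t ε ≤ c * ε := by
  rw [(hasDerivAt_smoothGap hε).deriv]
  unfold smoothGap
  generalize d - c * t = y
  have hr := Real.sqrt_pos.2 (radicand_pos hε y)
  have hsq := Real.sq_sqrt (radicand_pos hε y).le
  have hy := abs_le.1 (abs_le_sqrt_add y ε)
  have hεr : ε ≤ √(y ^ 2 + ε ^ 2) := Real.le_sqrt_of_sq_le (by nlinarith [sq_nonneg y])
  generalize √(y ^ 2 + ε ^ 2) = r at *
  have h1 : -c * (1 + y / r) / 2 + c = c * (r - y) / (2 * r) := by field_simp; ring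
  rw [h1, abs_of_nonneg (div_nonneg (mul_nonneg hc.le (by linarith)) (by linarith))]
  have h2 : c * (r - y) / (2 * r) * ((y + r) / 2) = c * ε ^ 2 / (4 * r) := by
    field_simp
    linear_combination (4 : ℝ) * hsq
  rw [h2, div_le_iff₀ (by positivity)]
  nlinarith [mul_pos hc hε, mul_le_mul_of_nonneg_left hεr (mul_pos hc hε).le]

lemma abs_smoothGap_sub_max_le (hε : 0 < ε) :
    |smoothGap d c t ε - max (d - c * t) 0| ≤ ε := by
  unfold smoothGap
  generalize d - c * t = y
  have h1 := abs_le_sqrt_add y ε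
  have h2 : √(y ^ 2 + ε ^ 2) ≤ |y| + ε := by
    rw [Real.sqrt_le_left (by positivity)]
    nlinarith [abs_nonneg y, sq_abs y]
  have h3 : max y 0 = (y + |y|) / 2 := by
    rcases le_total 0 y with h | h
    · rw [max_eq_left h, abs_of_nonneg h]; ring
    · rw [max_eq_right h, abs_of_nonpos h]; ring
  rw [h3, abs_le]
  constructor <;> linarith

end gap

/-! ### The two-shock function as a weak limit -/

section weakLimit

variable {f : ℝ → ℝ} {u₀ e₁ e₂ x₁ x₂ : ℝ}

/-- The phases of the asymptotic solution: the barycentre of the two shocks moves with constant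
velocity, and their distance is `smoothGap`. -/
def smoothPhase (f : ℝ → ℝ) (u₀ e₁ e₂ x₁ x₂ : ℝ) : Fin 2 → ℝ → ℝ → ℝ :=
  ![fun t ε => (e₁ * x₁ + e₂ * x₂ + (f (u₀ + e₁ + e₂) - f u₀) * t - e₂ * smoothGap (x₂ - x₁)
      ((f (u₀ + e₁ + e₂) - f (u₀ + e₂)) / e₁ - (f (u₀ + e₂) - f u₀) / e₂) t ε) / (e₁ + e₂),
    fun t ε => (e₁ * x₁ + e₂ * x₂ + (f (u₀ + e₁ + e₂) - f u₀) * t + e₁ * smoothGap (x₂ - x₁)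
      ((f (u₀ + e₁ + e₂) - f (u₀ + e₂)) / e₁ - (f (u₀ + e₂) - f u₀) / e₂) t ε) / (e₁ + e₂)]

lemma abs_smoothPhase_zero_sub_le (he₁ : 0 < e₁) (he₂ : 0 < e₂)
    (hD : 0 < e₂ * f (u₀ + e₁ + e₂) - (e₁ + e₂) * f (u₀ + e₂) + e₁ * f u₀) (t : ℝ) {ε : ℝ}
    (hε : 0 < ε) :
    |smoothPhase f u₀ e₁ e₂ x₁ x₂ 0 t ε - phase₁ f u₀ e₁ e₂ x₁ x₂ t| ≤ ε := by
  have h := abs_smoothGap_sub_max_le (d := x₂ - x₁)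
    (c := (f (u₀ + e₁ + e₂) - f (u₀ + e₂)) / e₁ - (f (u₀ + e₂) - f u₀) / e₂) (t := t) hε
  rw [phase₁_eq t he₁ he₂ hD]
  simp only [smoothPhase, Matrix.cons_val_zero]
  rw [← sub_div, sub_sub_sub_cancel_left, ← mul_sub, abs_div, abs_mul, abs_sub_comm, abs_of_pos he₂,
    abs_of_pos (by positivity : 0 < e₁ + e₂), div_le_iff₀ (by positivity)]
  nlinarith [mul_le_mul_of_nonneg_left h he₂.le]

lemma abs_smoothPhase_one_sub_le (he₁ : 0 < e₁) (he₂ : 0 < e₂)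
    (hD : 0 < e₂ * f (u₀ + e₁ + e₂) - (e₁ + e₂) * f (u₀ + e₂) + e₁ * f u₀) (t : ℝ) {ε : ℝ}
    (hε : 0 < ε) :
    |smoothPhase f u₀ e₁ e₂ x₁ x₂ 1 t ε - phase₂ f u₀ e₁ e₂ x₁ x₂ t| ≤ ε := by
  have h := abs_smoothGap_sub_max_le (d := x₂ - x₁)
    (c := (f (u₀ + e₁ + e₂) - f (u₀ + e₂)) / e₁ - (f (u₀ + e₂) - f u₀) / e₂) (t := t) hε
  rw [phase₂_eq t he₁ he₂ hD]
  simp only [smoothPhase, Matrix.cons_val_one, Matrix.cons_val_zero]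
  rw [← sub_div, add_sub_add_left_eq_sub, ← mul_sub, abs_div, abs_mul, abs_of_pos he₁,
    abs_of_pos (by positivity : 0 < e₁ + e₂), div_le_iff₀ (by positivity)]
  nlinarith [mul_le_mul_of_nonneg_left h he₁.le]

lemma phase₁_zero (he₁ : 0 < e₁) (he₂ : 0 < e₂) (hx : x₁ < x₂)
    (hD : 0 < e₂ * f (u₀ + e₁ + e₂) - (e₁ + e₂) * f (u₀ + e₂) + e₁ * f u₀) :
    phase₁ f u₀ e₁ e₂ x₁ x₂ 0 = x₁ := by
  simpa using (phases_before_merge he₁ he₂ hD (mergeTime_pos he₁ he₂ hx hD)).1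

lemma phase₂_zero (he₁ : 0 < e₁) (he₂ : 0 < e₂) (hx : x₁ < x₂)
    (hD : 0 < e₂ * f (u₀ + e₁ + e₂) - (e₁ + e₂) * f (u₀ + e₂) + e₁ * f u₀) :
    phase₂ f u₀ e₁ e₂ x₁ x₂ 0 = x₂ := by
  simpa using (phases_before_merge he₁ he₂ hD (mergeTime_pos he₁ he₂ hx hD)).2.1

lemma initialData_eq_heaviside (hx : x₁ < x₂) (x : ℝ) :
    initialData u₀ e₁ e₂ x₁ x₂ x =
      u₀ + e₁ * heaviside (-x + x₁) + e₂ * heaviside (-x + x₂) := by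
  unfold initialData heaviside
  split_ifs <;> linarith

lemma integral_steps_mul {φ : ℝ → ℝ} (hφ : IsTest φ) (u₀ e₁ e₂ a b : ℝ) :
    ∫ x, (u₀ + e₁ * heaviside (-x + a) + e₂ * heaviside (-x + b)) * φ x =
      u₀ * (∫ x, φ x) + e₁ * (∫ x, heaviside (-x + a) * φ x)
        + e₂ * ∫ x, heaviside (-x + b) * φ x := by
  have h := fun a => integrable_heaviside_mul a hφ.integrable
  rw [← integral_const_mul, ← integral_const_mul, ← integral_const_mul, ← integral_add,
    ← integral_add]
  · congr 1; funext x; ring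
  · exact (hφ.integrable.const_mul _).add ((h a).const_mul _)
  · exact (h b).const_mul _
  · exact hφ.integrable.const_mul _
  · exact (h a).const_mul _

lemma integrable_steps_mul {φ : ℝ → ℝ} (hφ : IsTest φ) (u₀ e₁ e₂ a b : ℝ) :
    Integrable fun x => (u₀ + e₁ * heaviside (-x + a) + e₂ * heaviside (-x + b)) * φ x := by
  have h := fun a => integrable_heaviside_mul a hφ.integrable
  refine (((hφ.integrable.const_mul u₀).add ((h a).const_mul e₁)).add
    ((h b).const_mul e₂)).congr (Eventually.of_forall fun x => ?_)
  simp only [Pi.add_apply]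
  ring

/-- Moving the jumps of a two-step function changes its pairings in a Lipschitz way. -/
lemma abs_integral_steps_sub_le {φ : ℝ → ℝ} (hφ : IsTest φ) {B : ℝ} (hB : ∀ x, |φ x| ≤ B)
    (he₁ : 0 < e₁) (he₂ : 0 < e₂) {a b a' b' η : ℝ} (ha : |a - a'| ≤ η) (hb : |b - b'| ≤ η) :
    |(∫ x, (u₀ + e₁ * heaviside (-x + a) + e₂ * heaviside (-x + b)) * φ x)
      - ∫ x, (u₀ + e₁ * heaviside (-x + a') + e₂ * heaviside (-x + b')) * φ x| ≤
      (e₁ + e₂) * B * η := by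
  have hB0 : 0 ≤ B := (abs_nonneg _).trans (hB 0)
  have h1 := (abs_integral_heaviside_mul_sub_le hφ hB a a').trans
    (mul_le_mul_of_nonneg_left ha hB0)
  have h2 := (abs_integral_heaviside_mul_sub_le hφ hB b b').trans
    (mul_le_mul_of_nonneg_left hb hB0)
  rw [integral_steps_mul hφ, integral_steps_mul hφ]
  rw [abs_le] at h1 h2 ⊢
  constructor
  · nlinarith [mul_le_mul_of_nonneg_left h1.1 he₁.le, mul_le_mul_of_nonneg_left h2.1 he₂.le]
  · nlinarith [mul_le_mul_of_nonneg_left h1.2 he₁.le, mul_le_mul_of_nonneg_left h2.2 he₂.le]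

lemma singularAnsatz_eq (Φ : Fin 2 → ℝ → ℝ → ℝ) (x t ε : ℝ) :
    singularAnsatz (fun _ _ => u₀) ![fun _ _ => e₁, fun _ _ => e₂] Φ x t ε =
      u₀ + e₁ * heaviside (-x + Φ 0 t ε) + e₂ * heaviside (-x + Φ 1 t ε) := by
  simp [singularAnsatz, Fin.sum_univ_two, add_assoc]

/-- The uniform motion of the barycentre makes the Rankine–Hugoniot defects of the two shocks
opposite. Their contributions then differ only by `φ(Φ 1) - φ(Φ 0)`, which is at most `B` times the
gap and is absorbed by `abs_deriv_smoothGap_add_mul_le`. -/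
lemma smoothPhase_equation {κ : Fin 2 → ℝ → ℝ} (hκ : ∀ k, IsKernel (κ k)) (hf : ContDiff ℝ ∞ f)
    (he₁ : 0 < e₁) (he₂ : 0 < e₂)
    (hD : 0 < e₂ * f (u₀ + e₁ + e₂) - (e₁ + e₂) * f (u₀ + e₂) + e₁ * f u₀) (I : Set ℝ) :
    IsBigODistrib (fun x t ε => lawOperator f (fun y s => smoothAnsatz κ (fun _ _ => u₀)
      ![fun _ _ => e₁, fun _ _ => e₂] (smoothPhase f u₀ e₁ e₂ x₁ x₂) y s ε) x t) I := by
  intro φ hφ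
  have hc := speed_gap_pos he₁ he₂ hD
  set c := (f (u₀ + e₁ + e₂) - f (u₀ + e₂)) / e₁ - (f (u₀ + e₂) - f u₀) / e₂ with hcdef
  set J := f (u₀ + e₁ + e₂) - f u₀ with hJ
  have he : 0 < e₁ + e₂ := by positivity
  -- The bound for the phase velocities: the gap moves with speed at most `c`, and it enters each
  -- phase with weight `e₁` or `e₂` over `e₁ + e₂`.
  obtain ⟨C, hC⟩ := exists_equation_bound (u₀ := u₀) hf hκ he₁ he₂ hφ
    ((|J| + (e₁ + e₂) * c) / (e₁ + e₂))
  obtain ⟨B, hB0, hB⟩ := hφ.deriv.bound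
  refine ⟨C + e₁ * e₂ / (e₁ + e₂) * B * c, 1, one_pos, fun ε hε t _ => ?_⟩
  set δ : ℝ → ℝ := fun t => smoothGap (x₂ - x₁) c t ε with hδ
  have hδd : HasDerivAt δ (deriv δ t) t := (hasDerivAt_smoothGap hε.1).differentiableAt.hasDerivAt
  have hδb : |deriv δ t| ≤ c := abs_deriv_smoothGap_le hc hε.1
  have hδm : |deriv δ t + c| * δ t ≤ c * ε := abs_deriv_smoothGap_add_mul_le hc hε.1
  have hδ0 : 0 ≤ δ t := smoothGap_nonneg _ _ _ _
  have hlin : HasDerivAt (fun t => e₁ * x₁ + e₂ * x₂ + J * t) J t := by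
    simpa using ((hasDerivAt_id t).const_mul J).const_add (e₁ * x₁ + e₂ * x₂)
  have hd0 : HasDerivAt (fun s => smoothPhase f u₀ e₁ e₂ x₁ x₂ 0 s ε)
      ((J - e₂ * deriv δ t) / (e₁ + e₂)) t := (hlin.sub (hδd.const_mul e₂)).div_const _
  have hd1 : HasDerivAt (fun s => smoothPhase f u₀ e₁ e₂ x₁ x₂ 1 s ε)
      ((J + e₁ * deriv δ t) / (e₁ + e₂)) t := (hlin.add (hδd.const_mul e₁)).div_const _
  have hv0 : smoothPhase f u₀ e₁ e₂ x₁ x₂ 0 t ε =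
    (e₁ * x₁ + e₂ * x₂ + J * t - e₂ * δ t) / (e₁ + e₂) := rfl
  have hv1 : smoothPhase f u₀ e₁ e₂ x₁ x₂ 1 t ε =
    (e₁ * x₁ + e₂ * x₂ + J * t + e₁ * δ t) / (e₁ + e₂) := rfl
  have hsub : smoothPhase f u₀ e₁ e₂ x₁ x₂ 1 t ε - smoothPhase f u₀ e₁ e₂ x₁ x₂ 0 t ε = δ t := by
    rw [hv0, hv1]; field_simp; ring
  have h := hC (smoothPhase f u₀ e₁ e₂ x₁ x₂) t ε hε.1
    (by rw [Fin.forall_fin_two]; exact ⟨hd0.differentiableAt, hd1.differentiableAt⟩)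
    (by
      have hx : ∀ z : ℝ, |z| ≤ (e₁ + e₂) * c →
          |(J + z) / (e₁ + e₂)| ≤ (|J| + (e₁ + e₂) * c) / (e₁ + e₂) := fun z hz => by
        rw [abs_div, abs_of_pos he]
        gcongr
        exact (abs_add_le _ _).trans (by gcongr)
      rw [Fin.forall_fin_two, hd0.deriv, hd1.deriv]
      refine ⟨?_, hx _ ?_⟩
      · rw [sub_eq_add_neg]
        refine hx _ ?_
        rw [abs_neg, abs_mul, abs_of_pos he₂]
        nlinarith [abs_nonneg (deriv δ t)]
      · rw [abs_mul, abs_of_pos he₁]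
        nlinarith [abs_nonneg (deriv δ t)])
    (by linarith)
  rw [hd0.deriv, hd1.deriv] at h
  have hA : e₁ * ((J - e₂ * deriv δ t) / (e₁ + e₂)) - (f (u₀ + e₁ + e₂) - f (u₀ + e₂)) =
      -(e₁ * e₂ / (e₁ + e₂) * (deriv δ t + c)) := by
    rw [hJ, hcdef]; field_simp; ring
  have hA' : e₂ * ((J + e₁ * deriv δ t) / (e₁ + e₂)) - (f (u₀ + e₂) - f u₀) =
      e₁ * e₂ / (e₁ + e₂) * (deriv δ t + c) := by
    rw [hJ, hcdef]; field_simp; ring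
  rw [hA, hA'] at h
  have hrem : |-(e₁ * e₂ / (e₁ + e₂) * (deriv δ t + c)) * φ (smoothPhase f u₀ e₁ e₂ x₁ x₂ 0 t ε)
      + e₁ * e₂ / (e₁ + e₂) * (deriv δ t + c) * φ (smoothPhase f u₀ e₁ e₂ x₁ x₂ 1 t ε)| ≤
      e₁ * e₂ / (e₁ + e₂) * B * c * ε := by
    have h1 := abs_sub_le_of_abs_deriv_le hφ hB (smoothPhase f u₀ e₁ e₂ x₁ x₂ 1 t ε)
      (smoothPhase f u₀ e₁ e₂ x₁ x₂ 0 t ε)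
    rw [hsub, abs_of_nonneg hδ0] at h1
    have hk : 0 < e₁ * e₂ / (e₁ + e₂) := by positivity
    generalize e₁ * e₂ / (e₁ + e₂) = k at hk ⊢
    generalize φ (smoothPhase f u₀ e₁ e₂ x₁ x₂ 1 t ε) = y at *
    generalize φ (smoothPhase f u₀ e₁ e₂ x₁ x₂ 0 t ε) = z at *
    calc _ = k * |deriv δ t + c| * |y - z| := by
          rw [← abs_of_pos hk, ← abs_mul, ← abs_mul, abs_of_pos hk]; ring_nf
      _ ≤ k * |deriv δ t + c| * (B * δ t) := by gcongr
      _ = k * B * (|deriv δ t + c| * δ t) := by ring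
      _ ≤ k * B * (c * ε) := by gcongr
      _ = _ := by ring
  have := abs_sub_abs_le_abs_sub (∫ x, lawOperator f (fun y s => smoothAnsatz κ (fun _ _ => u₀)
      ![fun _ _ => e₁, fun _ _ => e₂] (smoothPhase f u₀ e₁ e₂ x₁ x₂) y s ε) x t * φ x)
    (-(e₁ * e₂ / (e₁ + e₂) * (deriv δ t + c)) * φ (smoothPhase f u₀ e₁ e₂ x₁ x₂ 0 t ε)
      + e₁ * e₂ / (e₁ + e₂) * (deriv δ t + c) * φ (smoothPhase f u₀ e₁ e₂ x₁ x₂ 1 t ε))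
  linarith

lemma isWeakLimitSolution_twoShock {κ : Fin 2 → ℝ → ℝ} (hκ : ∀ k, IsKernel (κ k))
    (hf : ContDiff ℝ ∞ f) (he₁ : 0 < e₁) (he₂ : 0 < e₂) (hx : x₁ < x₂)
    (hD : 0 < e₂ * f (u₀ + e₁ + e₂) - (e₁ + e₂) * f (u₀ + e₂) + e₁ * f u₀) :
    IsWeakLimitSolution f κ (fun _ _ => u₀) ![fun _ _ => e₁, fun _ _ => e₂]
      (initialData u₀ e₁ e₂ x₁ x₂) (twoShock f u₀ e₁ e₂ x₁ x₂) := by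
  -- The phases are within `ε` of their limits uniformly in `t`; this one estimate serves both the
  -- initial condition and the weak limit.
  have hsteps : ∀ φ, IsTest φ → ∃ C, ∀ t, ∀ ε > 0,
      |(∫ x, singularAnsatz (fun _ _ => u₀) ![fun _ _ => e₁, fun _ _ => e₂]
        (smoothPhase f u₀ e₁ e₂ x₁ x₂) x t ε * φ x)
        - ∫ x, twoShock f u₀ e₁ e₂ x₁ x₂ x t * φ x| ≤ C * ε := by
    intro φ hφ
    obtain ⟨B, -, hB⟩ := hφ.bound
    refine ⟨(e₁ + e₂) * B, fun t ε hε => ?_⟩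
    simp only [singularAnsatz_eq]
    exact abs_integral_steps_sub_le hφ hB he₁ he₂ (abs_smoothPhase_zero_sub_le he₁ he₂ hD t hε)
      (abs_smoothPhase_one_sub_le he₁ he₂ hD t hε)
  refine ⟨smoothPhase f u₀ e₁ e₂ x₁ x₂, fun T _ => ⟨contDiff_const, ?_, ?_,
    smoothPhase_equation hκ hf he₁ he₂ hD _, ?_⟩, ?_⟩
  · rw [Fin.forall_fin_two]
    exact ⟨contDiff_const, contDiff_const⟩
  · rw [Fin.forall_fin_two]
    refine ⟨fun ε hε => ?_, fun ε hε => ?_⟩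
    all_goals
      have := contDiff_smoothGap (d := x₂ - x₁)
        (c := (f (u₀ + e₁ + e₂) - f (u₀ + e₂)) / e₁ - (f (u₀ + e₂) - f u₀) / e₂) hε
      simp only [smoothPhase, Matrix.cons_val_zero, Matrix.cons_val_one]
      fun_prop
  · intro φ hφ
    obtain ⟨C, hC⟩ := hsteps φ hφ
    refine ⟨C, 1, one_pos, fun ε hε t ht => ?_⟩
    obtain rfl : t = 0 := ht
    refine le_trans (le_of_eq ?_) (hC 0 ε hε.1)
    have hg : ∀ x, initialData u₀ e₁ e₂ x₁ x₂ x = twoShock f u₀ e₁ e₂ x₁ x₂ x 0 := fun x => by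
      rw [initialData_eq_heaviside hx, twoShock, phase₁_zero he₁ he₂ hx hD,
        phase₂_zero he₁ he₂ hx hD]
    simp only [hg, sub_mul]
    rw [integral_sub]
    · simp only [singularAnsatz_eq]
      exact integrable_steps_mul hφ _ _ _ _ _
    · exact integrable_steps_mul hφ _ _ _ _ _
  · intro t _ φ hφ
    obtain ⟨C, hC⟩ := hsteps φ hφ
    rw [tendsto_iff_norm_sub_tendsto_zero]
    have hlim : Tendsto (fun ε : ℝ => C * ε) (𝓝[>] 0) (𝓝 0) :=
      ((continuous_const_mul C).tendsto' 0 0 (by simp)).mono_left nhdsWithin_le_nhds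
    refine squeeze_zero' (Eventually.of_forall fun _ => norm_nonneg _) ?_ hlim
    filter_upwards [self_mem_nhdsWithin] with ε hε using hC t ε hε

end weakLimit

/-! ### Smooth minima of affine functions -/

section softmin

variable {ι : Type*} [Fintype ι]

/-- The affine function `a x + b t + c` of `(x, t)`. -/
def affineFun (a b c : ℝ) (q : ℝ × ℝ) : ℝ := a * q.1 + b * q.2 + c

/-- A smooth approximation from below of the minimum of finitely many affine functions. -/
def softmin (a b c : ι → ℝ) (δ : ℝ) (q : ℝ × ℝ) : ℝ :=
  -δ * Real.log (∑ i, Real.exp (-affineFun (a i) (b i) (c i) q / δ))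

/-- The weights in the gradient of `softmin`. -/
def softWeight (a b c : ι → ℝ) (δ : ℝ) (i : ι) (q : ℝ × ℝ) : ℝ :=
  Real.exp (-affineFun (a i) (b i) (c i) q / δ) /
    ∑ k, Real.exp (-affineFun (a k) (b k) (c k) q / δ)

variable {a b c : ι → ℝ} {δ : ℝ} {q : ℝ × ℝ}

lemma sum_exp_pos [Nonempty ι] (a b c : ι → ℝ) (δ : ℝ) (q : ℝ × ℝ) :
    0 < ∑ i, Real.exp (-affineFun (a i) (b i) (c i) q / δ) :=
  Finset.sum_pos (fun _ _ => Real.exp_pos _) Finset.univ_nonempty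

lemma softWeight_nonneg [Nonempty ι] (i : ι) : 0 ≤ softWeight a b c δ i q :=
  div_nonneg (Real.exp_pos _).le (sum_exp_pos a b c δ q).le

lemma sum_softWeight [Nonempty ι] : ∑ i, softWeight a b c δ i q = 1 := by
  unfold softWeight
  rw [← Finset.sum_div, div_self (sum_exp_pos a b c δ q).ne']

lemma softmin_le [Nonempty ι] (hδ : 0 < δ) (i : ι) : softmin a b c δ q ≤ affineFun (a i) (b i) (c i) q := by
  have h1 : Real.exp (-affineFun (a i) (b i) (c i) q / δ) ≤
      ∑ i, Real.exp (-affineFun (a i) (b i) (c i) q / δ) :=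
    Finset.single_le_sum (f := fun i => Real.exp (-affineFun (a i) (b i) (c i) q / δ))
      (fun _ _ => (Real.exp_pos _).le) (Finset.mem_univ i)
  have h2 := (Real.le_log_iff_exp_le (sum_exp_pos a b c δ q)).2 h1
  rw [div_le_iff₀ hδ] at h2
  unfold softmin
  linarith

/-- The sum of exponentials is at most `card ι` times its largest possible term, whence the error `δ
log (card ι)`. -/
lemma le_softmin [Nonempty ι] (hδ : 0 < δ) {y : ℝ} (hy : ∀ i, y ≤ affineFun (a i) (b i) (c i) q) :
    y - δ * Real.log (Fintype.card ι) ≤ softmin a b c δ q := by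
  have h1 : ∑ i, Real.exp (-affineFun (a i) (b i) (c i) q / δ) ≤
      Fintype.card ι * Real.exp (-y / δ) := by
    rw [← nsmul_eq_mul]
    refine Finset.sum_le_card_nsmul _ _ _ fun i _ => ?_
    have := hy i
    gcongr
  have h2 := Real.log_le_log (sum_exp_pos a b c δ q) h1
  have hcard : (0 : ℝ) < Fintype.card ι := by exact_mod_cast Fintype.card_pos
  rw [Real.log_mul hcard.ne' (Real.exp_pos _).ne', Real.log_exp] at h2
  have h3 := mul_le_mul_of_nonneg_left h2 hδ.le
  have h4 : δ * (-y / δ) = -y := by field_simp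
  unfold softmin
  linarith

lemma contDiff_softmin [Nonempty ι] (a b c : ι → ℝ) (δ : ℝ) : ContDiff ℝ ∞ (softmin a b c δ) := by
  unfold softmin
  refine contDiff_const.mul (ContDiff.log ?_ fun q => (sum_exp_pos a b c δ q).ne')
  refine ContDiff.sum fun i _ => Real.contDiff_exp.comp ?_
  unfold affineFun
  fun_prop

/-- Computed along the line `q + τ v`. The gradient is a convex combination of the gradients `(a i,
b i)`: this makes it bounded uniformly in `δ` and is what Jensen's inequality is applied to later.
-/
lemma fderiv_softmin [Nonempty ι] (hδ : 0 < δ) (v : ℝ × ℝ) :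
    fderiv ℝ (softmin a b c δ) q v =
      ∑ i, softWeight a b c δ i q * (a i * v.1 + b i * v.2) := by
  have hl : ∀ i, HasDerivAt (fun τ : ℝ => affineFun (a i) (b i) (c i) (q + τ • v))
      (a i * v.1 + b i * v.2) 0 := fun i => by
    have h : (fun τ : ℝ => affineFun (a i) (b i) (c i) (q + τ • v)) =
        fun τ => τ * (a i * v.1 + b i * v.2) + affineFun (a i) (b i) (c i) q := by
      funext τ
      simp only [affineFun, Prod.fst_add, Prod.snd_add, Prod.smul_fst, Prod.smul_snd, smul_eq_mul]
      ring
    rw [h]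
    simpa using ((hasDerivAt_id (0 : ℝ)).mul_const (a i * v.1 + b i * v.2)).add_const
      (affineFun (a i) (b i) (c i) q)
  have hs : HasDerivAt
      (fun τ : ℝ => ∑ i, Real.exp (-affineFun (a i) (b i) (c i) (q + τ • v) / δ))
      (∑ i, Real.exp (-affineFun (a i) (b i) (c i) q / δ) * (-(a i * v.1 + b i * v.2) / δ)) 0 := by
    refine HasDerivAt.fun_sum fun i _ => ?_
    simpa using ((hl i).neg.div_const δ).exp
  have hS : HasDerivAt (fun τ : ℝ => softmin a b c δ (q + τ • v))
      (∑ i, softWeight a b c δ i q * (a i * v.1 + b i * v.2)) 0 := by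
    have hp := sum_exp_pos a b c δ q
    refine ((hs.log (by simpa using hp.ne')).const_mul (-δ)).congr_deriv ?_
    simp only [zero_smul, add_zero]
    unfold softWeight
    rw [Finset.sum_div, Finset.mul_sum]
    refine Finset.sum_congr rfl fun i _ => ?_
    field_simp
  have hd : HasLineDerivAt ℝ (softmin a b c δ) (fderiv ℝ (softmin a b c δ) q v) q v :=
    ((contDiff_softmin a b c δ).differentiable (by simp) q).hasFDerivAt.hasLineDerivAt v
  exact HasDerivAt.unique hd hS

lemma hasDerivAt_softmin_fst [Nonempty ι] (hδ : 0 < δ) (x t : ℝ) :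
    HasDerivAt (fun y => softmin a b c δ (y, t)) (∑ i, softWeight a b c δ i (x, t) * a i) x := by
  have h := (((contDiff_softmin a b c δ).differentiable (by simp) (x, t)).hasFDerivAt).comp_hasDerivAt
    x ((hasDerivAt_id x).prodMk (hasDerivAt_const x t))
  rw [fderiv_softmin hδ] at h
  simpa [Function.comp_def] using h

lemma hasDerivAt_softmin_snd [Nonempty ι] (hδ : 0 < δ) (x t : ℝ) :
    HasDerivAt (fun s => softmin a b c δ (x, s)) (∑ i, softWeight a b c δ i (x, t) * b i) t := by
  have h := (((contDiff_softmin a b c δ).differentiable (by simp) (x, t)).hasFDerivAt).comp_hasDerivAt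
    t ((hasDerivAt_const t x).prodMk (hasDerivAt_id t))
  rw [fderiv_softmin hδ] at h
  simpa [Function.comp_def] using h

lemma abs_sum_softWeight_mul_le [Nonempty ι] (d : ι → ℝ) :
    |∑ i, softWeight a b c δ i q * d i| ≤ ∑ i, |d i| := by
  refine (Finset.abs_sum_le_sum_abs _ _).trans (Finset.sum_le_sum fun i _ => ?_)
  rw [abs_mul, abs_of_nonneg (softWeight_nonneg i)]
  have : softWeight a b c δ i q ≤ 1 := by
    rw [← sum_softWeight (a := a) (b := b) (c := c) (δ := δ) (q := q)]
    exact Finset.single_le_sum (fun i _ => softWeight_nonneg i) (Finset.mem_univ i)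
  exact mul_le_of_le_one_left (abs_nonneg _) this

/-- After division by the exponential of index `j`, all others decay as `δ → +0`, so the weights
concentrate on the strict minimiser. -/
lemma tendsto_sum_softWeight {j : ι}
    (hj : ∀ i, i ≠ j → affineFun (a j) (b j) (c j) q < affineFun (a i) (b i) (c i) q) (d : ι → ℝ) :
    Tendsto (fun δ => ∑ i, softWeight a b c δ i q * d i) (𝓝[>] 0) (𝓝 (d j)) := by
  classical
  have hexp : ∀ i, Tendsto (fun δ => Real.exp
      (-(affineFun (a i) (b i) (c i) q - affineFun (a j) (b j) (c j) q) / δ)) (𝓝[>] 0)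
      (𝓝 (if i = j then 1 else 0)) := by
    intro i
    split_ifs with h
    · subst h; simp
    · simp only [div_eq_mul_inv]
      refine Real.tendsto_exp_atBot.comp ?_
      exact tendsto_inv_nhdsGT_zero.const_mul_atTop_of_neg (by linarith [hj i h])
  have hw : ∀ i, Tendsto (fun δ => softWeight a b c δ i q) (𝓝[>] 0)
      (𝓝 (if i = j then 1 else 0)) := by
    intro i
    have h1 : ∀ δ, softWeight a b c δ i q =
        Real.exp (-(affineFun (a i) (b i) (c i) q - affineFun (a j) (b j) (c j) q) / δ) /
        ∑ k, Real.exp (-(affineFun (a k) (b k) (c k) q - affineFun (a j) (b j) (c j) q) / δ) := by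
      intro δ
      have h2 : ∀ k, Real.exp
          (-(affineFun (a k) (b k) (c k) q - affineFun (a j) (b j) (c j) q) / δ) =
          Real.exp (-affineFun (a k) (b k) (c k) q / δ) *
            Real.exp (affineFun (a j) (b j) (c j) q / δ) := fun k => by
        rw [← Real.exp_add]; congr 1; ring
      simp only [h2]
      rw [← Finset.sum_mul, mul_div_mul_right _ _ (Real.exp_pos _).ne', softWeight]
    simp only [h1]
    have h3 := (hexp i).div (tendsto_finsetSum Finset.univ fun k _ => hexp k) (by simp)
    simpa [Pi.div_def] using h3
  have h := tendsto_finsetSum Finset.univ fun i _ => (hw i).mul_const (d i)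
  simpa using h

end softmin

/-! ### Test functions in the plane -/

lemma deriv_curry_snd {φ : ℝ → ℝ → ℝ} (hφ : ContDiff ℝ ∞ (fun p : ℝ × ℝ => φ p.1 p.2))
    (p : ℝ × ℝ) :
    deriv (fun s => φ p.1 s) p.2 = fderiv ℝ (fun p : ℝ × ℝ => φ p.1 p.2) p (0, 1) := by
  have h := ((hφ.differentiable (by simp) p).hasFDerivAt).comp_hasDerivAt
    p.2 ((hasDerivAt_const p.2 p.1).prodMk (hasDerivAt_id p.2))
  exact h.deriv

lemma deriv_curry_fst {φ : ℝ → ℝ → ℝ} (hφ : ContDiff ℝ ∞ (fun p : ℝ × ℝ => φ p.1 p.2))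
    (p : ℝ × ℝ) :
    deriv (fun y => φ y p.2) p.1 = fderiv ℝ (fun p : ℝ × ℝ => φ p.1 p.2) p (1, 0) := by
  have h := ((hφ.differentiable (by simp) p).hasFDerivAt).comp_hasDerivAt
    p.1 ((hasDerivAt_id p.1).prodMk (hasDerivAt_const p.1 p.2))
  exact h.deriv

/-- A gradient has no curl: integrating by parts moves the derivatives of `S` onto `Φ`, and the
mixed second derivatives of `Φ` coincide. -/
lemma integral_gradient_cross_eq_zero {S Φ : ℝ × ℝ → ℝ} (hS : ContDiff ℝ ∞ S)
    (hΦ : ContDiff ℝ ∞ Φ) (hc : HasCompactSupport Φ) :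
    ∫ p, (fderiv ℝ S p (1, 0) * fderiv ℝ Φ p (0, 1) - fderiv ℝ S p (0, 1) * fderiv ℝ Φ p (1, 0))
      = 0 := by
  have hΦ' : ContDiff ℝ ∞ (fderiv ℝ Φ) := hΦ.fderiv_right (by simp)
  have hS' : Continuous (fderiv ℝ S) := hS.continuous_fderiv (by simp)
  have hg : ∀ v, ContDiff ℝ ∞ (fun p => fderiv ℝ Φ p v) := fun v => hΦ'.clm_apply contDiff_const
  have hgc : ∀ v, HasCompactSupport (fun p => fderiv ℝ Φ p v) := fun v => hc.fderiv_apply ℝ v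
  have hcs : ∀ {h k : ℝ × ℝ → ℝ}, Continuous h → Continuous k → HasCompactSupport k →
      Integrable (fun x => h x * k x) := fun hh hk hkc =>
    (hh.mul hk).integrable_of_hasCompactSupport hkc.mul_left
  have hSv : ∀ v, Continuous (fun p => fderiv ℝ S p v) := fun v => hS'.clm_apply continuous_const
  have hgv : ∀ v w, Continuous (fun p => fderiv ℝ (fun p => fderiv ℝ Φ p v) p w) := fun v w =>
    ((hg v).continuous_fderiv (by simp)).clm_apply continuous_const
  have hgvc : ∀ v w, HasCompactSupport (fun p => fderiv ℝ (fun p => fderiv ℝ Φ p v) p w) :=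
    fun v w => (hgc v).fderiv_apply ℝ w
  have key : ∀ v w, ∫ p, fderiv ℝ S p v * fderiv ℝ Φ p w =
      -∫ p, S p * fderiv ℝ (fderiv ℝ Φ) p v w := fun v w => by
    have h := integral_mul_fderiv_eq_neg_fderiv_mul_of_integrable (μ := (volume : Measure (ℝ × ℝ)))
      (f := S) (g := fun p => fderiv ℝ Φ p w) (v := v)
      (hcs (hSv v) (hg w).continuous (hgc w)) (hcs hS.continuous (hgv w v) (hgvc w v))
      (hcs hS.continuous (hg w).continuous (hgc w))
      (fun x _ => hS.differentiable (by simp) x) (fun x _ => (hg w).differentiable (by simp) x)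
    rw [eq_neg_iff_add_eq_zero, add_comm, ← eq_neg_iff_add_eq_zero, ← h]
    congr 1
    funext p
    rw [fderiv_clm_apply (hΦ'.differentiable (by simp) p) (differentiableAt_const w)]
    simp
  rw [integral_sub (hcs (hSv _) (hg _).continuous (hgc _)) (hcs (hSv _) (hg _).continuous (hgc _)),
    key, key, sub_eq_zero]
  congr 2
  funext p
  have hsym : IsSymmSndFDerivAt ℝ Φ p :=
    hΦ.contDiffAt.isSymmSndFDerivAt (by
      simp only [minSmoothness_of_isRCLikeNormedField]
      exact WithTop.coe_le_coe.2 le_top)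
  rw [hsym.eq]

/-! ### Graphs over intervals of time -/

/-- The union of the graphs of the functions `γ i` over the sets `J i`. -/
def curves (J : ℕ → Set ℝ) (γ : ℕ → ℝ → ℝ) : Set (ℝ × ℝ) := {p | ∃ i, p.2 ∈ J i ∧ p.1 = γ i p.2}

/-- Fubini: a graph meets each line `t = const` in at most one point. Extending `γ i` by zero off
the interval `J i` makes the graph measurable. -/
lemma volume_curves {J : ℕ → Set ℝ} {γ : ℕ → ℝ → ℝ} (hJ : ∀ i, (J i).OrdConnected)
    (hγ : ∀ i, ContinuousOn (γ i) (J i)) :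
    MeasurableSet (curves J γ) ∧ volume (curves J γ) = 0 := by
  have hi : ∀ i, MeasurableSet {p : ℝ × ℝ | p.2 ∈ J i ∧ p.1 = γ i p.2} := fun i => by
    have hJm : MeasurableSet (J i) := (hJ i).measurableSet
    have hm : Measurable ((J i).indicator (γ i)) := by
      classical
      rw [← piecewise_eq_indicator]
      exact (hγ i).measurable_piecewise continuousOn_const hJm
    have h1 : {p : ℝ × ℝ | p.2 ∈ J i ∧ p.1 = γ i p.2} =
        {p : ℝ × ℝ | p.2 ∈ J i} ∩ {p | p.1 = (J i).indicator (γ i) p.2} := by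
      ext p
      simp only [mem_ofPred_eq, mem_inter_iff]
      refine and_congr_right fun h => ?_
      rw [indicator_of_mem h]
    rw [h1]
    exact (measurable_snd hJm).inter (measurableSet_eq_fun measurable_fst (hm.comp measurable_snd))
  have hU : curves J γ = ⋃ i, {p : ℝ × ℝ | p.2 ∈ J i ∧ p.1 = γ i p.2} := by
    ext p; simp [curves]
  rw [hU]
  refine ⟨MeasurableSet.iUnion hi, measure_iUnion_null fun i => ?_⟩
  rw [Measure.volume_eq_prod, Measure.prod_apply_symm (hi i)]
  refine (lintegral_congr fun t => ?_).trans lintegral_zero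
  refine measure_mono_null (t := {γ i t}) (fun x hx => hx.2) (by simp)

lemma countable_curves_slice (J : ℕ → Set ℝ) (γ : ℕ → ℝ → ℝ) (t : ℝ) :
    {x | (x, t) ∈ curves J γ}.Countable :=
  (countable_range fun i => γ i t).mono (by rintro x ⟨i, hi⟩; exact ⟨i, hi.2.symm⟩)

/-! ### The two-shock function as an integral solution -/

section twoShock

variable {f : ℝ → ℝ} {u₀ e₁ e₂ x₁ x₂ : ℝ}

/-- The three states of the two-shock solution. -/
def states (u₀ e₁ e₂ : ℝ) : Fin 3 → ℝ := ![u₀ + e₁ + e₂, u₀ + e₂, u₀]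

/-- The constants making the affine potentials of the three states match at the initial jumps. -/
def offsets (e₁ e₂ x₁ x₂ : ℝ) : Fin 3 → ℝ := ![-(e₁ * x₁), 0, e₂ * x₂]

/-- The potential `p x - f(p) t + c` of the constant solution `p`, for each of the three states. -/
def statePotential (f : ℝ → ℝ) (u₀ e₁ e₂ x₁ x₂ : ℝ) (i : Fin 3) : ℝ × ℝ → ℝ :=
  affineFun (states u₀ e₁ e₂ i) (-f (states u₀ e₁ e₂ i)) (offsets e₁ e₂ x₁ x₂ i)

/-- Off the shock curves, the value of the two-shock solution is the state of least potential. -/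
lemma exists_strict_min (he₁ : 0 < e₁) (he₂ : 0 < e₂)
    (hD : 0 < e₂ * f (u₀ + e₁ + e₂) - (e₁ + e₂) * f (u₀ + e₂) + e₁ * f u₀) {x t : ℝ}
    (h₁ : x ≠ phase₁ f u₀ e₁ e₂ x₁ x₂ t) (h₂ : x ≠ phase₂ f u₀ e₁ e₂ x₁ x₂ t) :
    ∃ j, (∀ i, i ≠ j → statePotential f u₀ e₁ e₂ x₁ x₂ j (x, t) <
        statePotential f u₀ e₁ e₂ x₁ x₂ i (x, t)) ∧
      twoShock f u₀ e₁ e₂ x₁ x₂ x t = states u₀ e₁ e₂ j := by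
  have hle := phase₁_le_phase₂ (x₁ := x₁) (x₂ := x₂) t he₁ he₂ hD
  have hsum : 0 < e₁ + e₂ := by positivity
  have hp1 := phase₁_eq (x₁ := x₁) (x₂ := x₂) t he₁ he₂ hD
  have hp2 := phase₂_eq (x₁ := x₁) (x₂ := x₂) t he₁ he₂ hD
  have hc : e₁ * e₂ * ((f (u₀ + e₁ + e₂) - f (u₀ + e₂)) / e₁ - (f (u₀ + e₂) - f u₀) / e₂) =
    e₂ * f (u₀ + e₁ + e₂) - (e₁ + e₂) * f (u₀ + e₂) + e₁ * f u₀ :=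
    (three_point_eq f u₀ he₁ he₂).symm
  have hm1 := le_max_left (x₂ - x₁ -
        ((f (u₀ + e₁ + e₂) - f (u₀ + e₂)) / e₁ - (f (u₀ + e₂) - f u₀) / e₂) * t) 0
  have hm2 := le_max_right (x₂ - x₁ -
        ((f (u₀ + e₁ + e₂) - f (u₀ + e₂)) / e₁ - (f (u₀ + e₂) - f u₀) / e₂) * t) 0
  have hm3 := max_choice (x₂ - x₁ -
        ((f (u₀ + e₁ + e₂) - f (u₀ + e₂)) / e₁ - (f (u₀ + e₂) - f u₀) / e₂) * t) 0
  have q0 : statePotential f u₀ e₁ e₂ x₁ x₂ 0 (x, t) =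
      (u₀ + e₁ + e₂) * x - f (u₀ + e₁ + e₂) * t - e₁ * x₁ := by
    simp [statePotential, states, offsets, affineFun]; ring
  have q1 : statePotential f u₀ e₁ e₂ x₁ x₂ 1 (x, t) = (u₀ + e₂) * x - f (u₀ + e₂) * t := by
    simp [statePotential, states, offsets, affineFun]; ring
  have q2 : statePotential f u₀ e₁ e₂ x₁ x₂ 2 (x, t) = u₀ * x - f u₀ * t + e₂ * x₂ := by
    simp [statePotential, states, offsets, affineFun]; ring
  simp only [states, twoShock, heaviside]
  -- From here on the claim is polynomial arithmetic. `q 0 < q 1` means `x < x₁ + s₁ t`, `q 1 < q 2`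
  -- means `x < x₂ + s₂ t`, and `q 0 < q 2` means that `x` is left of the barycentre.
  generalize statePotential f u₀ e₁ e₂ x₁ x₂ = q at *
  generalize phase₁ f u₀ e₁ e₂ x₁ x₂ t = φ₁ at *
  generalize phase₂ f u₀ e₁ e₂ x₁ x₂ t = φ₂ at *
  generalize f (u₀ + e₁ + e₂) = A at *
  generalize f (u₀ + e₂) = B at *
  generalize f u₀ = C at *
  generalize (A - B) / e₁ - (B - C) / e₂ = k at *
  generalize hM : max (x₂ - x₁ - k * t) 0 = μ at *
  rw [eq_div_iff hsum.ne'] at hp1 hp2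
  have hkt : e₁ * e₂ * (k * t) = (e₂ * A - (e₁ + e₂) * B + e₁ * C) * t := by rw [← hc]; ring
  rcases lt_or_gt_of_ne h₁ with hx1 | hx1
  · -- left of both shocks
    refine ⟨0, ?_, by rw [if_pos (by linarith), if_pos (by linarith)]; simp⟩
    have hx := mul_lt_mul_of_pos_right hx1 hsum
    rw [hp1] at hx
    have hq := mul_le_mul_of_nonneg_left hm1 (mul_pos he₁ he₂).le
    have hq' := mul_nonneg he₂.le hm2
    rw [Fin.forall_fin_succ, Fin.forall_fin_two]
    refine ⟨fun h => absurd rfl h, fun _ => ?_, fun _ => ?_⟩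
    · have := mul_lt_mul_of_pos_left hx he₁
      change q 0 (x, t) < q 1 (x, t)
      rw [q0, q1]
      refine lt_of_mul_lt_mul_left ?_ hsum.le
      nlinarith
    · change q 0 (x, t) < q 2 (x, t)
      rw [q0, q2]
      nlinarith
  · rcases lt_or_gt_of_ne h₂ with hx2 | hx2
    · -- between the shocks
      refine ⟨1, ?_, by rw [if_neg (by linarith), if_pos (by linarith)]; simp⟩
      -- A point strictly between the phases exists only before merging: `μ = 0` would make the
      -- phases equal.
      have hμ : μ = x₂ - x₁ - k * t := by
        rcases hm3 with h | h
        · exact h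
        · exfalso
          rw [h] at hp1 hp2
          have : φ₁ < φ₂ := by linarith
          nlinarith
      have hx := mul_lt_mul_of_pos_right hx1 hsum
      have hx' := mul_lt_mul_of_pos_right hx2 hsum
      rw [hp1] at hx
      rw [hp2] at hx'
      have hx3 := mul_lt_mul_of_pos_left hx he₁
      have hx4 := mul_lt_mul_of_pos_left hx' he₂
      rw [hμ] at hx3 hx4
      rw [Fin.forall_fin_succ, Fin.forall_fin_two]
      refine ⟨fun _ => ?_, fun h => absurd rfl h, fun _ => ?_⟩
      · change q 1 (x, t) < q 0 (x, t)
        rw [q1, q0]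
        refine lt_of_mul_lt_mul_left ?_ hsum.le
        nlinarith
      · change q 1 (x, t) < q 2 (x, t)
        rw [q1, q2]
        refine lt_of_mul_lt_mul_left ?_ hsum.le
        nlinarith
    · -- right of both shocks
      refine ⟨2, ?_, by rw [if_neg (by linarith), if_neg (by linarith)]; simp⟩
      have hx := mul_lt_mul_of_pos_right hx2 hsum
      rw [hp2] at hx
      have hq := mul_le_mul_of_nonneg_left hm1 (mul_pos he₁ he₂).le
      have hq' := mul_nonneg he₁.le hm2
      rw [Fin.forall_fin_succ, Fin.forall_fin_two]
      refine ⟨fun _ => ?_, fun _ => ?_, fun h => absurd rfl h⟩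
      · change q 2 (x, t) < q 0 (x, t)
        rw [q2, q0]
        nlinarith
      · have := mul_lt_mul_of_pos_left hx he₂
        change q 2 (x, t) < q 1 (x, t)
        rw [q2, q1]
        refine lt_of_mul_lt_mul_left ?_ hsum.le
        nlinarith

/-- The two shock curves, in the format of `IsPiecewiseSmooth`. -/
def shockCurve (f : ℝ → ℝ) (u₀ e₁ e₂ x₁ x₂ : ℝ) (i : ℕ) : ℝ → ℝ :=
  if i = 0 then phase₁ f u₀ e₁ e₂ x₁ x₂ else phase₂ f u₀ e₁ e₂ x₁ x₂

/-- The parameter sets of the shock curves. -/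
def shockTimes (i : ℕ) : Set ℝ := if i < 2 then univ else ∅

lemma ordConnected_shockTimes (i : ℕ) : (shockTimes i).OrdConnected := by
  unfold shockTimes
  split_ifs
  · exact ordConnected_univ
  · exact ordConnected_empty

lemma continuous_shockCurve (he₁ : 0 < e₁) (he₂ : 0 < e₂)
    (hD : 0 < e₂ * f (u₀ + e₁ + e₂) - (e₁ + e₂) * f (u₀ + e₂) + e₁ * f u₀) (i : ℕ) :
    Continuous (shockCurve f u₀ e₁ e₂ x₁ x₂ i) := by
  unfold shockCurve
  split_ifs
  · exact continuous_phase₁ he₁ he₂ hD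
  · exact continuous_phase₂ he₁ he₂ hD

lemma ne_phases_of_notMem_curves {p : ℝ × ℝ}
    (hp : p ∉ curves shockTimes (shockCurve f u₀ e₁ e₂ x₁ x₂)) :
    p.1 ≠ phase₁ f u₀ e₁ e₂ x₁ x₂ p.2 ∧ p.1 ≠ phase₂ f u₀ e₁ e₂ x₁ x₂ p.2 := by
  constructor <;> intro h <;> apply hp
  · exact ⟨0, by simp [shockTimes], by simpa [shockCurve] using h⟩
  · exact ⟨1, by simp [shockTimes], by simpa [shockCurve] using h⟩

lemma eventuallyEq_heaviside {α : Type*} [TopologicalSpace α] {g : α → ℝ} {p : α}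
    (hg : ContinuousAt g p) (hp : g p ≠ 0) :
    (fun q => heaviside (g q)) =ᶠ[𝓝 p] fun _ => heaviside (g p) := by
  rcases lt_or_gt_of_ne hp with h | h
  · filter_upwards [hg.eventually_lt_const h] with q hq
    rw [heaviside, heaviside, if_neg (not_lt.2 hq.le), if_neg (not_lt.2 h.le)]
  · filter_upwards [hg.eventually_const_lt h] with q hq
    rw [heaviside, heaviside, if_pos hq, if_pos h]

lemma twoShock_eventuallyEq (he₁ : 0 < e₁) (he₂ : 0 < e₂)
    (hD : 0 < e₂ * f (u₀ + e₁ + e₂) - (e₁ + e₂) * f (u₀ + e₂) + e₁ * f u₀) {p : ℝ × ℝ}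
    (h₁ : p.1 ≠ phase₁ f u₀ e₁ e₂ x₁ x₂ p.2) (h₂ : p.1 ≠ phase₂ f u₀ e₁ e₂ x₁ x₂ p.2) :
    (fun q : ℝ × ℝ => twoShock f u₀ e₁ e₂ x₁ x₂ q.1 q.2) =ᶠ[𝓝 p]
      fun _ => twoShock f u₀ e₁ e₂ x₁ x₂ p.1 p.2 := by
  have hc1 := continuous_phase₁ (x₁ := x₁) (x₂ := x₂) he₁ he₂ hD
  have hc2 := continuous_phase₂ (x₁ := x₁) (x₂ := x₂) he₁ he₂ hD
  have e1 := eventuallyEq_heaviside (p := p)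
    (g := fun q : ℝ × ℝ => -q.1 + phase₁ f u₀ e₁ e₂ x₁ x₂ q.2) (by fun_prop)
    (fun h => h₁ (by linarith))
  have e2 := eventuallyEq_heaviside (p := p)
    (g := fun q : ℝ × ℝ => -q.1 + phase₂ f u₀ e₁ e₂ x₁ x₂ q.2) (by fun_prop)
    (fun h => h₂ (by linarith))
  filter_upwards [e1, e2] with q hq1 hq2
  simp only [twoShock, hq1, hq2]

lemma tendsto_heaviside_left (x₀ α : ℝ) :
    Tendsto (fun x => heaviside (-x + α)) (𝓝[<] x₀) (𝓝 (if x₀ ≤ α then 1 else 0)) := by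
  split_ifs with h
  · refine tendsto_const_nhds.congr' ?_
    filter_upwards [self_mem_nhdsWithin] with x hx
    have : x < x₀ := hx
    rw [heaviside, if_pos (by linarith)]
  · refine tendsto_const_nhds.congr' ?_
    filter_upwards [nhdsWithin_le_nhds (lt_mem_nhds (not_le.1 h))] with x hx
    rw [heaviside, if_neg (by linarith)]

lemma tendsto_heaviside_right (x₀ α : ℝ) :
    Tendsto (fun x => heaviside (-x + α)) (𝓝[>] x₀) (𝓝 (if x₀ < α then 1 else 0)) := by
  split_ifs with h
  · refine tendsto_const_nhds.congr' ?_
    filter_upwards [nhdsWithin_le_nhds (gt_mem_nhds h)] with x hx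
    rw [heaviside, if_pos (by linarith)]
  · refine tendsto_const_nhds.congr' ?_
    filter_upwards [self_mem_nhdsWithin] with x hx
    have : x₀ < x := hx
    rw [heaviside, if_neg (by linarith)]

/-- A discontinuity lies on one of the curves. The step carried by that curve jumps down there, and
the other one does not jump up. -/
lemma isStable_twoShock (he₁ : 0 < e₁) (he₂ : 0 < e₂)
    (hD : 0 < e₂ * f (u₀ + e₁ + e₂) - (e₁ + e₂) * f (u₀ + e₂) + e₁ * f u₀) (T : ℝ) :
    IsStable T (twoShock f u₀ e₁ e₂ x₁ x₂) := by
  intro p _ hp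
  have hon : p.1 = phase₁ f u₀ e₁ e₂ x₁ x₂ p.2 ∨ p.1 = phase₂ f u₀ e₁ e₂ x₁ x₂ p.2 := by
    by_contra! h
    exact hp ((twoShock_eventuallyEq he₁ he₂ hD h.1 h.2).continuousAt)
  refine ⟨_, _, ((tendsto_heaviside_left _ _).const_mul e₁ |>.const_add u₀).add
    ((tendsto_heaviside_left _ _).const_mul e₂),
    ((tendsto_heaviside_right _ _).const_mul e₁ |>.const_add u₀).add
    ((tendsto_heaviside_right _ _).const_mul e₂), ?_⟩
  have hle : ∀ α : ℝ, (if p.1 < α then (1 : ℝ) else 0) ≤ if p.1 ≤ α then 1 else 0 := fun α => by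
    split_ifs <;> linarith
  have h1 := mul_le_mul_of_nonneg_left (hle (phase₁ f u₀ e₁ e₂ x₁ x₂ p.2)) he₁.le
  have h2 := mul_le_mul_of_nonneg_left (hle (phase₂ f u₀ e₁ e₂ x₁ x₂ p.2)) he₂.le
  rcases hon with h | h
  · rw [← h] at h1 ⊢
    simp only [lt_irrefl, le_refl, if_true, if_false] at h1 ⊢
    linarith
  · rw [← h] at h2 ⊢
    simp only [lt_irrefl, le_refl, if_true, if_false] at h2 ⊢
    linarith

lemma isPiecewiseSmooth_twoShock (he₁ : 0 < e₁) (he₂ : 0 < e₂)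
    (hD : 0 < e₂ * f (u₀ + e₁ + e₂) - (e₁ + e₂) * f (u₀ + e₂) + e₁ * f u₀) (T : ℝ) :
    IsPiecewiseSmooth T (twoShock f u₀ e₁ e₂ x₁ x₂) := by
  refine ⟨shockTimes, shockCurve f u₀ e₁ e₂ x₁ x₂, ordConnected_shockTimes,
    fun i => (continuous_shockCurve he₁ he₂ hD i).continuousOn, fun p _ => ⟨univ, univ_mem, ?_⟩,
    fun p _ hp => ?_⟩
  · refine (finite_lt_nat 2).subset ?_
    rintro i ⟨t, ht, -⟩
    by_contra h
    simp [shockTimes, show ¬ i < 2 from h] at ht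
  · have h := ne_phases_of_notMem_curves (p := p) (f := f) (u₀ := u₀) (e₁ := e₁) (e₂ := e₂)
      (x₁ := x₁) (x₂ := x₂) (fun ⟨i, hi⟩ => hp i hi.1 hi.2)
    exact contDiffAt_const.congr_of_eventuallyEq (twoShock_eventuallyEq he₁ he₂ hD h.1 h.2)

lemma measurableSet_strip (T : ℝ) : MeasurableSet (strip T) :=
  MeasurableSet.univ.prod measurableSet_Ioo

lemma ae_notMem_shockCurves (he₁ : 0 < e₁) (he₂ : 0 < e₂)
    (hD : 0 < e₂ * f (u₀ + e₁ + e₂) - (e₁ + e₂) * f (u₀ + e₂) + e₁ * f u₀) :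
    ∀ᵐ p : ℝ × ℝ, p ∉ curves shockTimes (shockCurve f u₀ e₁ e₂ x₁ x₂) :=
  measure_eq_zero_iff_ae_notMem.1 (volume_curves ordConnected_shockTimes
    fun i => (continuous_shockCurve he₁ he₂ hD i).continuousOn).2

/-- The identity for `u*` is the limit `δ → +0` of the curl identity for `softmin`, whose gradient
stays bounded and converges off the shock curves to `(u*, -f(u*))`. No curve integral or jump
condition has to be written down. -/
lemma integralIdentity_twoShock (he₁ : 0 < e₁) (he₂ : 0 < e₂)
    (hD : 0 < e₂ * f (u₀ + e₁ + e₂) - (e₁ + e₂) * f (u₀ + e₂) + e₁ * f u₀) (T : ℝ) :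
    IntegralIdentity f T (twoShock f u₀ e₁ e₂ x₁ x₂) := by
  intro φ hφ hc hsupp
  simp only [deriv_curry_snd hφ, deriv_curry_fst hφ]
  set Φ : ℝ × ℝ → ℝ := fun p => φ p.1 p.2 with hΦ
  set S : ℝ → ℝ × ℝ → ℝ := fun δ => softmin (states u₀ e₁ e₂)
    (fun i => -f (states u₀ e₁ e₂ i)) (offsets e₁ e₂ x₁ x₂) δ with hS
  have hΦ' : Continuous (fderiv ℝ Φ) := hφ.continuous_fderiv (by simp)
  have hint : ∀ v, Integrable (fun p => fderiv ℝ Φ p v) := fun v =>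
    (hΦ'.clm_apply continuous_const).integrable_of_hasCompactSupport (hc.fderiv_apply ℝ v)
  have hzero : ∀ δ > 0, ∫ p in strip T, (fderiv ℝ (S δ) p (1, 0) * fderiv ℝ Φ p (0, 1)
      - fderiv ℝ (S δ) p (0, 1) * fderiv ℝ Φ p (1, 0)) = 0 := fun δ _ => by
    -- The gradient of `Φ` vanishes off the strip, so the integral may be taken over the plane.
    rw [setIntegral_eq_integral_of_forall_compl_eq_zero,
      integral_gradient_cross_eq_zero (contDiff_softmin _ _ _ _) hφ hc]
    intro p hp
    have : fderiv ℝ Φ p = 0 := by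
      by_contra h
      exact hp (hsupp (support_fderiv_subset ℝ h))
    simp [this]
  have hlim : Tendsto (fun δ => ∫ p in strip T, (fderiv ℝ (S δ) p (1, 0) * fderiv ℝ Φ p (0, 1)
      - fderiv ℝ (S δ) p (0, 1) * fderiv ℝ Φ p (1, 0))) (𝓝[>] 0)
      (𝓝 (∫ p in strip T, (twoShock f u₀ e₁ e₂ x₁ x₂ p.1 p.2 * fderiv ℝ Φ p (0, 1)
        + f (twoShock f u₀ e₁ e₂ x₁ x₂ p.1 p.2) * fderiv ℝ Φ p (1, 0)))) := by
    refine tendsto_integral_filter_of_dominated_convergence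
      (fun p => (∑ i, |states u₀ e₁ e₂ i|) * |fderiv ℝ Φ p (0, 1)|
        + (∑ i, |-f (states u₀ e₁ e₂ i)|) * |fderiv ℝ Φ p (1, 0)|) ?_ ?_ ?_ ?_
    · refine Eventually.of_forall fun δ => Continuous.aestronglyMeasurable ?_
      have h1 : Continuous (fderiv ℝ (S δ)) :=
        (contDiff_softmin _ _ _ _).continuous_fderiv (by simp)
      fun_prop
    · filter_upwards [self_mem_nhdsWithin] with δ hδ
      refine Eventually.of_forall fun p => ?_
      rw [fderiv_softmin hδ, fderiv_softmin hδ]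
      simp only [mul_one, mul_zero, add_zero, zero_add]
      refine (norm_sub_le _ _).trans (add_le_add ?_ ?_)
      · rw [norm_mul]
        exact mul_le_mul_of_nonneg_right (abs_sum_softWeight_mul_le _) (norm_nonneg _)
      · rw [norm_mul]
        exact mul_le_mul_of_nonneg_right (abs_sum_softWeight_mul_le _) (norm_nonneg _)
    · exact (((hint _).abs.const_mul _).add ((hint _).abs.const_mul _)).integrableOn
    · refine ae_restrict_of_ae ?_
      filter_upwards [ae_notMem_shockCurves (x₁ := x₁) (x₂ := x₂) he₁ he₂ hD] with p hp
      obtain ⟨h1, h2⟩ := ne_phases_of_notMem_curves hp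
      obtain ⟨j, hj, hval⟩ := exists_strict_min he₁ he₂ hD h1 h2
      rw [hval, show states u₀ e₁ e₂ j * fderiv ℝ Φ p (0, 1) + f (states u₀ e₁ e₂ j) *
        fderiv ℝ Φ p (1, 0) = states u₀ e₁ e₂ j * fderiv ℝ Φ p (0, 1) - -f (states u₀ e₁ e₂ j) *
        fderiv ℝ Φ p (1, 0) by ring]
      have ht := fun d => tendsto_sum_softWeight (a := states u₀ e₁ e₂)
        (b := fun i => -f (states u₀ e₁ e₂ i)) (c := offsets e₁ e₂ x₁ x₂) (q := p) hj d
      refine (((ht _).mul_const _).sub ((ht fun i => -f (states u₀ e₁ e₂ i)).mul_const _)).congr' ?_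
      filter_upwards [self_mem_nhdsWithin] with δ hδ
      rw [fderiv_softmin hδ, fderiv_softmin hδ]
      simp only [mul_one, mul_zero, add_zero, zero_add]
  refine tendsto_nhds_unique hlim (tendsto_const_nhds.congr' ?_)
  filter_upwards [self_mem_nhdsWithin] with δ hδ using (hzero δ hδ).symm

lemma isIntegralSolution_twoShock (he₁ : 0 < e₁) (he₂ : 0 < e₂) (hx : x₁ < x₂)
    (hD : 0 < e₂ * f (u₀ + e₁ + e₂) - (e₁ + e₂) * f (u₀ + e₂) + e₁ * f u₀) (T : ℝ) :
    IsIntegralSolution f T (initialData u₀ e₁ e₂ x₁ x₂) (twoShock f u₀ e₁ e₂ x₁ x₂) := by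
  refine ⟨⟨|u₀| + e₁ + e₂, fun p _ => ?_⟩, isPiecewiseSmooth_twoShock he₁ he₂ hD T,
    isStable_twoShock he₁ he₂ hD T, integralIdentity_twoShock he₁ he₂ hD T, fun φ hφ => ?_⟩
  · have h1 := heaviside_mem (-p.1 + phase₁ f u₀ e₁ e₂ x₁ x₂ p.2)
    have h2 := heaviside_mem (-p.1 + phase₂ f u₀ e₁ e₂ x₁ x₂ p.2)
    have h3 := neg_abs_le u₀
    have h4 := le_abs_self u₀
    rw [abs_le, twoShock]
    constructor <;> nlinarith [h1.1, h1.2, h2.1, h2.2]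
  · obtain ⟨B, hB0, hB⟩ := hφ.bound
    rw [tendsto_iff_norm_sub_tendsto_zero]
    have hc1 := continuous_phase₁ (x₁ := x₁) (x₂ := x₂) he₁ he₂ hD
    have hc2 := continuous_phase₂ (x₁ := x₁) (x₂ := x₂) he₁ he₂ hD
    have hlim : Tendsto (fun t => (e₁ + e₂) * B * (|phase₁ f u₀ e₁ e₂ x₁ x₂ t - x₁|
        + |phase₂ f u₀ e₁ e₂ x₁ x₂ t - x₂|)) (𝓝[>] 0) (𝓝 0) := by
      refine (Continuous.tendsto' (by fun_prop) 0 0 ?_).mono_left nhdsWithin_le_nhds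
      rw [phase₁_zero he₁ he₂ hx hD, phase₂_zero he₁ he₂ hx hD]
      simp
    refine squeeze_zero (fun _ => norm_nonneg _) (fun t => ?_) hlim
    simp only [initialData_eq_heaviside hx]
    exact abs_integral_steps_sub_le hφ hB he₁ he₂ (le_add_of_nonneg_right (abs_nonneg _))
      (le_add_of_nonneg_left (abs_nonneg _))

end twoShock

/-! ### Tools for test functions of one variable -/

lemma IsTest.exists_radius {ψ : ℝ → ℝ} (hψ : IsTest ψ) :
    ∃ R, 0 < R ∧ ∀ x, R ≤ |x| → ψ x = 0 := by
  obtain ⟨R, hR⟩ := hψ.2.isCompact.isBounded.subset_closedBall (0 : ℝ)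
  refine ⟨max R 0 + 1, by positivity, fun x hx => ?_⟩
  by_contra h
  have := hR (subset_tsupport _ h)
  rw [mem_closedBall_zero_iff, Real.norm_eq_abs] at this
  linarith [le_max_left R 0]

lemma deriv_eq_zero_of_radius {ψ : ℝ → ℝ} {R : ℝ} (hR : ∀ x, R ≤ |x| → ψ x = 0) {x : ℝ}
    (hx : R < |x|) : deriv ψ x = 0 := by
  have : ψ =ᶠ[𝓝 x] fun _ => 0 := by
    filter_upwards [continuous_abs.continuousAt.eventually_const_lt hx] with y hy
    exact hR y hy.le
  rw [this.deriv_eq, deriv_const]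

/-- Integration by parts against a test function, for a continuous function which is differentiable
off a countable set with bounded derivative. -/
lemma integral_mul_deriv_test {W w : ℝ → ℝ} {C : Set ℝ} (hC : C.Countable) (hW : Continuous W)
    (hd : ∀ x ∉ C, HasDerivAt W (w x) x) (hwm : AEStronglyMeasurable w volume) {M : ℝ}
    (hb : ∀ x, |w x| ≤ M) {ψ : ℝ → ℝ} (hψ : IsTest ψ) :
    ∫ x, W x * deriv ψ x = -∫ x, w x * ψ x := by
  obtain ⟨R, hR0, hR⟩ := hψ.exists_radius
  have hi1 : Integrable (fun x => w x * ψ x) :=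
    hψ.integrable.bdd_mul hwm (Eventually.of_forall hb)
  have hi2 : Integrable (fun x => W x * deriv ψ x) :=
    (hW.mul hψ.deriv.1.continuous).integrable_of_hasCompactSupport hψ.deriv.2.mul_left
  have h := integral_eq_of_hasDerivAt_off_countable_of_le (fun x => W x * ψ x)
    (fun x => w x * ψ x + W x * deriv ψ x) (a := -(R + 1)) (b := R + 1) (by linarith) hC
    (hW.mul hψ.1.continuous).continuousOn
    (fun x hx => (hd x hx.2).mul (hψ.1.differentiable (by simp) x).hasDerivAt)
    ((hi1.add hi2).intervalIntegrable)
  rw [hR (R + 1) (by rw [abs_of_pos] <;> linarith),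
    hR (-(R + 1)) (by rw [abs_neg, abs_of_pos] <;> linarith),
    intervalIntegral.integral_eq_integral_of_support_subset, integral_add hi1 hi2] at h
  · linarith
  · intro x hx
    by_contra hx'
    apply hx
    have : R < |x| := by
      rw [mem_Ioc, not_and_or, not_lt, not_le] at hx'
      rcases hx' with h | h
      · exact lt_abs.2 (Or.inr (by linarith))
      · exact lt_abs.2 (Or.inl (by linarith))
    simp only [hR x this.le, deriv_eq_zero_of_radius hR this, mul_zero, add_zero]

/-- A test function of integral zero has a primitive which is a test function. -/
lemma exists_primitive_test {θ : ℝ → ℝ} (hθ : IsTest θ) (h0 : ∫ x, θ x = 0) {α β : ℝ}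
    (hαβ : ∀ x ∉ Icc α β, θ x = 0) :
    ∃ ψ, IsTest ψ ∧ deriv ψ = θ ∧ ∀ x ∉ Icc α β, ψ x = 0 := by
  have hd : ∀ x, HasDerivAt (fun x => ∫ y in Iic x, θ y) (θ x) x := fun x => by
    have h2 : (fun z => ∫ η in Iic z, θ η) =
        fun z => (∫ η in (0 : ℝ)..z, θ η) + ∫ η in Iic 0, θ η := by
      funext z
      rw [← intervalIntegral.integral_Iic_sub_Iic hθ.integrable.integrableOn
        hθ.integrable.integrableOn]
      ring
    rw [h2]
    exact (intervalIntegral.integral_hasDerivAt_right (hθ.1.continuous.intervalIntegrable _ _)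
      hθ.1.continuous.stronglyMeasurable.stronglyMeasurableAtFilter
      hθ.1.continuous.continuousAt).add_const _
  have hder : deriv (fun x => ∫ y in Iic x, θ y) = θ := funext fun x => (hd x).deriv
  have hout : ∀ x ∉ Icc α β, ∫ y in Iic x, θ y = 0 := by
    intro x hx
    rw [mem_Icc, not_and_or, not_le, not_le] at hx
    rcases hx with h | h
    · refine setIntegral_eq_zero_of_forall_eq_zero fun y hy => hαβ y fun hy' => ?_
      have : y ≤ x := hy
      linarith [hy'.1]
    · rw [setIntegral_eq_integral_of_forall_compl_eq_zero, h0]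
      intro y hy
      refine hαβ y fun hy' => hy ?_
      exact (hy'.2.trans h.le : y ≤ x)
  refine ⟨fun x => ∫ y in Iic x, θ y, ⟨?_, ?_⟩, hder, hout⟩
  · rw [contDiff_infty_iff_deriv, hder]
    exact ⟨fun x => (hd x).differentiableAt, hθ.1⟩
  · exact HasCompactSupport.intro isCompact_Icc hout

/-- Normalized bump functions. -/
lemma exists_bump (x₀ : ℝ) {r : ℝ} (hr : 0 < r) :
    ∃ χ : ℝ → ℝ, IsTest χ ∧ (∀ y, 0 ≤ χ y) ∧ (∫ y, χ y = 1) ∧ ∀ y, r ≤ |y - x₀| → χ y = 0 := by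
  let b : ContDiffBump x₀ := ⟨r / 2, r, by positivity, by linarith⟩
  refine ⟨b.normed volume, ⟨b.contDiff_normed, b.hasCompactSupport_normed⟩, b.nonneg_normed,
    b.integral_normed, fun y hy => ?_⟩
  by_contra h
  have h2 : y ∈ Function.support (b.normed volume) := h
  rw [b.support_normed_eq, Metric.mem_ball, Real.dist_eq] at h2
  exact absurd h2 (not_lt.2 hy)

lemma abs_integral_mul_bump_sub_le {χ h : ℝ → ℝ} {x₀ r A ε : ℝ} (hχ : IsTest χ)
    (hχ0 : ∀ y, 0 ≤ χ y) (hχ1 : ∫ y, χ y = 1) (hχr : ∀ y, r ≤ |y - x₀| → χ y = 0)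
    (hi : Integrable (fun y => h y * χ y)) (hA : ∀ y, |y - x₀| < r → |h y - A| ≤ ε) :
    |(∫ y, h y * χ y) - A| ≤ ε := by
  have h1 : (∫ y, h y * χ y) - A = ∫ y, (h y - A) * χ y := by
    simp only [sub_mul]
    rw [integral_sub hi (hχ.integrable.const_mul A), integral_const_mul, hχ1, mul_one]
  rw [h1]
  calc |∫ y, (h y - A) * χ y| ≤ ∫ y, ε * χ y := by
        rw [← Real.norm_eq_abs]
        refine norm_integral_le_of_norm_le (hχ.integrable.const_mul ε)
          (Eventually.of_forall fun y => ?_)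
        rw [norm_mul, Real.norm_eq_abs, Real.norm_eq_abs, abs_of_nonneg (hχ0 y)]
        rcases lt_or_ge |y - x₀| r with hy | hy
        · exact mul_le_mul_of_nonneg_right (hA y hy) (hχ0 y)
        · simp [hχr y hy]
    _ = ε := by rw [integral_const_mul, hχ1, mul_one]

lemma IsTest.translate {χ : ℝ → ℝ} (hχ : IsTest χ) (a : ℝ) : IsTest fun y => χ (y - a) :=
  ⟨hχ.1.comp (contDiff_id.sub contDiff_const), hχ.2.comp_homeomorph (Homeomorph.subRight a)⟩

lemma IsTest.sub_const_mul {χ χ₀ : ℝ → ℝ} (hχ : IsTest χ) (hχ₀ : IsTest χ₀) (k : ℝ) :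
    IsTest fun y => χ y - k * χ₀ y :=
  ⟨hχ.1.sub (contDiff_const.mul hχ₀.1), hχ.2.sub hχ₀.2.mul_left⟩

/-! ### Bounded functions on the strip which are continuous off a negligible set -/

/-- `v` is bounded by `M` on the strip, and continuous there off the negligible set `Z`, which meets
every line `t = const` in a countable set. -/
structure IsRegular (T M : ℝ) (v : ℝ → ℝ → ℝ) (Z : Set (ℝ × ℝ)) : Prop where
  bound : ∀ x, ∀ t ∈ Ioo 0 T, |v x t| ≤ M
  meas : MeasurableSet Z
  null : volume Z = 0
  slice : ∀ t, {x | (x, t) ∈ Z}.Countable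
  cont : ∀ x, ∀ t ∈ Ioo 0 T, (x, t) ∉ Z → ContinuousAt (fun q : ℝ × ℝ => v q.1 q.2) (x, t)

/-- The pairing `⟨F(v(·, t)), χ⟩`. -/
def pairing (F : ℝ → ℝ) (v : ℝ → ℝ → ℝ) (χ : ℝ → ℝ) (t : ℝ) : ℝ := ∫ x, F (v x t) * χ x

section regular

variable {T M : ℝ} {v : ℝ → ℝ → ℝ} {Z : Set (ℝ × ℝ)}

lemma IsRegular.continuousAt_slice (h : IsRegular T M v Z) {x t : ℝ} (ht : t ∈ Ioo 0 T)
    (hx : (x, t) ∉ Z) : ContinuousAt (fun y => v y t) x :=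
  (h.cont x t ht hx).comp (f := fun y : ℝ => (y, t)) (by fun_prop)

lemma IsRegular.ae_notMem (h : IsRegular T M v Z) (t : ℝ) : ∀ᵐ x, (x, t) ∉ Z :=
  measure_eq_zero_iff_ae_notMem.1 ((h.slice t).measure_zero volume)

lemma IsRegular.aestronglyMeasurable_slice (h : IsRegular T M v Z) {t : ℝ} (ht : t ∈ Ioo 0 T) :
    AEStronglyMeasurable (fun x => v x t) volume := by
  have h1 : ContinuousOn (fun x => v x t) {x | (x, t) ∈ Z}ᶜ := fun x hx =>
    (h.continuousAt_slice ht hx).continuousWithinAt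
  have h2 := h1.aestronglyMeasurable (μ := volume) (h.slice t).measurableSet.compl
  rwa [Measure.restrict_eq_self_of_ae_mem] at h2
  exact h.ae_notMem t

lemma IsRegular.aestronglyMeasurable (h : IsRegular T M v Z) :
    AEStronglyMeasurable (fun q : ℝ × ℝ => v q.1 q.2) (volume.restrict (strip T)) := by
  have h1 : ContinuousOn (fun q : ℝ × ℝ => v q.1 q.2) (strip T \ Z) := fun q hq =>
    (h.cont q.1 q.2 hq.1.2 hq.2).continuousWithinAt
  have h2 := h1.aestronglyMeasurable (μ := volume) ((measurableSet_strip T).diff h.meas)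
  rwa [Measure.restrict_congr_set (sdiff_null_ae_eq_self h.null)] at h2

lemma exists_bound_of_continuous {F : ℝ → ℝ} (hF : Continuous F) (M : ℝ) :
    ∃ K, 0 ≤ K ∧ ∀ y, |y| ≤ M → |F y| ≤ K := by
  obtain ⟨K, hK⟩ := isCompact_Icc.exists_bound_of_continuousOn (s := Icc (-M) M) hF.continuousOn
  exact ⟨max K 0, le_max_right _ _, fun y hy => (hK y (abs_le.1 hy)).trans (le_max_left _ _)⟩

variable {F χ : ℝ → ℝ}

lemma IsRegular.integrable_mul (h : IsRegular T M v Z) (hF : Continuous F) (hχ : IsTest χ) {t : ℝ}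
    (ht : t ∈ Ioo 0 T) : Integrable fun x => F (v x t) * χ x := by
  obtain ⟨K, -, hK⟩ := exists_bound_of_continuous hF M
  exact hχ.integrable.bdd_mul (hF.comp_aestronglyMeasurable (h.aestronglyMeasurable_slice ht))
    (Eventually.of_forall fun x => hK _ (h.bound x t ht))

lemma IsRegular.exists_pairing_bound (h : IsRegular T M v Z) (hF : Continuous F) (hχ : IsTest χ) :
    ∃ K, ∀ t ∈ Ioo 0 T, |pairing F v χ t| ≤ K := by
  obtain ⟨K, -, hK⟩ := exists_bound_of_continuous hF M
  refine ⟨∫ x, K * |χ x|, fun t ht => ?_⟩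
  rw [← Real.norm_eq_abs]
  refine norm_integral_le_of_norm_le (hχ.integrable.abs.const_mul K)
    (Eventually.of_forall fun x => ?_)
  rw [norm_mul]
  exact mul_le_mul_of_nonneg_right (hK _ (h.bound x t ht)) (norm_nonneg _)

/-- The exceptional set meets the line at time `t` in a null set, so `v(x, s) → v(x, t)` for almost
every `x`; dominated convergence does the rest. The initial value is thereby linked to genuine
values at each time. -/
lemma IsRegular.continuousAt_pairing (h : IsRegular T M v Z) (hF : Continuous F) (hχ : IsTest χ)
    {t : ℝ} (ht : t ∈ Ioo 0 T) : ContinuousAt (pairing F v χ) t := by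
  obtain ⟨K, -, hK⟩ := exists_bound_of_continuous hF M
  have hT : ∀ᶠ s in 𝓝 t, s ∈ Ioo 0 T := isOpen_Ioo.mem_nhds ht
  refine tendsto_integral_filter_of_dominated_convergence (fun x => K * |χ x|) ?_ ?_
    (hχ.integrable.abs.const_mul K) ?_
  · filter_upwards [hT] with s hs using (h.integrable_mul hF hχ hs).aestronglyMeasurable
  · filter_upwards [hT] with s hs
    refine Eventually.of_forall fun x => ?_
    rw [norm_mul]
    exact mul_le_mul_of_nonneg_right (hK _ (h.bound x s hs)) (norm_nonneg _)
  · filter_upwards [h.ae_notMem t] with x hx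
    have h1 : ContinuousAt (fun s => v x s) t :=
      (h.cont x t ht hx).comp (f := fun s : ℝ => (x, s)) (by fun_prop)
    exact (hF.continuousAt.comp h1).mul_const (χ x)

lemma IsRegular.continuousOn_pairing (h : IsRegular T M v Z) (hF : Continuous F) (hχ : IsTest χ) :
    ContinuousOn (pairing F v χ) (Ioo 0 T) := fun _ ht =>
  (h.continuousAt_pairing hF hχ ht).continuousWithinAt

lemma IsRegular.intervalIntegrable_pairing (h : IsRegular T M v Z) (hF : Continuous F)
    (hχ : IsTest χ) {s t : ℝ} (hs : s ∈ Ico 0 T) (ht : t ∈ Ico 0 T) :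
    IntervalIntegrable (pairing F v χ) volume s t := by
  obtain ⟨K, hK⟩ := h.exists_pairing_bound hF hχ
  have hm : AEStronglyMeasurable (pairing F v χ) (volume.restrict (Ioo 0 T)) :=
    (h.continuousOn_pairing hF hχ).aestronglyMeasurable measurableSet_Ioo
  have h1 : IntegrableOn (pairing F v χ) (Ioo 0 T) := by
    refine Integrable.of_bound hm K ?_
    exact (ae_restrict_mem measurableSet_Ioo).mono fun t ht => hK t ht
  rw [intervalIntegrable_iff]
  refine h1.mono_set ?_
  intro y hy
  rw [uIoc, mem_Ioc] at hy
  exact ⟨lt_of_le_of_lt (le_min hs.1 ht.1) hy.1, lt_of_le_of_lt hy.2 (max_lt hs.2 ht.2)⟩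

/-! ### From the integral identity to an evolution equation for pairings -/

variable {f : ℝ → ℝ}

/-- The integral identity for products of test functions. -/
lemma IsRegular.weak_form (h : IsRegular T M v Z) (hf : Continuous f)
    (hid : IntegralIdentity f T v) (hχ : IsTest χ) {ψ : ℝ → ℝ} (hψ : IsTest ψ)
    (hψT : tsupport ψ ⊆ Ioo 0 T) :
    ∫ t in Ioo 0 T, (deriv ψ t * pairing id v χ t + ψ t * pairing f v (deriv χ) t) = 0 := by
  have hsupp : Function.support (fun p : ℝ × ℝ => χ p.1 * ψ p.2) ⊆ tsupport χ ×ˢ tsupport ψ := by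
    intro p hp
    rw [Function.mem_support, mul_ne_zero_iff] at hp
    exact ⟨subset_tsupport _ hp.1, subset_tsupport _ hp.2⟩
  have h1 := hid (fun x t => χ x * ψ t)
    ((hχ.1.comp contDiff_fst).mul (hψ.1.comp contDiff_snd))
    (HasCompactSupport.of_support_subset_isCompact (hχ.2.isCompact.prod hψ.2.isCompact) hsupp)
    (by
      refine (closure_minimal hsupp ((isClosed_tsupport _).prod (isClosed_tsupport _))).trans ?_
      exact prod_mono (subset_univ _) hψT)
  have hd1 : ∀ p : ℝ × ℝ, deriv (fun s => χ p.1 * ψ s) p.2 = χ p.1 * deriv ψ p.2 := fun p =>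
    deriv_const_mul _ (hψ.1.differentiable (by simp) _)
  have hd2 : ∀ p : ℝ × ℝ, deriv (fun y => χ y * ψ p.2) p.1 = deriv χ p.1 * ψ p.2 := fun p =>
    deriv_mul_const (hχ.1.differentiable (by simp) _) _
  simp only [hd1, hd2] at h1
  have hμ : (volume.restrict (strip T) : Measure (ℝ × ℝ)) =
      (volume : Measure ℝ).prod ((volume : Measure ℝ).restrict (Ioo 0 T)) := by
    rw [strip, Measure.volume_eq_prod, ← Measure.prod_restrict, Measure.restrict_univ]
  have hbd : ∀ {F χ ψ : ℝ → ℝ}, Continuous F → IsTest χ → IsTest ψ →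
      Integrable (fun p : ℝ × ℝ => F (v p.1 p.2) * (χ p.1 * ψ p.2)) (volume.restrict (strip T)) := by
    intro F χ ψ hF hχ hψ
    obtain ⟨K, -, hK⟩ := exists_bound_of_continuous hF M
    refine Integrable.bdd_mul (c := K) ?_ (hF.comp_aestronglyMeasurable h.aestronglyMeasurable) ?_
    · rw [hμ]
      exact hχ.integrable.mul_prod hψ.integrable.integrableOn
    · exact (ae_restrict_mem (measurableSet_strip T)).mono fun p hp => hK _ (h.bound _ _ hp.2)
  have hI := (hbd continuous_id hχ hψ.deriv).add (hbd hf hχ.deriv hψ)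
  simp only [id] at hI
  have h2 : ∫ p, ((fun p : ℝ × ℝ => v p.1 p.2 * (χ p.1 * deriv ψ p.2)) + fun p : ℝ × ℝ =>
    f (v p.1 p.2) * (deriv χ p.1 * ψ p.2)) p ∂(volume.restrict (strip T)) = 0 := h1
  rw [hμ] at hI h2
  rw [integral_prod_symm _ hI] at h2
  refine Eq.trans ?_ h2
  refine setIntegral_congr_fun measurableSet_Ioo fun t ht => ?_
  simp only [Pi.add_apply, pairing]
  rw [integral_add, ← integral_const_mul, ← integral_const_mul]
  · congr 1
    · congr 1; funext x; simp only [id]; ring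
    · congr 1; funext x; ring
  · have := (h.integrable_mul continuous_id hχ ht).mul_const (deriv ψ t)
    exact this.congr (Eventually.of_forall fun x => by simp only [id]; ring)
  · have := (h.integrable_mul hf hχ.deriv ht).mul_const (ψ t)
    exact this.congr (Eventually.of_forall fun x => by ring)

/-- A continuous function on an open interval is constant if it is orthogonal to all test functions
of integral zero. -/
lemma eq_of_integral_mul_test_eq_zero {n : ℝ → ℝ} (hn : ContinuousOn n (Ioo 0 T))
    (h0 : ∀ θ : ℝ → ℝ, IsTest θ → ∫ t, θ t = 0 → ∀ α β, α < β → Icc α β ⊆ Ioo 0 T →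
      (∀ t ∉ Icc α β, θ t = 0) → ∫ t, n t * θ t = 0) {t₁ t₂ : ℝ} (ht₁ : t₁ ∈ Ioo 0 T)
    (ht₂ : t₂ ∈ Ioo 0 T) (hlt : t₁ < t₂) : n t₁ = n t₂ := by
  refine eq_of_abs_sub_le_all fun ε hε => ?_
  have hnear : ∀ t ∈ Ioo 0 T, ∀ᶠ r in 𝓝[>] (0 : ℝ), ∀ y, |y - t| ≤ r → |n y - n t| ≤ ε / 2 := by
    intro t ht
    obtain ⟨δ, hδ, hδn⟩ := Metric.continuousAt_iff.1
      ((hn t ht).continuousAt (isOpen_Ioo.mem_nhds ht)) (ε / 2) (by positivity)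
    filter_upwards [Ioo_mem_nhdsGT hδ] with r hr y hy
    exact (hδn (x := y) (lt_of_le_of_lt hy hr.2)).le
  obtain ⟨r, ⟨⟨h1, h2⟩, h3⟩, h4⟩ := (((hnear t₁ ht₁).and (hnear t₂ ht₂)).and
    (Ioo_mem_nhdsGT (lt_min ht₁.1 (sub_pos.2 ht₂.2)))).and self_mem_nhdsWithin |>.exists
  have hr : 0 < r := h4
  have hr1 : r < t₁ := h3.2.trans_le (min_le_left _ _)
  have hr2 : r < T - t₂ := h3.2.trans_le (min_le_right _ _)
  obtain ⟨b₁, hb₁, hb₁0, hb₁1, hb₁r⟩ := exists_bump t₁ hr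
  obtain ⟨b₂, hb₂, hb₂0, hb₂1, hb₂r⟩ := exists_bump t₂ hr
  have hsub : Icc (t₁ - r) (t₂ + r) ⊆ Ioo 0 T := fun y hy =>
    ⟨by linarith [hy.1], by linarith [hy.2]⟩
  have hout : ∀ {b : ℝ → ℝ} {t : ℝ}, t₁ ≤ t → t ≤ t₂ → (∀ y, r ≤ |y - t| → b y = 0) →
      ∀ y ∉ Icc (t₁ - r) (t₂ + r), b y = 0 := fun {b t} ht ht' hb y hy => by
    apply hb
    rw [mem_Icc, not_and_or, not_le, not_le] at hy
    rcases hy with h | h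
    · exact le_abs.2 (Or.inr (by linarith))
    · exact le_abs.2 (Or.inl (by linarith))
  have hint : ∀ {b : ℝ → ℝ}, IsTest b → (∀ y ∉ Icc (t₁ - r) (t₂ + r), b y = 0) →
      Integrable (fun y => n y * b y) := fun {b} hb hb0 => by
    have h5 : IntegrableOn (fun y => n y * b y) (Icc (t₁ - r) (t₂ + r)) :=
      ((hn.mono hsub).mul hb.1.continuous.continuousOn).integrableOn_Icc
    rwa [integrableOn_iff_integrable_of_support_subset] at h5
    intro y hy
    by_contra hy'
    exact hy (by simp [hb0 y hy'])
  have hi₁ := hint hb₁ (hout le_rfl hlt.le hb₁r)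
  have hi₂ := hint hb₂ (hout hlt.le le_rfl hb₂r)
  -- The difference of two unit bumps at `t₂` and `t₁` has integral zero, and each of the two
  -- pairings is within `ε / 2` of the value of `n` at the centre.
  have hz := h0 (fun t => b₂ t - 1 * b₁ t) (hb₂.sub_const_mul hb₁ 1)
    (by
      rw [integral_sub hb₂.integrable (hb₁.integrable.const_mul 1), integral_const_mul, hb₁1, hb₂1]
      ring) (t₁ - r) (t₂ + r) (by linarith) hsub
    (fun t ht => by rw [hout le_rfl hlt.le hb₁r t ht, hout hlt.le le_rfl hb₂r t ht]; ring)
  simp only [one_mul, mul_sub] at hz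
  rw [integral_sub hi₂ hi₁] at hz
  have e1 := abs_le.1 (abs_integral_mul_bump_sub_le hb₁ hb₁0 hb₁1 hb₁r hi₁
    fun y hy => h1 y hy.le)
  have e2 := abs_le.1 (abs_integral_mul_bump_sub_le hb₂ hb₂0 hb₂1 hb₂r hi₂
    fun y hy => h2 y hy.le)
  rw [abs_le]
  constructor <;> linarith [e1.1, e1.2, e2.1, e2.2]

lemma IsRegular.hasDerivAt_integral_pairing (h : IsRegular T M v Z) (hF : Continuous F)
    (hχ : IsTest χ) {s t : ℝ} (hs : s ∈ Ico 0 T) (ht : t ∈ Ioo 0 T) :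
    HasDerivAt (fun t => ∫ τ in s..t, pairing F v χ τ) (pairing F v χ t) t :=
  intervalIntegral.integral_hasDerivAt_right
    (h.intervalIntegrable_pairing hF hχ hs (Ioo_subset_Ico_self ht))
    ((h.continuousOn_pairing hF hχ).stronglyMeasurableAtFilter isOpen_Ioo t ht)
    (h.continuousAt_pairing hF hχ ht)

/-- Du Bois-Reymond's lemma in time: the weak derivative of `⟨v, χ⟩` is `⟨f(v), χ'⟩`, so subtracting
a primitive of the latter leaves a continuous function with zero weak derivative. -/
lemma IsRegular.pairing_sub_eq (h : IsRegular T M v Z) (hf : Continuous f)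
    (hid : IntegralIdentity f T v) (hχ : IsTest χ) {t₁ t₂ : ℝ} (ht₁ : t₁ ∈ Ioo 0 T)
    (ht₂ : t₂ ∈ Ioo 0 T) (hlt : t₁ < t₂) :
    pairing id v χ t₂ = pairing id v χ t₁ + ∫ τ in t₁..t₂, pairing f v (deriv χ) τ := by
  have hQ := fun t ht => h.hasDerivAt_integral_pairing (t := t) hf hχ.deriv
    (Ioo_subset_Ico_self ht₁) ht
  have hm := h.continuousOn_pairing continuous_id hχ
  have hQc : ContinuousOn (fun t => ∫ τ in t₁..t, pairing f v (deriv χ) τ) (Ioo 0 T) :=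
    fun t ht => (hQ t ht).continuousAt.continuousWithinAt
  have key := eq_of_integral_mul_test_eq_zero
    (n := fun t => pairing id v χ t - ∫ τ in t₁..t, pairing f v (deriv χ) τ)
    (hm.sub hQc) ?_ ht₁ ht₂ hlt
  · simp only [intervalIntegral.integral_same] at key
    linarith
  · intro θ hθ hθ0 α β hαβ hsub hout
    obtain ⟨ψ, hψ, rfl, hψout⟩ := exists_primitive_test hθ hθ0 hout
    have hts : tsupport ψ ⊆ Icc α β :=
      closure_minimal (fun y hy => by by_contra hy'; exact hy (hψout y hy')) isClosed_Icc
    have hw := h.weak_form hf hid hχ hψ (hts.trans hsub)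
    have hred : ∀ g : ℝ → ℝ, (∀ y ∉ Icc α β, g y = 0) →
        (∫ t, g t = ∫ t in Icc α β, g t) ∧ (∫ t in Ioo 0 T, g t = ∫ t in Icc α β, g t) := by
      intro g hg
      have h1 := setIntegral_eq_integral_of_forall_compl_eq_zero (μ := volume) hg
      refine ⟨h1.symm, ?_⟩
      rw [h1]
      exact setIntegral_eq_integral_of_forall_compl_eq_zero fun y hy => hg y fun hy' => hy (hsub hy')
    have hci : ∀ {g : ℝ → ℝ}, ContinuousOn g (Ioo 0 T) → ∀ {ψ : ℝ → ℝ}, IsTest ψ →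
        IntegrableOn (fun t => g t * ψ t) (Icc α β) := fun hg _ hψ =>
      ((hg.mono hsub).mul hψ.1.continuous.continuousOn).integrableOn_Icc
    have hq := h.continuousOn_pairing hf hχ.deriv
    rw [(hred _ (fun y hy => by rw [hout y hy, hψout y hy]; ring)).2] at hw
    rw [(hred _ (fun y hy => by rw [hout y hy]; ring)).1]
    have hparts : ∫ t in α..β, (deriv ψ t * (∫ τ in t₁..t, pairing f v (deriv χ) τ) +
        ψ t * pairing f v (deriv χ) t) = 0 := by
      have hu : uIcc α β = Icc α β := uIcc_of_le hαβ.le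
      have h1 := intervalIntegral.integral_deriv_mul_eq_sub (a := α) (b := β) (u := ψ)
        (u' := deriv ψ) (v := fun t => ∫ τ in t₁..t, pairing f v (deriv χ) τ)
        (v' := pairing f v (deriv χ))
        (fun t _ => (hψ.1.differentiable (by simp) t).hasDerivAt)
        (fun t ht => hQ t (hsub (hu ▸ ht)))
        (hψ.deriv.1.continuous.intervalIntegrable _ _)
        ((hq.mono (hu ▸ hsub)).intervalIntegrable)
      -- `ψ` is known to vanish only off `[α, β]`; the endpoints are reached by continuity.
      have hends : ψ α = 0 ∧ ψ β = 0 := by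
        have hzero : ∀ y, y ∈ closure (Icc α β)ᶜ → ψ y = 0 := fun y hy =>
          closure_minimal (t := {y | ψ y = 0}) (fun z hz => hψout z hz)
            (isClosed_eq hψ.1.continuous continuous_const) hy
        constructor <;> apply hzero
        · rw [closure_compl, interior_Icc]; simp
        · rw [closure_compl, interior_Icc]; simp
      rw [hends.1, hends.2] at h1
      simpa using h1
    rw [intervalIntegral.integral_of_le hαβ.le, ← integral_Icc_eq_integral_Ioc] at hparts
    have hA := hci hm hψ.deriv
    have hB := hci hQc hψ.deriv
    have hC := hci hq hψ
    have hA' : IntegrableOn (fun t => deriv ψ t * pairing id v χ t) (Icc α β) := by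
      simpa [mul_comm] using hA
    have hB' : IntegrableOn (fun t => deriv ψ t * ∫ τ in t₁..t, pairing f v (deriv χ) τ)
        (Icc α β) := by simpa [mul_comm] using hB
    have hC' : IntegrableOn (fun t => ψ t * pairing f v (deriv χ) t) (Icc α β) := by
      simpa [mul_comm] using hC
    rw [integral_add hA' hC'] at hw
    rw [integral_add hB' hC'] at hparts
    have : ∀ t, (pairing id v χ t - ∫ τ in t₁..t, pairing f v (deriv χ) τ) * deriv ψ t =
        deriv ψ t * pairing id v χ t - deriv ψ t * ∫ τ in t₁..t, pairing f v (deriv χ) τ :=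
      fun t => by ring
    simp only [this]
    rw [integral_sub hA' hB']
    linarith

/-- The evolution of the pairings with a test function, from the initial time on. -/
lemma IsRegular.pairing_eq (h : IsRegular T M v Z) (hf : Continuous f)
    (hid : IntegralIdentity f T v) {g : ℝ → ℝ} (hχ : IsTest χ)
    (hinit : Tendsto (fun t => ∫ x, v x t * χ x) (𝓝[>] 0) (𝓝 (∫ x, g x * χ x))) {t : ℝ}
    (ht : t ∈ Ioo 0 T) :
    pairing id v χ t = (∫ x, g x * χ x) + ∫ τ in (0 : ℝ)..t, pairing f v (deriv χ) τ := by
  have hi : IntervalIntegrable (pairing f v (deriv χ)) volume 0 t :=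
    h.intervalIntegrable_pairing hf hχ.deriv ⟨le_rfl, ht.1.trans ht.2⟩ (Ioo_subset_Ico_self ht)
  have h1 : Tendsto (fun s => ∫ τ in s..t, pairing f v (deriv χ) τ) (𝓝[>] 0)
      (𝓝 (∫ τ in (0 : ℝ)..t, pairing f v (deriv χ) τ)) := by
    have hc := intervalIntegral.continuousOn_primitive_interval_left (μ := volume)
      (f := pairing f v (deriv χ)) (a := 0) (b := t)
      ((intervalIntegrable_iff' (by simp)).1 hi)
    have h2 := hc 0 left_mem_uIcc
    refine h2.mono_left (nhdsWithin_le_of_mem ?_)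
    rw [uIcc_of_le ht.1.le]
    exact mem_of_superset (Ioo_mem_nhdsGT ht.1) Ioo_subset_Icc_self
  refine tendsto_nhds_unique (tendsto_const_nhds.congr' ?_) (hinit.add h1)
  filter_upwards [Ioo_mem_nhdsGT ht.1] with s hs
  exact h.pairing_sub_eq hf hid hχ ⟨hs.1, hs.2.trans ht.2⟩ ht hs.2

end regular

/-! ### The potential of a generalized solution -/

/-- `U` is a potential of the generalized solution `v`, i.e. `U_x = v` and `U_t = -f(v)` in a weak
form, with initial value `G`. -/
structure IsPotential (T M : ℝ) (f : ℝ → ℝ) (v : ℝ → ℝ → ℝ) (G : ℝ → ℝ) (U : ℝ → ℝ → ℝ) :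
    Prop where
  zero : ∀ x, U x 0 = G x
  lip : ∀ t ∈ Ico 0 T, ∀ x y, |U x t - U y t| ≤ M * |x - y|
  prim : ∀ t ∈ Ioo 0 T, ∀ x y, U y t - U x t = ∫ z in x..y, v z t
  pair : ∀ χ, IsTest χ → ∀ t ∈ Ico 0 T,
    ∫ x, U x t * χ x = (∫ x, G x * χ x) - ∫ τ in (0 : ℝ)..t, pairing f v χ τ

section potential

variable {T M : ℝ} {f : ℝ → ℝ} {v : ℝ → ℝ → ℝ} {Z : Set (ℝ × ℝ)}

lemma IsRegular.intervalIntegrable (h : IsRegular T M v Z) {t : ℝ} (ht : t ∈ Ioo 0 T) (x y : ℝ) :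
    IntervalIntegrable (fun z => v z t) volume x y := by
  rw [intervalIntegrable_iff, uIoc]
  exact Integrable.of_bound (h.aestronglyMeasurable_slice ht).restrict M
    (Eventually.of_forall fun z => h.bound z t ht)

lemma IsRegular.abs_integral_le (h : IsRegular T M v Z) {t : ℝ} (ht : t ∈ Ioo 0 T) (x y : ℝ) :
    |∫ z in y..x, v z t| ≤ M * |x - y| :=
  intervalIntegral.norm_integral_le_of_norm_le_const (f := fun z => v z t)
    fun z _ => h.bound z t ht

lemma continuous_of_abs_sub_le {W : ℝ → ℝ} (hW : ∀ x y, |W x - W y| ≤ M * |x - y|) :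
    Continuous W := by
  refine (LipschitzWith.of_dist_le_mul (K := M.toNNReal) fun x y => ?_).continuous
  rw [Real.dist_eq, Real.dist_eq]
  exact (hW x y).trans (mul_le_mul_of_nonneg_right (Real.le_coe_toNNReal M) (abs_nonneg _))

/-- Every generalized solution has a potential. -/
lemma IsRegular.exists_potential (h : IsRegular T M v Z) (hf : Continuous f)
    (hid : IntegralIdentity f T v) {g G : ℝ → ℝ} {C : Set ℝ} (hC : C.Countable)
    (hG : ∀ x y, |G x - G y| ≤ M * |x - y|) (hGd : ∀ x ∉ C, HasDerivAt G (g x) x)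
    (hgm : AEStronglyMeasurable g volume) (hgb : ∀ x, |g x| ≤ M)
    (hinit : ∀ χ, IsTest χ → Tendsto (fun t => ∫ x, v x t * χ x) (𝓝[>] 0) (𝓝 (∫ x, g x * χ x))) :
    ∃ U, IsPotential T M f v G U := by
  -- A primitive of `v` in `x` is determined up to a function of `t`. That function is fixed by
  -- demanding the evolution law `pair` for the single test function `χ₀`.
  obtain ⟨χ₀, hχ₀, -, hχ₀1, -⟩ := exists_bump 0 one_pos
  have hGc : Continuous G := continuous_of_abs_sub_le hG
  set F : ℝ → ℝ → ℝ := fun x t => ∫ y in (0 : ℝ)..x, v y t with hF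
  have hFsub : ∀ t ∈ Ioo 0 T, ∀ x y, F y t - F x t = ∫ z in x..y, v z t := fun t ht x y =>
    intervalIntegral.integral_interval_sub_left (h.intervalIntegrable ht _ _)
      (h.intervalIntegrable ht _ _)
  have hFl : ∀ t ∈ Ioo 0 T, ∀ x y, |F x t - F y t| ≤ M * |x - y| := fun t ht x y => by
    rw [hFsub t ht]
    exact h.abs_integral_le ht x y
  have hFc : ∀ t ∈ Ioo 0 T, Continuous fun x => F x t := fun t ht =>
    continuous_of_abs_sub_le (hFl t ht)
  have hFd : ∀ t ∈ Ioo 0 T, ∀ x ∉ {x | (x, t) ∈ Z}, HasDerivAt (fun x => F x t) (v x t) x :=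
    fun t ht x hx => intervalIntegral.integral_hasDerivAt_right (h.intervalIntegrable ht _ _)
      (h.aestronglyMeasurable_slice ht).stronglyMeasurableAtFilter (h.continuousAt_slice ht hx)
  -- Time zero is treated separately: `v(·, 0)` is arbitrary, and only the weak initial value `g =
  -- G'` has a meaning.
  set U : ℝ → ℝ → ℝ := fun x t => if t = 0 then G x else F x t - (∫ y, F y t * χ₀ y)
    + (∫ y, G y * χ₀ y) - ∫ τ in (0 : ℝ)..t, pairing f v χ₀ τ with hU
  have hUt : ∀ t ∈ Ioo 0 T, ∀ x, U x t = F x t - (∫ y, F y t * χ₀ y)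
      + (∫ y, G y * χ₀ y) - ∫ τ in (0 : ℝ)..t, pairing f v χ₀ τ := fun t ht x =>
    if_neg ht.1.ne'
  have hU0 : ∀ x, U x 0 = G x := fun x => if_pos rfl
  refine ⟨U, hU0, fun t ht x y => ?_, fun t ht x y => ?_, fun χ hχ t ht => ?_⟩
  · rcases ht.1.eq_or_lt with rfl | h0
    · rw [hU0, hU0]
      exact hG x y
    · rw [hUt t ⟨h0, ht.2⟩, hUt t ⟨h0, ht.2⟩]
      convert hFl t ⟨h0, ht.2⟩ x y using 2
      ring
  · rw [← hFsub t ht, hUt t ht, hUt t ht]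
    ring
  · rcases ht.1.eq_or_lt with rfl | h0
    · simp [hU0]
    have ht' : t ∈ Ioo 0 T := ⟨h0, ht.2⟩
    set k := ∫ x, χ x with hk
    -- `χ - k χ₀` has integral zero, hence equals `Ψ'` for a test function `Ψ`. Two integrations by
    -- parts reduce `pair` for `χ` to the evolution of `⟨v, Ψ⟩`.
    have hθ : IsTest fun y => χ y - k * χ₀ y := hχ.sub_const_mul hχ₀ k
    obtain ⟨R, -, hR⟩ := hθ.exists_radius
    have hθ0 : ∫ x, (χ x - k * χ₀ x) = 0 := by
      rw [integral_sub hχ.integrable (hχ₀.integrable.const_mul k), integral_const_mul, hχ₀1]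
      ring
    obtain ⟨Ψ, hΨ, hΨd, -⟩ := exists_primitive_test hθ hθ0 (α := -R) (β := R) (fun x hx =>
      hR x (by
        by_contra hx'
        exact hx (abs_le.1 (not_le.1 hx').le)))
    have hcs : ∀ {W : ℝ → ℝ}, Continuous W → ∀ {ψ : ℝ → ℝ}, IsTest ψ →
        Integrable (fun x => W x * ψ x) := fun hh _ hψ =>
      (hh.mul hψ.1.continuous).integrable_of_hasCompactSupport hψ.2.mul_left
    have hsplit : ∀ {W : ℝ → ℝ}, Continuous W →
        ∫ x, W x * deriv Ψ x = (∫ x, W x * χ x) - k * ∫ x, W x * χ₀ x := fun {W} hW => by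
      rw [hΨd, ← integral_const_mul, ← integral_sub (hcs hW hχ) ((hcs hW hχ₀).const_mul k)]
      congr 1; funext x; ring
    have e1 := integral_mul_deriv_test (h.slice t) (hFc t ht') (hFd t ht')
      (h.aestronglyMeasurable_slice ht') (fun x => h.bound x t ht') hΨ
    have e2 := integral_mul_deriv_test hC hGc hGd hgm hgb hΨ
    have e3 := h.pairing_eq hf hid hΨ (hinit Ψ hΨ) ht'
    have e4 : ∫ τ in (0 : ℝ)..t, pairing f v (deriv Ψ) τ =
        (∫ τ in (0 : ℝ)..t, pairing f v χ τ) - k * ∫ τ in (0 : ℝ)..t, pairing f v χ₀ τ := by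
      have hz : (0 : ℝ) ∈ Ico 0 T := ⟨le_rfl, ht'.1.trans ht'.2⟩
      rw [← intervalIntegral.integral_const_mul, ← intervalIntegral.integral_sub
        (h.intervalIntegrable_pairing hf hχ hz ht)
        ((h.intervalIntegrable_pairing hf hχ₀ hz ht).const_mul k)]
      refine intervalIntegral.integral_congr_ae (Eventually.of_forall fun τ hτ => ?_)
      rw [uIoc_of_le h0.le] at hτ
      have hτ' : τ ∈ Ioo 0 T := ⟨hτ.1, hτ.2.trans_lt ht.2⟩
      simp only [pairing]
      rw [hΨd, ← integral_const_mul, ← integral_sub (h.integrable_mul hf hχ hτ')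
        ((h.integrable_mul hf hχ₀ hτ').const_mul k)]
      congr 1; funext x; ring
    rw [hsplit (hFc t ht')] at e1
    rw [hsplit hGc] at e2
    simp only [pairing, id] at e3 e4
    have hsum : ∫ x, U x t * χ x = (∫ x, F x t * χ x) + (-(∫ y, F y t * χ₀ y)
      + (∫ y, G y * χ₀ y) - ∫ τ in (0 : ℝ)..t, pairing f v χ₀ τ) * k := by
      rw [hk, ← integral_const_mul, ← integral_add (hcs (hFc t ht') hχ) (hχ.integrable.const_mul _)]
      congr 1; funext x; rw [hUt t ht']; ring
    rw [hsum]
    simp only [pairing]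
    linarith

/-! ### Regularity of a potential -/

variable {G : ℝ → ℝ} {U : ℝ → ℝ → ℝ}

lemma IsPotential.nonneg (hU : IsPotential T M f v G U) (hT : 0 < T) : 0 ≤ M := by
  have := (abs_nonneg _).trans (hU.lip 0 ⟨le_rfl, hT⟩ 1 0)
  simpa using this

lemma IsPotential.continuous (hU : IsPotential T M f v G U) {t : ℝ} (ht : t ∈ Ico 0 T) :
    Continuous fun x => U x t := continuous_of_abs_sub_le (hU.lip t ht)

lemma IsPotential.integrable_mul (hU : IsPotential T M f v G U) {t : ℝ} (ht : t ∈ Ico 0 T)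
    {χ : ℝ → ℝ} (hχ : IsTest χ) : Integrable fun x => U x t * χ x :=
  ((hU.continuous ht).mul hχ.1.continuous).integrable_of_hasCompactSupport hχ.2.mul_left

lemma IsPotential.pair_sub (hU : IsPotential T M f v G U) (h : IsRegular T M v Z)
    (hf : Continuous f) {χ : ℝ → ℝ} (hχ : IsTest χ) {t₁ t₂ : ℝ} (ht₁ : t₁ ∈ Ico 0 T)
    (ht₂ : t₂ ∈ Ico 0 T) :
    (∫ x, U x t₂ * χ x) - ∫ x, U x t₁ * χ x = -∫ τ in t₁..t₂, pairing f v χ τ := by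
  have hz : (0 : ℝ) ∈ Ico 0 T := ⟨le_rfl, ht₁.1.trans_lt ht₁.2⟩
  rw [hU.pair χ hχ _ ht₂, hU.pair χ hχ _ ht₁, ← intervalIntegral.integral_interval_sub_left
    (h.intervalIntegrable_pairing hf hχ hz ht₂) (h.intervalIntegrable_pairing hf hχ hz ht₁)]
  ring

/-- If `f(v)` is close to `A` near the segment `{x} × (t₁, t₂]`, then `U(x, ·)` is close to being
affine with slope `-A` there. -/
lemma IsPotential.abs_time_sub_add_le (hU : IsPotential T M f v G U) (h : IsRegular T M v Z)
    (hf : Continuous f) {x t₁ t₂ A ε r : ℝ} (ht₁ : 0 ≤ t₁) (hlt : t₁ ≤ t₂) (ht₂ : t₂ < T)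
    (hr : 0 < r) (hA : ∀ y, |y - x| < r → ∀ s ∈ Ioc t₁ t₂, |f (v y s) - A| ≤ ε) :
    |U x t₂ - U x t₁ + A * (t₂ - t₁)| ≤ ε * (t₂ - t₁) := by
  have hT : 0 < T := by linarith
  have hM := hU.nonneg hT
  refine le_of_forall_pos_le_add fun η hη => ?_
  -- The radius keeps the bump inside the region where `f(v)` is controlled, and makes the averaging
  -- error of `U` at most `η / 2` at each of the two times.
  have hρ : 0 < min r (η / (2 * M + 1)) := lt_min hr (by positivity)
  obtain ⟨χ, hχ, hχ0, hχ1, hχr⟩ := exists_bump x hρ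
  set ρ := min r (η / (2 * M + 1))
  have hMρ : M * ρ ≤ η / 2 := by
    calc M * ρ ≤ M * (η / (2 * M + 1)) := by gcongr; exact min_le_right _ _
      _ = (2 * M) / (2 * M + 1) * (η / 2) := by field_simp
      _ ≤ 1 * (η / 2) := by
          gcongr
          rw [div_le_one (by positivity)]
          linarith
      _ = η / 2 := one_mul _
  have hm₁ : t₁ ∈ Ico 0 T := ⟨ht₁, hlt.trans_lt ht₂⟩
  have hm₂ : t₂ ∈ Ico 0 T := ⟨ht₁.trans hlt, ht₂⟩
  have hclose : ∀ t ∈ Ico 0 T, |(∫ y, U y t * χ y) - U x t| ≤ η / 2 := fun t ht =>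
    abs_integral_mul_bump_sub_le hχ hχ0 hχ1 hχr (hU.integrable_mul ht hχ) fun y hy =>
      (hU.lip t ht y x).trans (le_trans (by gcongr) hMρ)
  have hp : ∀ s ∈ Ioc t₁ t₂, |pairing f v χ s - A| ≤ ε := fun s hs =>
    abs_integral_mul_bump_sub_le hχ hχ0 hχ1 hχr
      (h.integrable_mul hf hχ ⟨ht₁.trans_lt hs.1, hs.2.trans_lt ht₂⟩) fun y hy =>
      hA y (hy.trans_le (min_le_left _ _)) s hs
  have hi := h.intervalIntegrable_pairing hf hχ hm₁ hm₂
  have hint : |∫ s in t₁..t₂, (pairing f v χ s - A)| ≤ ε * |t₂ - t₁| :=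
    intervalIntegral.norm_integral_le_of_norm_le_const (f := fun s => pairing f v χ s - A)
      fun s hs => hp s (by rwa [uIoc_of_le hlt] at hs)
  rw [intervalIntegral.integral_sub hi intervalIntegrable_const,
    intervalIntegral.integral_const, abs_of_nonneg (sub_nonneg.2 hlt), smul_eq_mul] at hint
  have hd := hU.pair_sub h hf hχ hm₁ hm₂
  have c1 := abs_le.1 (hclose t₁ hm₁)
  have c2 := abs_le.1 (hclose t₂ hm₂)
  have c3 := abs_le.1 hint
  rw [abs_le]
  constructor <;> linarith [c1.1, c1.2, c2.1, c2.2, c3.1, c3.2]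

lemma IsPotential.abs_time_sub_le (hU : IsPotential T M f v G U) (h : IsRegular T M v Z)
    (hf : Continuous f) {K : ℝ} (hK : ∀ y, |y| ≤ M → |f y| ≤ K) (x : ℝ) {s t : ℝ}
    (hs : s ∈ Ico 0 T) (ht : t ∈ Ico 0 T) : |U x t - U x s| ≤ K * |t - s| := by
  wlog hst : s ≤ t generalizing s t
  · rw [abs_sub_comm, abs_sub_comm t s]
    exact this ht hs (le_of_not_ge hst)
  have := hU.abs_time_sub_add_le h hf (x := x) (A := 0) (ε := K) hs.1 hst ht.2 one_pos
    fun y _ τ hτ => by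
      rw [sub_zero]
      exact hK _ (h.bound y τ ⟨hs.1.trans_lt hτ.1, hτ.2.trans_lt ht.2⟩)
  rwa [zero_mul, add_zero, ← abs_of_nonneg (sub_nonneg.2 hst)] at this

/-- The equation for `U` is known only after averaging in `x`. Joint continuity of `v` keeps `f(v)`
near `f(v x t)` on a whole neighbourhood, which localises it to the single line through `x`. -/
lemma IsPotential.hasDerivAt_time (hU : IsPotential T M f v G U) (h : IsRegular T M v Z)
    (hf : Continuous f) {x t : ℝ} (ht : t ∈ Ioo 0 T)
    (hc : ContinuousAt (fun q : ℝ × ℝ => v q.1 q.2) (x, t)) :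
    HasDerivAt (fun s => U x s) (-f (v x t)) t := by
  rw [hasDerivAt_iff_isLittleO, Asymptotics.isLittleO_iff]
  intro ε hε
  have hfc : ContinuousAt (fun q : ℝ × ℝ => f (v q.1 q.2)) (x, t) := hf.continuousAt.comp hc
  obtain ⟨δ, hδ, hδf⟩ := Metric.continuousAt_iff.1 hfc ε hε
  have hclose : ∀ y s, |y - x| < δ → |s - t| < δ → |f (v y s) - f (v x t)| ≤ ε := fun y s hy hs =>
    (hδf (x := (y, s)) (by
      rw [Prod.dist_eq]
      exact max_lt hy hs)).le
  filter_upwards [isOpen_Ioo.mem_nhds ht, Metric.ball_mem_nhds t hδ] with s hs hsδ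
  rw [Metric.mem_ball, Real.dist_eq] at hsδ
  rw [Real.norm_eq_abs, Real.norm_eq_abs, smul_eq_mul]
  rcases le_total t s with hts | hts
  · have := hU.abs_time_sub_add_le h hf (x := x) (A := f (v x t)) (ε := ε) ht.1.le hts hs.2 hδ
      fun y hy τ hτ => hclose y τ hy (by
        rw [abs_of_nonneg (by linarith [hτ.1])]
        rw [abs_of_nonneg (by linarith)] at hsδ
        linarith [hτ.2])
    rw [abs_of_nonneg (sub_nonneg.2 hts)]
    convert this using 2
    ring
  · have := hU.abs_time_sub_add_le h hf (x := x) (A := f (v x t)) (ε := ε) hs.1.le hts ht.2 hδ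
      fun y hy τ hτ => hclose y τ hy (by
        rw [abs_of_nonpos (by linarith [hτ.2])]
        rw [abs_of_nonpos (by linarith)] at hsδ
        linarith [hτ.1])
    rw [abs_of_nonpos (sub_nonpos.2 hts), ← abs_neg]
    convert this using 2 <;> ring

lemma IsPotential.hasDerivAt_space (hU : IsPotential T M f v G U) (h : IsRegular T M v Z)
    {x t : ℝ} (ht : t ∈ Ioo 0 T) (hc : ContinuousAt (fun y => v y t) x) :
    HasDerivAt (fun y => U y t) (v x t) x := by
  have hd := intervalIntegral.integral_hasDerivAt_right (h.intervalIntegrable ht x x)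
    (h.aestronglyMeasurable_slice ht).stronglyMeasurableAtFilter hc
  have heq : (fun y => U y t) = fun y => U x t + ∫ z in x..y, v z t := by
    funext y
    rw [← hU.prim t ht]
    ring
  rw [heq]
  exact hd.const_add _

lemma IsPotential.hasDerivWithinAt_left (hU : IsPotential T M f v G U) (h : IsRegular T M v Z)
    {x t l : ℝ} (ht : t ∈ Ioo 0 T) (hl : Tendsto (fun y => v y t) (𝓝[<] x) (𝓝 l)) :
    HasDerivWithinAt (fun y => U y t) l (Iic x) x := by
  -- The value of `v` at `x` itself need not be `l`; it is discarded as a null set.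
  have hle : 𝓝[≤] x ⊓ ae volume ≤ 𝓝[<] x := by
    have h1 : (ae (volume : Measure ℝ)) ≤ 𝓟 {x}ᶜ := by
      rw [le_principal_iff]
      exact compl_mem_ae_iff.2 (by simp)
    refine (inf_le_inf_left _ h1).trans (le_of_eq ?_)
    rw [← nhdsWithin_inter']
    congr 1
    ext y
    simp [lt_iff_le_and_ne]
  have hd := intervalIntegral.integral_hasDerivWithinAt_of_tendsto_ae_right
    (h.intervalIntegrable ht x x) (s := Iic x) (t := Iic x)
    (h.aestronglyMeasurable_slice ht).stronglyMeasurableAtFilter (hl.mono_left hle)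
  have heq : (fun y => U y t) = fun y => U x t + ∫ z in x..y, v z t := by
    funext y
    rw [← hU.prim t ht]
    ring
  rw [heq]
  exact hd.const_add _

lemma IsPotential.hasDerivWithinAt_right (hU : IsPotential T M f v G U) (h : IsRegular T M v Z)
    {x t r : ℝ} (ht : t ∈ Ioo 0 T) (hr : Tendsto (fun y => v y t) (𝓝[>] x) (𝓝 r)) :
    HasDerivWithinAt (fun y => U y t) r (Ici x) x := by
  have hd := intervalIntegral.integral_hasDerivWithinAt_of_tendsto_ae_right
    (h.intervalIntegrable ht x x) (s := Ici x) (t := Ioi x)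
    (h.aestronglyMeasurable_slice ht).stronglyMeasurableAtFilter (hr.mono_left inf_le_left)
  have heq : (fun y => U y t) = fun y => U x t + ∫ z in x..y, v z t := by
    funext y
    rw [← hU.prim t ht]
    ring
  rw [heq]
  exact hd.const_add _

/-! ### Mollification in space -/

/-- The average `∫ U(x + z, t) χ(z) dz`. -/
def mollify (U : ℝ → ℝ → ℝ) (χ : ℝ → ℝ) (x t : ℝ) : ℝ := ∫ z, U (x + z) t * χ z

variable {χ : ℝ → ℝ}

lemma mollify_eq (U : ℝ → ℝ → ℝ) (χ : ℝ → ℝ) (x t : ℝ) :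
    mollify U χ x t = ∫ y, U y t * χ (y - x) := by
  unfold mollify
  rw [← integral_add_left_eq_self (fun y => U y t * χ (y - x)) x]
  simp

lemma IsPotential.integrable_shift_mul (hU : IsPotential T M f v G U) (hχ : IsTest χ) {t : ℝ}
    (ht : t ∈ Ico 0 T) (x : ℝ) : Integrable fun z => U (x + z) t * χ z :=
  (((hU.continuous ht).comp (continuous_const_add x)).mul
    hχ.1.continuous).integrable_of_hasCompactSupport hχ.2.mul_left

/-- Averaging in `x` alone suffices: the evolution law of the pairings is exact, so the average is
differentiable in time at every point, also over discontinuities of `v`. -/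
lemma IsPotential.hasDerivAt_mollify_time (hU : IsPotential T M f v G U) (h : IsRegular T M v Z)
    (hf : Continuous f) (hχ : IsTest χ) (x : ℝ) {t : ℝ} (ht : t ∈ Ioo 0 T) :
    HasDerivAt (fun s => mollify U χ x s) (-pairing f v (fun y => χ (y - x)) t) t := by
  have hχ' := hχ.translate x
  have hd := h.hasDerivAt_integral_pairing hf hχ' ⟨le_rfl, ht.1.trans ht.2⟩ ht
  refine (hd.const_sub (∫ y, G y * χ (y - x))).congr_of_eventuallyEq ?_
  filter_upwards [isOpen_Ioo.mem_nhds ht] with s hs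
  rw [mollify_eq]
  exact hU.pair _ hχ' s (Ioo_subset_Ico_self hs)

lemma IsPotential.hasDerivAt_mollify_space (hU : IsPotential T M f v G U)
    (h : IsRegular T M v Z) (hχ : IsTest χ) (x : ℝ) {t : ℝ} (ht : t ∈ Ioo 0 T) :
    HasDerivAt (fun y => mollify U χ y t) (pairing id v (fun y => χ (y - x)) t) x := by
  have ht' := Ioo_subset_Ico_self ht
  have hpair : pairing id v (fun y => χ (y - x)) t = ∫ z, v (x + z) t * χ z := by
    unfold pairing
    rw [← integral_add_left_eq_self (fun y => id (v y t) * χ (y - x)) x]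
    simp
  have hshift : MeasurePreserving (fun z : ℝ => x + z) volume volume :=
    measurePreserving_add_left volume x
  rw [hpair]
  refine (hasDerivAt_integral_of_dominated_loc_of_lip (F := fun y z => U (y + z) t * χ z)
    (F' := fun z => v (x + z) t * χ z) (bound := fun z => M * |χ z|) univ_mem
    (Eventually.of_forall fun y => (hU.integrable_shift_mul hχ ht' y).aestronglyMeasurable)
    (hU.integrable_shift_mul hχ ht' x) ?_ ?_ (hχ.integrable.abs.const_mul M) ?_).2
  · exact ((h.aestronglyMeasurable_slice ht).comp_measurePreserving hshift).mul
      hχ.1.continuous.aestronglyMeasurable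
  · refine Eventually.of_forall fun z => LipschitzOnWith.of_dist_le_mul fun y _ y' _ => ?_
    have hM := hU.nonneg (ht.1.trans ht.2)
    have h1 := hU.lip t ht' (y + z) (y' + z)
    rw [add_sub_add_right_eq_sub] at h1
    rw [Real.dist_eq, Real.dist_eq, ← sub_mul, abs_mul, Real.coe_nnabs,
      abs_of_nonneg (mul_nonneg hM (abs_nonneg (χ z)))]
    nlinarith [mul_le_mul_of_nonneg_right h1 (abs_nonneg (χ z))]
  · filter_upwards [hshift.quasiMeasurePreserving.ae (h.ae_notMem t)] with z hz
    have hd := hU.hasDerivAt_space h ht (h.continuousAt_slice ht hz)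
    exact (HasDerivAt.comp_add_const x z hd).mul_const (χ z)

variable {K : ℝ}

lemma IsPotential.abs_sub_le (hU : IsPotential T M f v G U) (h : IsRegular T M v Z)
    (hf : Continuous f) (hK : ∀ y, |y| ≤ M → |f y| ≤ K) (x y : ℝ) {s t : ℝ}
    (hs : s ∈ Ico 0 T) (ht : t ∈ Ico 0 T) : |U x t - U y s| ≤ M * |x - y| + K * |t - s| :=
  (_root_.abs_sub_le (U x t) (U y t) (U y s)).trans
    (add_le_add (hU.lip t ht x y) (hU.abs_time_sub_le h hf hK y hs ht))

lemma IsPotential.abs_mollify_sub_le (hU : IsPotential T M f v G U) (h : IsRegular T M v Z)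
    (hf : Continuous f) (hK : ∀ y, |y| ≤ M → |f y| ≤ K) (hχ : IsTest χ) (hχ0 : ∀ y, 0 ≤ χ y)
    (hχ1 : ∫ y, χ y = 1) (x y : ℝ) {s t : ℝ} (hs : s ∈ Ico 0 T) (ht : t ∈ Ico 0 T) :
    |mollify U χ x t - mollify U χ y s| ≤ M * |x - y| + K * |t - s| := by
  obtain ⟨R, hR0, hR⟩ := hχ.exists_radius
  have h1 : mollify U χ x t - mollify U χ y s =
      (∫ z, (U (x + z) t - U (y + z) s) * χ z) - 0 := by
    unfold mollify
    rw [sub_zero, ← integral_sub (hU.integrable_shift_mul hχ ht x)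
      (hU.integrable_shift_mul hχ hs y)]
    congr 1; funext z; ring
  rw [h1]
  refine abs_integral_mul_bump_sub_le (x₀ := 0) (r := R) hχ hχ0 hχ1
    (fun z hz => hR z (by simpa using hz)) ?_ fun z _ => ?_
  · refine ((hU.integrable_shift_mul hχ ht x).sub (hU.integrable_shift_mul hχ hs y)).congr
      (Eventually.of_forall fun z => ?_)
    simp only [Pi.sub_apply]; ring
  · rw [sub_zero]
    have := hU.abs_sub_le h hf hK (x + z) (y + z) hs ht
    rwa [add_sub_add_right_eq_sub] at this

lemma IsPotential.abs_mollify_sub_self_le (hU : IsPotential T M f v G U) (hχ : IsTest χ)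
    (hχ0 : ∀ y, 0 ≤ χ y) (hχ1 : ∫ y, χ y = 1) {r : ℝ} (hr : ∀ y, r ≤ |y - 0| → χ y = 0)
    (x : ℝ) {t : ℝ} (ht : t ∈ Ico 0 T) : |mollify U χ x t - U x t| ≤ M * r := by
  refine abs_integral_mul_bump_sub_le hχ hχ0 hχ1 hr (hU.integrable_shift_mul hχ ht x)
    fun z hz => ?_
  have hM := hU.nonneg (ht.1.trans_lt ht.2)
  refine (hU.lip t ht (x + z) x).trans ?_
  rw [add_sub_cancel_left]
  rw [sub_zero] at hz
  gcongr

end potential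

/-! ### Penalized minima -/

lemma nonpos_of_min_left {h : ℝ → ℝ} {d x : ℝ} (hd : HasDerivWithinAt h d (Iic x) x)
    (hmin : ∀ᶠ y in 𝓝[<] x, h x ≤ h y) : d ≤ 0 := by
  have h1 := (hasDerivWithinAt_iff_tendsto_slope' (s := Iio x) (by simp)).1
    (hd.mono Iio_subset_Iic_self)
  refine le_of_tendsto h1 ?_
  filter_upwards [hmin, self_mem_nhdsWithin] with y hy hyx
  have : y < x := hyx
  rw [slope_def_field]
  exact div_nonpos_of_nonneg_of_nonpos (by linarith) (by linarith)

lemma nonneg_of_min_right {h : ℝ → ℝ} {d x : ℝ} (hd : HasDerivWithinAt h d (Ici x) x)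
    (hmin : ∀ᶠ y in 𝓝[>] x, h x ≤ h y) : 0 ≤ d := by
  have h1 := (hasDerivWithinAt_iff_tendsto_slope' (s := Ioi x) (by simp)).1
    (hd.mono Ioi_subset_Ici_self)
  refine ge_of_tendsto h1 ?_
  filter_upwards [hmin, self_mem_nhdsWithin] with y hy hyx
  have : x < y := hyx
  rw [slope_def_field]
  exact div_nonneg (by linarith) (by linarith)

lemma exists_hasDerivAt_weight {β : ℝ} (hβ : 0 < β) (x : ℝ) :
    ∃ θ, |θ| ≤ β ∧ HasDerivAt (fun y => β * √(1 + y ^ 2)) θ x := by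
  have hp : 0 < 1 + x ^ 2 := by positivity
  have hr := Real.sqrt_pos.2 hp
  have h1 : HasDerivAt (fun y : ℝ => 1 + y ^ 2) (2 * x) x := by
    simpa using (hasDerivAt_pow 2 x).const_add 1
  refine ⟨_, ?_, (h1.sqrt hp.ne').const_mul β⟩
  rw [abs_mul, abs_of_pos hβ]
  refine mul_le_of_le_one_right hβ.le ?_
  rw [mul_div_mul_left _ _ two_ne_zero, abs_div, abs_of_pos hr, div_le_one hr]
  exact Real.abs_le_sqrt (by linarith)

/-- At a point `(x₀, t₀)` with `t₀ > 0`, the function `D + η t + β √(1 + x²)` has a minimum in `x`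
and a minimum in `t` over the past. -/
structure IsPenalizedMin (D : ℝ → ℝ → ℝ) (η β x₀ t₀ : ℝ) : Prop where
  beta_pos : 0 < β
  time_pos : 0 < t₀
  space : ∀ x, D x₀ t₀ + β * √(1 + x₀ ^ 2) ≤ D x t₀ + β * √(1 + x ^ 2)
  time : ∀ t ∈ Icc 0 t₀, D x₀ t₀ + η * t₀ ≤ D x₀ t + η * t

section penalized

variable {D : ℝ → ℝ → ℝ} {η β x₀ t₀ : ℝ}

lemma IsPenalizedMin.time_deriv (h : IsPenalizedMin D η β x₀ t₀) {d : ℝ}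
    (hd : HasDerivAt (fun t => D x₀ t) d t₀) : d + η ≤ 0 := by
  have h1 : HasDerivAt (fun t => D x₀ t + η * t) (d + η) t₀ :=
    (hd.add ((hasDerivAt_id t₀).const_mul η)).congr_deriv (by rw [mul_one])
  refine nonpos_of_min_left h1.hasDerivWithinAt ?_
  filter_upwards [Ioo_mem_nhdsLT h.time_pos] with t ht using h.time t ⟨ht.1.le, ht.2.le⟩

/-- The penalty is differentiable, so it adds the same slope `θ` on both sides and `l + θ ≤ 0 ≤ r +
θ`. A minimum admits only convex kinks. -/
lemma IsPenalizedMin.le_of_one_sided (h : IsPenalizedMin D η β x₀ t₀) {l r : ℝ}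
    (hl : HasDerivWithinAt (fun x => D x t₀) l (Iic x₀) x₀)
    (hr : HasDerivWithinAt (fun x => D x t₀) r (Ici x₀) x₀) : l ≤ r := by
  obtain ⟨θ, -, hd⟩ := exists_hasDerivAt_weight h.beta_pos x₀
  have h1 := nonpos_of_min_left (hl.add hd.hasDerivWithinAt) (Eventually.of_forall h.space)
  have h2 := nonneg_of_min_right (hr.add hd.hasDerivWithinAt) (Eventually.of_forall h.space)
  linarith

lemma IsPenalizedMin.abs_space_deriv_le (h : IsPenalizedMin D η β x₀ t₀) {d : ℝ}
    (hd : HasDerivAt (fun x => D x t₀) d x₀) : |d| ≤ β := by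
  obtain ⟨θ, hθ, hw⟩ := exists_hasDerivAt_weight h.beta_pos x₀
  have h1 := nonpos_of_min_left (hd.add hw).hasDerivWithinAt (Eventually.of_forall h.space)
  have h2 := nonneg_of_min_right (hd.add hw).hasDerivWithinAt (Eventually.of_forall h.space)
  have h3 : d = -θ := by linarith
  rwa [h3, abs_neg]

/-- The weight in `x` is coercive and forces the minimum to be attained. The penalties are small
enough to keep it negative, which excludes `t₀ = 0`. The requirement `L β < η` lets the gain in time
outweigh the slope error of the weight. -/
lemma exists_isPenalizedMin {t₁ : ℝ} (ht₁ : 0 ≤ t₁)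
    (hc : ContinuousOn (fun q : ℝ × ℝ => D q.1 q.2) (univ ×ˢ Icc 0 t₁)) {K : ℝ}
    (hK : ∀ x, ∀ t ∈ Icc 0 t₁, -K ≤ D x t) (h0 : ∀ x, 0 ≤ D x 0) {x₁ : ℝ} (hneg : D x₁ t₁ < 0)
    (L : ℝ) :
    ∃ η β x₀ t₀, L * β < η ∧ t₀ ≤ t₁ ∧ IsPenalizedMin D η β x₀ t₀ := by
  set w : ℝ → ℝ := fun x => √(1 + x ^ 2) with hw
  have hw1 : ∀ x, 1 ≤ w x := fun x => Real.one_le_sqrt.2 (by nlinarith [sq_nonneg x])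
  have hwx : ∀ x, |x| ≤ w x := fun x => Real.abs_le_sqrt (by linarith)
  have hwc : Continuous w := by fun_prop
  set y := -D x₁ t₁ with hy
  have hy0 : 0 < y := by linarith
  -- The depth `y` is shared: `η t₁ < y / 2` here, and `β w(x₁) ≤ y / 2` below.
  set η := y / (2 * (t₁ + 1)) with hη
  have hη0 : 0 < η := by positivity
  have hηt : η * t₁ < y / 2 := by
    rw [hη, div_mul_eq_mul_div, div_lt_div_iff₀ (by positivity) (by norm_num)]
    nlinarith
  set β := min (η / (|L| + 1)) (y / (2 * w x₁)) with hβ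
  have hw0 : 0 < w x₁ := by linarith [hw1 x₁]
  have hβ0 : 0 < β := lt_min (by positivity) (by positivity)
  have hLβ : L * β < η := by
    have h1 : β * (|L| + 1) ≤ η := by
      rw [← le_div_iff₀ (by positivity)]
      exact min_le_left _ _
    nlinarith [le_abs_self L, mul_le_mul_of_nonneg_right (le_abs_self L) hβ0.le]
  have hβw : β * w x₁ ≤ y / 2 := by
    have h1 : β ≤ y / (2 * w x₁) := min_le_right _ _
    calc β * w x₁ ≤ y / (2 * w x₁) * w x₁ := by gcongr
      _ = y / 2 := by field_simp
  set E : ℝ × ℝ → ℝ := fun q => D q.1 q.2 + η * q.2 + β * w q.1 with hE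
  -- For `|x| > R` the weight exceeds `K`, so the function is positive there and the minimum over
  -- the compact box is global.
  set R := max (|K| / β) |x₁| with hR
  have hEc : ContinuousOn E (Icc (-R) R ×ˢ Icc 0 t₁) := by
    refine ((hc.mono (prod_mono (subset_univ _) le_rfl)).add ?_).add ?_
    · exact Continuous.continuousOn (by fun_prop)
    · exact Continuous.continuousOn (by fun_prop)
  have hmem : (x₁, t₁) ∈ Icc (-R) R ×ˢ Icc 0 t₁ :=
    ⟨abs_le.1 (le_max_right _ _), ⟨ht₁, le_rfl⟩⟩
  obtain ⟨⟨x₀, t₀⟩, hm, hmin⟩ := (isCompact_Icc.prod isCompact_Icc).exists_isMinOn ⟨_, hmem⟩ hEc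
  have hE1 : E (x₁, t₁) < 0 := by
    simp only [hE]
    linarith
  have hE0 : E (x₀, t₀) < 0 := lt_of_le_of_lt (hmin hmem) hE1
  have hglob : ∀ x, ∀ t ∈ Icc 0 t₁, E (x₀, t₀) ≤ E (x, t) := fun x t ht => by
    by_cases hx : |x| ≤ R
    · exact hmin (⟨abs_le.1 hx, ht⟩ : (x, t) ∈ Icc (-R) R ×ˢ Icc 0 t₁)
    · refine hE0.le.trans ?_
      have h1 : |K| / β < |x| := (le_max_left _ _).trans_lt (not_le.1 hx)
      rw [div_lt_iff₀ hβ0] at h1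
      have h2 := hK x t ht
      have h3 := mul_nonneg hη0.le ht.1
      have h4 := mul_le_mul_of_nonneg_left (hwx x) hβ0.le
      simp only [hE]
      linarith [le_abs_self K]
  have ht0 : 0 < t₀ := by
    rcases hm.2.1.eq_or_lt with h | h
    · exfalso
      have h' : t₀ = 0 := h.symm
      have h1 := h0 x₀
      have h2 : 0 < β * w x₀ := mul_pos hβ0 (by linarith [hw1 x₀])
      simp only [hE, h', mul_zero] at hE0
      linarith
    · exact h
  refine ⟨η, β, x₀, t₀, hLβ, hm.2.2, hβ0, ht0, fun x => ?_, fun t ht => ?_⟩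
  · have := hglob x t₀ hm.2
    simp only [hE] at this
    linarith
  · have := hglob x₀ t ⟨ht.1, ht.2.trans hm.2.2⟩
    simp only [hE] at this
    linarith

lemma continuousOn_of_abs_sub_le {W : ℝ → ℝ → ℝ} {M K : ℝ} {I : Set ℝ} (hM : 0 ≤ M) (hK : 0 ≤ K)
    (hW : ∀ x y, ∀ s ∈ I, ∀ t ∈ I, |W x t - W y s| ≤ M * |x - y| + K * |t - s|) :
    ContinuousOn (fun q : ℝ × ℝ => W q.1 q.2) (univ ×ˢ I) := by
  refine LipschitzOnWith.continuousOn (K := (M + K).toNNReal)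
    (LipschitzOnWith.of_dist_le_mul fun p hp q hq => ?_)
  rw [Real.coe_toNNReal _ (add_nonneg hM hK), Real.dist_eq]
  have h1 : |p.1 - q.1| ≤ dist p q := le_max_left _ _
  have h2 : |p.2 - q.2| ≤ dist p q := le_max_right _ _
  calc _ ≤ M * |p.1 - q.1| + K * |p.2 - q.2| := hW _ _ _ hq.2 _ hp.2
    _ ≤ M * dist p q + K * dist p q := by gcongr
    _ = _ := by ring

end penalized

/-! ### Comparison of potentials -/

section comparison

variable {T M : ℝ} {f : ℝ → ℝ} {v : ℝ → ℝ → ℝ} {Z : Set (ℝ × ℝ)} {G : ℝ → ℝ} {U : ℝ → ℝ → ℝ}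

/-- A potential lies below every affine solution that lies above its initial value. -/
lemma IsPotential.le_affine (hU : IsPotential T M f v G U) (h : IsRegular T M v Z)
    (hf : ContDiff ℝ ∞ f) (hconvex : ∀ v, 0 ≤ deriv (deriv f) v) {p c : ℝ}
    (hG : ∀ x, G x ≤ p * x + c) {x₁ t₁ : ℝ} (ht₁ : t₁ ∈ Ioo 0 T) :
    U x₁ t₁ ≤ p * x₁ - f p * t₁ + c := by
  have hM := hU.nonneg (ht₁.1.trans ht₁.2)
  obtain ⟨K, hK0, hK⟩ := exists_bound_of_continuous hf.continuous M
  by_contra! hlt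
  set y := U x₁ t₁ - (p * x₁ - f p * t₁ + c) with hy
  have hy0 : 0 < y := by linarith
  -- The average of `U` differs from `U` by at most `M r`. This is paid once at time zero, by the
  -- shift in `D`, and once at `(x₁, t₁)`; hence `2 M r < y`.
  set r := y / (4 * (M + 1)) with hr
  have hr0 : 0 < r := by positivity
  have hMr : 2 * (M * r) < y := by
    have h1 : r * (4 * (M + 1)) = y := div_mul_cancel₀ _ (by positivity)
    nlinarith
  obtain ⟨χ, hχ, hχ0, hχ1, hχr⟩ := exists_bump 0 hr0
  have hsub : Icc 0 t₁ ⊆ Ico 0 T := fun t ht => ⟨ht.1, ht.2.trans_lt ht₁.2⟩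
  have hself := fun x t ht => abs_le.1 (hU.abs_mollify_sub_self_le hχ hχ0 hχ1 hχr x (t := t) ht)
  -- Minimising `D` pushes `U` up, and concave kinks, the ones that stable shocks produce, are
  -- admissible there. Averaging removes them, and Jensen's inequality has the right sign for the
  -- average.
  set D : ℝ → ℝ → ℝ := fun x t => p * x - f p * t + c + M * r - mollify U χ x t with hD
  have hz : (0 : ℝ) ∈ Ico 0 T := ⟨le_rfl, ht₁.1.trans ht₁.2⟩
  have hDc : ContinuousOn (fun q : ℝ × ℝ => D q.1 q.2) (univ ×ˢ Icc 0 t₁) := by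
    refine ContinuousOn.sub (Continuous.continuousOn (by fun_prop)) ?_
    exact continuousOn_of_abs_sub_le hM hK0 fun x y s hs t ht =>
      hU.abs_mollify_sub_le h hf.continuous hK hχ hχ0 hχ1 x y (hsub hs) (hsub ht)
  have hDK : ∀ x, ∀ t ∈ Icc 0 t₁, -((|f p| + K) * t₁) ≤ D x t := fun x t ht => by
    have h1 := (hself x t (hsub ht)).2
    have h2 := (abs_le.1 (hU.abs_time_sub_le h hf.continuous hK x hz (hsub ht))).2
    rw [hU.zero, sub_zero, abs_of_nonneg ht.1] at h2
    have h3 := hG x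
    have h4 : f p * t ≤ |f p| * t₁ := (mul_le_mul_of_nonneg_right (le_abs_self _) ht.1).trans
      (mul_le_mul_of_nonneg_left ht.2 (abs_nonneg _))
    have h5 : K * t ≤ K * t₁ := mul_le_mul_of_nonneg_left ht.2 hK0
    simp only [hD]
    linarith
  have hD0 : ∀ x, 0 ≤ D x 0 := fun x => by
    have h1 := (hself x 0 hz).2
    rw [hU.zero] at h1
    have h3 := hG x
    simp only [hD]
    linarith
  have hneg : D x₁ t₁ < 0 := by
    have h1 := (hself x₁ t₁ (Ioo_subset_Ico_self ht₁)).1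
    simp only [hD]
    linarith
  obtain ⟨η, β, x₀, t₀, hη, ht₀, hmin⟩ := exists_isPenalizedMin ht₁.1.le hDc hDK hD0 hneg
    |deriv f p|
  have ht₀' : t₀ ∈ Ioo 0 T := ⟨hmin.time_pos, ht₀.trans_lt ht₁.2⟩
  have hdx := hmin.abs_space_deriv_le (d := p - pairing id v (fun y => χ (y - x₀)) t₀) (by
    have h1 : HasDerivAt (fun x => p * x - f p * t₀ + c + M * r) p x₀ := by
      simpa using ((((hasDerivAt_id x₀).const_mul p).sub_const (f p * t₀)).add_const c).add_const
        (M * r)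
    exact h1.sub (hU.hasDerivAt_mollify_space h hχ x₀ ht₀'))
  have hdt := hmin.time_deriv (d := -f p - -pairing f v (fun y => χ (y - x₀)) t₀) (by
    have h1 : HasDerivAt (fun t => p * x₀ - f p * t + c + M * r) (-f p) t₀ := by
      simpa using ((((hasDerivAt_id t₀).const_mul (f p)).const_sub (p * x₀)).add_const c).add_const
        (M * r)
    exact h1.sub (hU.hasDerivAt_mollify_time h hf.continuous hχ x₀ ht₀'))
  -- the flux averages satisfy Jensen's inequality, in the form of the tangent inequality at `p`
  have hχ' := hχ.translate x₀
  have hχ1' : ∫ y, χ (y - x₀) = 1 := by rw [integral_sub_right_eq_self (fun y => χ y), hχ1]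
  have hjensen : f p + deriv f p * (pairing id v (fun y => χ (y - x₀)) t₀ - p) ≤
      pairing f v (fun y => χ (y - x₀)) t₀ := by
    have hi1 := h.integrable_mul continuous_id hχ' ht₀'
    have hi2 := h.integrable_mul hf.continuous hχ' ht₀'
    have h1 : ∫ y, ((f p - deriv f p * p) * χ (y - x₀) + deriv f p * (id (v y t₀) * χ (y - x₀))) ≤
        ∫ y, f (v y t₀) * χ (y - x₀) := by
      refine integral_mono ((hχ'.integrable.const_mul _).add (hi1.const_mul _)) hi2 fun y => ?_
      have h2 := mul_le_mul_of_nonneg_right (tangent_le hf hconvex p (v y t₀)) (hχ0 (y - x₀))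
      simp only [id]
      linarith
    rw [integral_add (hχ'.integrable.const_mul _) (hi1.const_mul _), integral_const_mul,
      integral_const_mul, hχ1'] at h1
    simp only [pairing]
    linarith
  have h1 : deriv f p * (p - pairing id v (fun y => χ (y - x₀)) t₀) ≤ |deriv f p| * β := by
    refine (le_abs_self _).trans ?_
    rw [abs_mul]
    gcongr
  linarith

/-- A potential of a stable solution lies above every smooth minimum of affine solutions that lies
below its initial value. -/
lemma IsPotential.softmin_le {ι : Type*} [Fintype ι] [Nonempty ι] (hU : IsPotential T M f v G U)
    (h : IsRegular T M v Z) (hstable : IsStable T v) (hf : ContDiff ℝ ∞ f)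
    (hconvex : ∀ v, 0 ≤ deriv (deriv f) v) {a c : ι → ℝ} {δ : ℝ} (hδ : 0 < δ)
    (hG : ∀ x, softmin a (fun i => -f (a i)) c δ (x, 0) ≤ G x) {x₁ t₁ : ℝ} (ht₁ : t₁ ∈ Ioo 0 T) :
    softmin a (fun i => -f (a i)) c δ (x₁, t₁) ≤ U x₁ t₁ := by
  have hM := hU.nonneg (ht₁.1.trans ht₁.2)
  obtain ⟨K, hK0, hK⟩ := exists_bound_of_continuous hf.continuous M
  obtain ⟨L, hL0, hL⟩ := exists_bound_of_continuous (contDiff_infty_iff_deriv.1 hf).2.continuous M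
  by_contra! hlt
  set S : ℝ × ℝ → ℝ := softmin a (fun i => -f (a i)) c δ with hS
  have hSc : Continuous S := (contDiff_softmin _ _ _ _).continuous
  have hsub : Icc 0 t₁ ⊆ Ico 0 T := fun t ht => ⟨ht.1, ht.2.trans_lt ht₁.2⟩
  have hz : (0 : ℝ) ∈ Ico 0 T := ⟨le_rfl, ht₁.1.trans ht₁.2⟩
  set B := ∑ i, |-f (a i)| with hB
  have hB0 : 0 ≤ B := Finset.sum_nonneg fun _ _ => abs_nonneg _
  have hSt : ∀ x t, |S (x, t) - S (x, 0)| ≤ B * |t - 0| := fun x t =>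
    Convex.norm_image_sub_le_of_norm_hasDerivWithin_le (f := fun s => S (x, s)) (s := univ)
      (fun s _ => (hasDerivAt_softmin_snd hδ x s).hasDerivWithinAt)
      (fun s _ => abs_sum_softWeight_mul_le _) convex_univ trivial trivial
  set D : ℝ → ℝ → ℝ := fun x t => U x t - S (x, t) with hD
  have hDc : ContinuousOn (fun q : ℝ × ℝ => D q.1 q.2) (univ ×ˢ Icc 0 t₁) := by
    refine ContinuousOn.sub ?_ hSc.continuousOn
    exact continuousOn_of_abs_sub_le hM hK0 fun x y s hs t ht =>
      hU.abs_sub_le h hf.continuous hK x y (hsub hs) (hsub ht)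
  have hDK : ∀ x, ∀ t ∈ Icc 0 t₁, -((K + B) * t₁) ≤ D x t := fun x t ht => by
    have h1 := (abs_le.1 (hSt x t)).2
    have h2 := (abs_le.1 (hU.abs_time_sub_le h hf.continuous hK x hz (hsub ht))).1
    rw [hU.zero] at h2
    rw [sub_zero, abs_of_nonneg ht.1] at h1 h2
    have h3 := hG x
    have h4 : B * t ≤ B * t₁ := mul_le_mul_of_nonneg_left ht.2 hB0
    have h5 : K * t ≤ K * t₁ := mul_le_mul_of_nonneg_left ht.2 hK0
    simp only [hD]
    linarith
  have hD0 : ∀ x, 0 ≤ D x 0 := fun x => by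
    simp only [hD, hU.zero]
    linarith [hG x]
  have hneg : D x₁ t₁ < 0 := by
    simp only [hD]
    linarith
  obtain ⟨η, β, x₀, t₀, hη, ht₀, hmin⟩ := exists_isPenalizedMin ht₁.1.le hDc hDK hD0 hneg L
  have ht₀' : t₀ ∈ Ioo 0 T := ⟨hmin.time_pos, ht₀.trans_lt ht₁.2⟩
  have hSx := hasDerivAt_softmin_fst (a := a) (b := fun i => -f (a i)) (c := c) hδ x₀ t₀
  have hSt₀ := hasDerivAt_softmin_snd (a := a) (b := fun i => -f (a i)) (c := c) hδ x₀ t₀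
  -- Where `v` is continuous, both derivatives of `U` exist and the subsolution inequality yields `η
  -- ≤ L β`. At a discontinuity, stability says `r < l`, against the convex kink at a minimum.
  by_cases hc : ContinuousAt (fun q : ℝ × ℝ => v q.1 q.2) (x₀, t₀)
  · have hcx : ContinuousAt (fun y => v y t₀) x₀ :=
      hc.comp (f := fun y : ℝ => (y, t₀)) (by fun_prop)
    have hdx := hmin.abs_space_deriv_le ((hU.hasDerivAt_space h ht₀' hcx).sub hSx)
    have hdt := hmin.time_deriv ((hU.hasDerivAt_time h hf.continuous ht₀' hc).sub hSt₀)
    -- the smooth minimum is a subsolution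
    have hjensen : f (v x₀ t₀) + deriv f (v x₀ t₀) *
        ((∑ i, softWeight a (fun i => -f (a i)) c δ i (x₀, t₀) * a i) - v x₀ t₀) ≤
        ∑ i, softWeight a (fun i => -f (a i)) c δ i (x₀, t₀) * f (a i) := by
      have h1 : f (v x₀ t₀) + deriv f (v x₀ t₀) *
          ((∑ i, softWeight a (fun i => -f (a i)) c δ i (x₀, t₀) * a i) - v x₀ t₀) =
          ∑ i, softWeight a (fun i => -f (a i)) c δ i (x₀, t₀) *
            (f (v x₀ t₀) + deriv f (v x₀ t₀) * (a i - v x₀ t₀)) := by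
        have h2 : ∀ i, softWeight a (fun i => -f (a i)) c δ i (x₀, t₀) *
            (f (v x₀ t₀) + deriv f (v x₀ t₀) * (a i - v x₀ t₀)) =
            softWeight a (fun i => -f (a i)) c δ i (x₀, t₀) *
              (f (v x₀ t₀) - deriv f (v x₀ t₀) * v x₀ t₀) + deriv f (v x₀ t₀) *
              (softWeight a (fun i => -f (a i)) c δ i (x₀, t₀) * a i) := fun i => by ring
        simp only [h2]
        rw [Finset.sum_add_distrib, ← Finset.sum_mul, ← Finset.mul_sum, sum_softWeight]
        ring
      rw [h1]
      exact Finset.sum_le_sum fun i _ =>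
        mul_le_mul_of_nonneg_left (tangent_le hf hconvex _ _) (softWeight_nonneg i)
    simp only [mul_neg, Finset.sum_neg_distrib] at hdt
    have h1 : deriv f (v x₀ t₀) * (v x₀ t₀ -
        ∑ i, softWeight a (fun i => -f (a i)) c δ i (x₀, t₀) * a i) ≤ L * β := by
      refine (le_abs_self _).trans ?_
      rw [abs_mul]
      have := hL _ (h.bound x₀ t₀ ht₀')
      gcongr
    linarith
  · obtain ⟨l, r, hl, hr, hrl⟩ := hstable (x₀, t₀) ⟨trivial, ht₀'⟩ hc
    have := hmin.le_of_one_sided ((hU.hasDerivWithinAt_left h ht₀' hl).sub hSx.hasDerivWithinAt)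
      ((hU.hasDerivWithinAt_right h ht₀' hr).sub hSx.hasDerivWithinAt)
    linarith

end comparison

/-! ### Uniqueness -/

section uniqueness

variable {f : ℝ → ℝ} {u₀ e₁ e₂ x₁ x₂ : ℝ}

/-- The potential of the two-shock solution, a minimum of three affine functions. -/
def minPotential (f : ℝ → ℝ) (u₀ e₁ e₂ x₁ x₂ : ℝ) (q : ℝ × ℝ) : ℝ :=
  Finset.univ.inf' Finset.univ_nonempty fun i => statePotential f u₀ e₁ e₂ x₁ x₂ i q

lemma minPotential_le (i : Fin 3) (q : ℝ × ℝ) :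
    minPotential f u₀ e₁ e₂ x₁ x₂ q ≤ statePotential f u₀ e₁ e₂ x₁ x₂ i q :=
  Finset.inf'_le _ (Finset.mem_univ i)

lemma le_minPotential {y : ℝ} {q : ℝ × ℝ} (h : ∀ i, y ≤ statePotential f u₀ e₁ e₂ x₁ x₂ i q) :
    y ≤ minPotential f u₀ e₁ e₂ x₁ x₂ q :=
  (Finset.le_inf'_iff _ _).2 fun i _ => h i

lemma abs_state_le (u₀ e₁ e₂ : ℝ) (i : Fin 3) :
    |states u₀ e₁ e₂ i| ≤ ∑ i, |states u₀ e₁ e₂ i| :=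
  Finset.single_le_sum (f := fun i => |states u₀ e₁ e₂ i|) (fun _ _ => abs_nonneg _)
    (Finset.mem_univ i)

lemma abs_minPotential_sub_le (t x y : ℝ) :
    |minPotential f u₀ e₁ e₂ x₁ x₂ (x, t) - minPotential f u₀ e₁ e₂ x₁ x₂ (y, t)| ≤
      (∑ i, |states u₀ e₁ e₂ i|) * |x - y| := by
  have key : ∀ x y, minPotential f u₀ e₁ e₂ x₁ x₂ (x, t) -
      (∑ i, |states u₀ e₁ e₂ i|) * |x - y| ≤ minPotential f u₀ e₁ e₂ x₁ x₂ (y, t) := fun x y => by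
    refine le_minPotential fun i => ?_
    have h1 := minPotential_le (f := f) (u₀ := u₀) (e₁ := e₁) (e₂ := e₂) (x₁ := x₁) (x₂ := x₂) i
      (x, t)
    have h2 : states u₀ e₁ e₂ i * (x - y) ≤ (∑ i, |states u₀ e₁ e₂ i|) * |x - y| := by
      refine (le_abs_self _).trans ?_
      rw [abs_mul]
      exact mul_le_mul_of_nonneg_right (abs_state_le _ _ _ i) (abs_nonneg _)
    simp only [statePotential, affineFun] at h1 ⊢
    linarith
  have h1 := key x y
  have h2 := key y x
  rw [abs_sub_comm] at h2
  rw [abs_le]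
  constructor <;> linarith

lemma continuous_statePotential (i : Fin 3) :
    Continuous (statePotential f u₀ e₁ e₂ x₁ x₂ i) := by
  unfold statePotential affineFun
  fun_prop

lemma hasDerivAt_minPotential {j : Fin 3} {x t : ℝ}
    (hj : ∀ i, i ≠ j → statePotential f u₀ e₁ e₂ x₁ x₂ j (x, t) <
      statePotential f u₀ e₁ e₂ x₁ x₂ i (x, t)) :
    HasDerivAt (fun y => minPotential f u₀ e₁ e₂ x₁ x₂ (y, t)) (states u₀ e₁ e₂ j) x := by
  have hev : ∀ᶠ y in 𝓝 x, ∀ i, statePotential f u₀ e₁ e₂ x₁ x₂ j (y, t) ≤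
      statePotential f u₀ e₁ e₂ x₁ x₂ i (y, t) := by
    rw [eventually_all]
    intro i
    have hc := fun i => continuous_statePotential (f := f) (u₀ := u₀) (e₁ := e₁) (e₂ := e₂)
      (x₁ := x₁) (x₂ := x₂) i
    by_cases hi : i = j
    · subst hi
      exact Eventually.of_forall fun _ => le_rfl
    · have h1 := fun i => (((hc i).comp (by fun_prop : Continuous fun y : ℝ => (y, t))).tendsto x)
      exact ((h1 j).eventually_lt (h1 i) (hj i hi)).mono fun y hy => hy.le
  have hd : HasDerivAt (fun y => statePotential f u₀ e₁ e₂ x₁ x₂ j (y, t)) (states u₀ e₁ e₂ j) x := by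
    unfold statePotential affineFun
    simpa using (((hasDerivAt_id x).const_mul (states u₀ e₁ e₂ j)).add_const
      (-f (states u₀ e₁ e₂ j) * t)).add_const (offsets e₁ e₂ x₁ x₂ j)
  refine hd.congr_of_eventuallyEq ?_
  filter_upwards [hev] with y hy using le_antisymm (minPotential_le j _) (le_minPotential hy)

/-- Piecewise smoothness enters the uniqueness proof only as continuity off a null set with
countable time slices. -/
lemma IsIntegralSolution.exists_isRegular {T : ℝ} {g : ℝ → ℝ} {v : ℝ → ℝ → ℝ}
    (hv : IsIntegralSolution f T g v) (M₀ : ℝ) : ∃ M Z, M₀ ≤ M ∧ IsRegular T M v Z := by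
  obtain ⟨M, hM⟩ := hv.bounded
  obtain ⟨J, γ, hJ, hγ, -, hs⟩ := hv.piecewise_smooth
  have hZ := volume_curves hJ hγ
  refine ⟨max M₀ M, curves J γ, le_max_left _ _,
    fun x t ht => (hM (x, t) ⟨trivial, ht⟩).trans (le_max_right _ _), hZ.1, hZ.2,
    countable_curves_slice J γ, fun x t ht hx => ?_⟩
  exact (hs (x, t) ⟨trivial, ht⟩ fun i hi heq => hx ⟨i, hi, heq⟩).continuousAt

lemma ae_eq_twoShock (hf : ContDiff ℝ ∞ f) (hconvex : ∀ v, 0 ≤ deriv (deriv f) v)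
    (he₁ : 0 < e₁) (he₂ : 0 < e₂) (hx : x₁ < x₂)
    (hD : 0 < e₂ * f (u₀ + e₁ + e₂) - (e₁ + e₂) * f (u₀ + e₂) + e₁ * f u₀) {T : ℝ}
    {v : ℝ → ℝ → ℝ} (hv : IsIntegralSolution f T (initialData u₀ e₁ e₂ x₁ x₂) v) :
    ∀ᵐ p ∂(volume.restrict (strip T)), v p.1 p.2 = twoShock f u₀ e₁ e₂ x₁ x₂ p.1 p.2 := by
  -- One constant bounds `v` and the initial value, and is a Lipschitz constant for the initial
  -- potential.
  obtain ⟨M, Z, hM, h⟩ := hv.exists_isRegular (∑ i, |states u₀ e₁ e₂ i|)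
  have hg0 : ∀ x, initialData u₀ e₁ e₂ x₁ x₂ x = twoShock f u₀ e₁ e₂ x₁ x₂ x 0 := fun x => by
    rw [initialData_eq_heaviside hx, twoShock, phase₁_zero he₁ he₂ hx hD,
      phase₂_zero he₁ he₂ hx hD]
  have hgm : Measurable (initialData u₀ e₁ e₂ x₁ x₂) := by
    rw [show initialData u₀ e₁ e₂ x₁ x₂ = _ from funext fun x => initialData_eq_heaviside hx x]
    have h1 := fun a : ℝ => measurable_heaviside.comp (by fun_prop : Measurable fun x : ℝ => -x + a)
    exact (((h1 x₁).const_mul e₁).const_add u₀).add ((h1 x₂).const_mul e₂)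
  have hgb : ∀ x, |initialData u₀ e₁ e₂ x₁ x₂ x| ≤ M := fun x => by
    refine le_trans ?_ hM
    unfold initialData
    split_ifs
    · exact abs_state_le u₀ e₁ e₂ 0
    · exact abs_state_le u₀ e₁ e₂ 1
    · exact abs_state_le u₀ e₁ e₂ 2
  -- The initial potential is the minimum of the affine functions at `t = 0`; off `x₁` and `x₂` its
  -- derivative is the initial value, by the strict-minimum description of `u*`.
  obtain ⟨U, hU⟩ := h.exists_potential hf.continuous hv.identity
    (g := initialData u₀ e₁ e₂ x₁ x₂) (G := fun x => minPotential f u₀ e₁ e₂ x₁ x₂ (x, 0))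
    (C := {x₁, x₂}) (by simp)
    (fun x y => (abs_minPotential_sub_le 0 x y).trans
      (mul_le_mul_of_nonneg_right hM (abs_nonneg _)))
    (fun x hxC => by
      have hxC' : x ≠ x₁ ∧ x ≠ x₂ := by simpa [not_or] using hxC
      obtain ⟨j, hj, hval⟩ := exists_strict_min (x₁ := x₁) (x₂ := x₂) (x := x) (t := 0) he₁ he₂ hD
        (by rw [phase₁_zero he₁ he₂ hx hD]; exact hxC'.1)
        (by rw [phase₂_zero he₁ he₂ hx hD]; exact hxC'.2)
      rw [hg0, hval]
      exact hasDerivAt_minPotential hj)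
    hgm.aestronglyMeasurable hgb hv.initial
  have hUV : ∀ x, ∀ t ∈ Ioo 0 T, U x t = minPotential f u₀ e₁ e₂ x₁ x₂ (x, t) := by
    intro x t ht
    refine le_antisymm (le_minPotential fun i => ?_) ?_
    · have h1 := hU.le_affine h hf hconvex (p := states u₀ e₁ e₂ i) (c := offsets e₁ e₂ x₁ x₂ i)
        (fun x => by
          have := minPotential_le (f := f) (u₀ := u₀) (e₁ := e₁) (e₂ := e₂) (x₁ := x₁) (x₂ := x₂)
            i (x, 0)
          simpa [statePotential, affineFun] using this) (x₁ := x) ht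
      simp only [statePotential, affineFun]
      linarith
    -- The soft minima lie below `U` for every `δ > 0`, and within `δ log 3` of the true minimum.
    · have hlim : Tendsto (fun δ : ℝ => minPotential f u₀ e₁ e₂ x₁ x₂ (x, t) -
          δ * Real.log (Fintype.card (Fin 3))) (𝓝[>] 0)
          (𝓝 (minPotential f u₀ e₁ e₂ x₁ x₂ (x, t))) :=
        (Continuous.tendsto' (by fun_prop) 0 _ (by simp)).mono_left nhdsWithin_le_nhds
      refine le_of_tendsto hlim ?_
      filter_upwards [self_mem_nhdsWithin] with δ hδ
      refine (le_softmin (a := states u₀ e₁ e₂) (b := fun i => -f (states u₀ e₁ e₂ i))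
        (c := offsets e₁ e₂ x₁ x₂) hδ fun i => minPotential_le i (x, t)).trans ?_
      exact hU.softmin_le h hv.stable hf hconvex hδ
        (fun x => le_minPotential fun i => softmin_le hδ i) ht
  rw [ae_restrict_iff' (measurableSet_strip T)]
  filter_upwards [measure_eq_zero_iff_ae_notMem.1 h.null,
    ae_notMem_shockCurves (x₁ := x₁) (x₂ := x₂) he₁ he₂ hD] with p hpZ hpS hp
  obtain ⟨h1, h2⟩ := ne_phases_of_notMem_curves hpS
  obtain ⟨j, hj, hval⟩ := exists_strict_min he₁ he₂ hD h1 h2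
  rw [hval]
  have hd := hU.hasDerivAt_space h hp.2 (h.continuousAt_slice hp.2 hpZ)
  simp only [fun x => hUV x p.2 hp.2] at hd
  exact hd.unique (hasDerivAt_minPotential hj)

end uniqueness

end

end Shock

theorem theorem1p5 (f : ℝ → ℝ) (u₀ e₁ e₂ x₁ x₂ : ℝ)
    (hf : ContDiff ℝ ∞ f) (hconvex : ∀ v, 0 ≤ deriv (deriv f) v)
    (hnondeg : ∃ v ∈ Icc u₀ (u₀ + e₁ + e₂), 0 < deriv (deriv f) v)
    (he₁ : 0 < e₁) (he₂ : 0 < e₂) (hx : x₁ < x₂) :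
    -- `u*` is a weak limit of asymptotic solutions, whatever the averaging kernels are
    (∀ κ₁ κ₂ : ℝ → ℝ, Shock.IsKernel κ₁ → Shock.IsKernel κ₂ →
      Shock.IsWeakLimitSolution f ![κ₁, κ₂] (fun _ _ => u₀) ![fun _ _ => e₁, fun _ _ => e₂]
        (Shock.initialData u₀ e₁ e₂ x₁ x₂) (Shock.twoShock f u₀ e₁ e₂ x₁ x₂)) ∧
    -- two separate shocks before the merging time, one shock afterwards
    0 < Shock.mergeTime f u₀ e₁ e₂ x₁ x₂ ∧
    (∀ t ∈ Ico 0 (Shock.mergeTime f u₀ e₁ e₂ x₁ x₂),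
      Shock.phase₁ f u₀ e₁ e₂ x₁ x₂ t = x₁ + Shock.speed f (u₀ + e₁ + e₂) (u₀ + e₂) * t ∧
      Shock.phase₂ f u₀ e₁ e₂ x₁ x₂ t = x₂ + Shock.speed f (u₀ + e₂) u₀ * t ∧
      Shock.phase₁ f u₀ e₁ e₂ x₁ x₂ t < Shock.phase₂ f u₀ e₁ e₂ x₁ x₂ t) ∧
    (∀ t ≥ Shock.mergeTime f u₀ e₁ e₂ x₁ x₂,
      Shock.phase₁ f u₀ e₁ e₂ x₁ x₂ t = Shock.mergePoint f u₀ e₁ e₂ x₁ x₂ +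
        (f (u₀ + e₁ + e₂) - f u₀) / (e₁ + e₂) * (t - Shock.mergeTime f u₀ e₁ e₂ x₁ x₂) ∧
      Shock.phase₂ f u₀ e₁ e₂ x₁ x₂ t = Shock.mergePoint f u₀ e₁ e₂ x₁ x₂ +
        (f (u₀ + e₁ + e₂) - f u₀) / (e₁ + e₂) * (t - Shock.mergeTime f u₀ e₁ e₂ x₁ x₂)) ∧
    -- `u*` is the unique generalized solution in the sense of the integral identity
    (∀ T > 0,
      Shock.IsIntegralSolution f T (Shock.initialData u₀ e₁ e₂ x₁ x₂)
        (Shock.twoShock f u₀ e₁ e₂ x₁ x₂) ∧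
      ∀ v : ℝ → ℝ → ℝ,
        Shock.IsIntegralSolution f T (Shock.initialData u₀ e₁ e₂ x₁ x₂) v →
        ∀ᵐ p ∂(volume.restrict (Shock.strip T)),
          v p.1 p.2 = Shock.twoShock f u₀ e₁ e₂ x₁ x₂ p.1 p.2) := by
  -- The nondegeneracy of `f''` enters through `D > 0` alone.
  have hD := Shock.three_point_pos hf hconvex hnondeg he₁ he₂
  refine ⟨fun κ₁ κ₂ h₁ h₂ => Shock.isWeakLimitSolution_twoShock
      (Fin.forall_fin_two.2 ⟨h₁, h₂⟩) hf he₁ he₂ hx hD,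
    Shock.mergeTime_pos he₁ he₂ hx hD,
    fun t ht => Shock.phases_before_merge he₁ he₂ hD ht.2,
    fun t ht => Shock.phases_after_merge he₁ he₂ hD ht,
    fun T _ => ⟨Shock.isIntegralSolution_twoShock he₁ he₂ hx hD T,
      fun v hv => Shock.ae_eq_twoShock hf hconvex he₁ he₂ hx hD hv⟩⟩
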